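/- \textbf{Setting.} Let $S_X,S_\eta:\mathbb R\to[0,\infty)$ be measurable even functions with $\sigma_X^2=\int_{\mathbb R} S_X(f)\,df<\infty$ ($S_\eta$ need not be integrable; quotients $0/0$ are read as $0$), and put $S_{X+\eta}=S_X+S_\eta$. Let $X(\cdot)$ be a real, centred, stationary Gaussian process with power spectral density $S_X$, i.e. $\mathbb E[X(t)X(s)]=\int S_X(f)e^{2\pi i f(t-s)}\,df$. Let $\eta(\cdot)$ be a real, centred, stationary (possibly generalized) Gaussian noise with power spectral density $S_\eta$, independent of $X$: its responses $\eta(g)$ to transfer functions $g$ with $g(-f)=\overline{g(f)}$ and $\int|g|^2S_\eta<\infty$ are jointly Gaussian and centred, with $\mathbb E[\eta(g)\eta(h)]=\int g\,\overline{h}\,S_\eta\,df$. Fix $f_s>0$. For $P\in\mathbb N$, $P\ge 1$, an admissible filter bank consists of $P$ LTI filters with real impulse responses, given by measurable $H_1,\dots,H_P:\mathbb R\to\mathbb C$ with $H_p(-f)=\overline{H_p(f)}$ and $\int |H_p|^2S_{X+\eta}\,df<\infty$. Let $Z_p(\cdot)$ be the output of $H_p$ with input $X+\eta$ (filtering in the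 mean-square spectral sense), let $Y_p[n]=Z_p(nP/f_s)$, $n\in\mathbb Z$, $\mathbf Y=(Y_1,\dots,Y_P)$, and \[ \mathsf{mmse}_{X|\mathbf Y}(f_s)=\lim_{T\to\infty}\frac1{2T}\int_{-T}^{T}\mathbb E\Big[\big(X(t)-\mathbb E[X(t)\mid \mathbf Y]\big)^2\Big]dt . \] Let $\mathsf{mmse}^\star_{X|\mathbf Y}(f_s;P)$ be the infimum of $\mathsf{mmse}_{X|\mathbf Y}(f_s)$ over all admissible filter banks with $P$ branches, and let \[ L(f_s)=\sigma_X^2-\sup_{\mu(F)\le f_s}\int_F\frac{S_X^2(f)}{S_{X+\eta}(f)}\,df , \] the supremum being over measurable $F\subset\mathbb R$ of Lebesgue measure $\mu(F)$ at most $f_s$. \textbf{Theorem.} (a) For every $P\ge1$ and every admissible filter bank, the outputs $Z_p$ exist, the limit defining $\mathsf{mmse}_{X|\mathbf Y}(f_s)$ exists, and $\mathsf{mmse}_{X|\mathbf Y}(f_s)\ge L(f_s)$. (b) For every $\epsilon>0$ there exist $P\ge1$ and an admissible filter bank $H_1^\star,\dots,H_P^\star$ whose MMSE $m$ satisfies \[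 L(f_s)\le \mathsf{mmse}^\star_{X|\mathbf Y}(f_s;P)\le m< L(f_s)+\epsilon . \] (c) Hence $\lim_{P\to\infty}\mathsf{mmse}^\star_{X|\mathbf Y}(f_s;P)=L(f_s)$. -/

import Mathlib

open MeasureTheory ProbabilityTheory Filter Topology

noncomputable section

namespace SubNyquist

/-- The complex exponential `e^{2πi f t}`. -/
def wave (f t : ℝ) : ℂ := Complex.exp (2 * (Real.pi : ℂ) * Complex.I * (f : ℂ) * (t : ℂ))

/-- A power spectral density of a real-valued stationary signal: a measurable, nonnegative,
even function of the frequency. No integrability is required here. -/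
structure IsPSD (S : ℝ → ℝ) : Prop where
  measurable : Measurable S
  nonneg : ∀ f, 0 ≤ S f
  even : ∀ f, S (-f) = S f

/-- `H` is the frequency response of a real LTI system (real impulse response, i.e.
`H (-f)` is the conjugate of `H f`) whose response to a signal with power spectral density `S`
has finite power: `∫ |H|² S < ∞`. -/
structure IsFilter (S : ℝ → ℝ) (H : ℝ → ℂ) : Prop where
  measurable : Measurable H
  hermitian : ∀ f, H (-f) = (starRingEnd ℂ) (H f)
  finitePower : Integrable (fun f => ‖H f‖ ^ 2 * S f)

variable {Ω : Type*} [MeasurableSpace Ω]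

/-- `X` is a real, centred, stationary Gaussian signal with power spectral density `S`:
`E[X(t) X(s)] = ∫ S(f) e^{2πi f (t-s)} df`. -/
structure IsStationaryGaussian (μ : Measure Ω) (S : ℝ → ℝ) (X : ℝ → Ω → ℝ) : Prop where
  measurable : ∀ t, Measurable (X t)
  gaussian : IsGaussianProcess X μ
  centred : ∀ t, ∫ ω, X t ω ∂μ = 0
  spectrum : ∀ t s, ((∫ ω, X t ω * X s ω ∂μ : ℝ) : ℂ) = ∫ f, (S f : ℂ) * wave f (t - s)

/-- `η` is a real, centred, stationary Gaussian noise with power spectral density `S`. As `S`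
need not be integrable (white noise, for instance), the noise is a generalized signal: it is
given by its responses `η g` (at time `0`) to the real LTI systems `g` with
`∫ |g|² S < ∞`, which are jointly Gaussian with
`E[η(g) η(h)] = ∫ g(f) conj(h(f)) S(f) df`. The response of `g` at time `t` is the response at
time `0` of `f ↦ g(f) e^{2πi f t}`. -/
structure IsStationaryGaussianNoise (μ : Measure Ω) (S : ℝ → ℝ)
    (η : {g : ℝ → ℂ // IsFilter S g} → Ω → ℝ) : Prop where
  measurable : ∀ g, Measurable (η g)
  gaussian : IsGaussianProcess η μ
  centred : ∀ g, ∫ ω, η g ω ∂μ = 0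
  spectrum : ∀ g h, ((∫ ω, η g ω * η h ω ∂μ : ℝ) : ℂ) =
    ∫ f, g.1 f * (starRingEnd ℂ) (h.1 f) * (S f : ℂ)

/-- `U` is the value at time `t` of the output of the LTI system with frequency response `H`
driven by the signal `X` with power spectral density `S`: it is the mean square limit of finite
superpositions `∑ c s * X s` whose frequency responses `∑ c s * e^{2πi f s}` converge to
`H(f) e^{2πi f t}` in `L²(S(f) df)`. -/
def IsResponse (μ : Measure Ω) (S : ℝ → ℝ) (X : ℝ → Ω → ℝ) (H : ℝ → ℂ) (t : ℝ)
    (U : Ω → ℝ) : Prop :=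
  MemLp U 2 μ ∧
  ∀ ε > 0, ∃ c : ℝ →₀ ℝ,
    ∫ f, ‖H f * wave f t - c.sum (fun s a => (a : ℂ) * wave f s)‖ ^ 2 * S f < ε ∧
    ∫ ω, (U ω - c.sum (fun s a => a * X s ω)) ^ 2 ∂μ < ε

/-- `Z 0, …, Z (P-1)` are the outputs of the LTI systems `H 0, …, H (P-1)`, all driven by the
noisy source `X + η`. -/
structure IsFilterBankOutput (μ : Measure Ω) (SX Sη : ℝ → ℝ) (X : ℝ → Ω → ℝ)
    (η : {g : ℝ → ℂ // IsFilter Sη g} → Ω → ℝ) {P : ℕ} (H : Fin P → ℝ → ℂ)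
    (Z : Fin P → ℝ → Ω → ℝ) : Prop where
  measurable : ∀ p t, Measurable (Z p t)
  response : ∀ p t, ∃ (U : Ω → ℝ) (g : {g : ℝ → ℂ // IsFilter Sη g}),
    IsResponse μ SX X (H p) t U ∧ (∀ f, g.1 f = H p f * wave f t) ∧
    Z p t =ᵐ[μ] fun ω => U ω + η g ω

/-- The samples `Y_p[n] = Z_p(n P / fs)`: each of the `P` branches is sampled uniformly with
frequency `fs / P`. -/
def samples {P : ℕ} (fs : ℝ) (Z : Fin P → ℝ → Ω → ℝ) (p : Fin P) (n : ℤ) : Ω → ℝ :=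
  Z p ((n : ℝ) * (P : ℝ) / fs)

/-- The σ-algebra generated by all samples of all branches. -/
abbrev sigmaSamples {P : ℕ} (Y : Fin P → ℤ → Ω → ℝ) : MeasurableSpace Ω :=
  ⨆ (p : Fin P) (n : ℤ), MeasurableSpace.comap (Y p n) inferInstance

/-- `m` is the minimal mean squared error in estimating `X` from `Y`: the limit as `T → ∞` of
`(1/2T) ∫_{-T}^{T} E[(X(t) - E[X(t) | Y])²] dt`. -/
def HasMMSE (μ : Measure Ω) (X : ℝ → Ω → ℝ) {P : ℕ} (Y : Fin P → ℤ → Ω → ℝ) (m : ℝ) : Prop :=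
  Tendsto (fun T : ℝ => 1 / (2 * T) *
      ∫ t in (-T)..T, ∫ ω, (X t ω - (μ[X t | sigmaSamples Y]) ω) ^ 2 ∂μ)
    atTop (𝓝 m)

/-- The optimal MMSE under `P`-branch uniform sampling with total sampling frequency `fs`: the
infimum of the MMSE over all banks of `P` admissible pre-sampling filters. -/
def optimalMMSE (μ : Measure Ω) (SX Sη : ℝ → ℝ) (X : ℝ → Ω → ℝ)
    (η : {g : ℝ → ℂ // IsFilter Sη g} → Ω → ℝ) (fs : ℝ) (P : ℕ) : ℝ :=
  sInf {m : ℝ | ∃ (H : Fin P → ℝ → ℂ) (Z : Fin P → ℝ → Ω → ℝ),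
    (∀ p, IsFilter (fun f => SX f + Sη f) (H p)) ∧
    IsFilterBankOutput μ SX Sη X η H Z ∧ HasMMSE μ X (samples fs Z) m}

/-- `σ_X² - sup_{μ(F) ≤ fs} ∫_F S_X² / S_{X+η}`, the supremum being over all measurable sets
of Lebesgue measure at most `fs`. -/
def landauBound (SX Sη : ℝ → ℝ) (fs : ℝ) : ℝ :=
  (∫ f, SX f) -
    sSup {r : ℝ | ∃ F : Set ℝ, MeasurableSet F ∧ volume F ≤ ENNReal.ofReal fs ∧
      r = ∫ f in F, SX f ^ 2 / (SX f + Sη f)}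

end SubNyquist

end

noncomputable section

namespace SubNyquist

/-! ### Gaussian Hilbert spaces and conditional expectation as projection -/

section

variable {Ω : Type*} [MeasurableSpace Ω]

/-! Everything takes place in Hilbert space. Since all variables are jointly Gaussian and centred,
`E[X(t) | Y]` is the orthogonal projection of `X(t)` onto the closed span of the samples
(`integral_sub_condExp_sq`), so the error at time `t` is a squared distance. A spectral isometry
(`norm_sq_fst_of_mem_spectralGraph`) sends a random variable to its pair of frequency responses in
`L²(S_X) ⊕ L²(S_η)`. A finite combination of samples has the same response `G` to signal and noise,
and `G = ∑ C_p H_p` with coefficients `C_p` of period `Δ = fs / P`. Write `ρ = S_X² / S_{X+η}`.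
Completing the square (`norm_sq_mul_add_norm_sq_mul`) turns the error into the constant `∫ (S_X -
ρ)` plus the unweighted squared `L²` distance between `√ρ e^{2πift}` and `√S_{X+η} G`. Delaying by
one sampling period leaves the problem unchanged, so the error is periodic in `t` with period `P /
fs`; being continuous as well, it has a time average, namely its mean over one period.

Lower bound. Split the frequency axis into fibres `{f + kΔ}`, `0 ≤ f < Δ`. In a fibre the reachable
vectors lie in a space of dimension at most `P` which does not depend on `t`, while the coordinates
of the target rotate at different speeds. Averaging over a period makes these coordinates
uncorrelated, so the captured energy is `∑ w_k ρ(f + kΔ)` with `0 ≤ w_k ≤ 1` and `∑ w_k ≤ P`; this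
is at most the sum of the `P` largest values (`exists_finset_le_integral_norm_sub_starProjection`).
The best aliases, chosen measurably in `f`, sweep out a set of measure at most `PΔ = fs`
(`exists_best_aliases`), and the supremum in the bound is over such sets.

Upper bound. A band on which reduction modulo `Δ` is injective suffers no aliasing, so one branch
passing only this band recovers all of `ρ` there, by density of the exponentials
(`mseAt_bandFilter_le`). It remains to approximate a nearly optimal set by `P` disjoint, symmetric,
alias-free bands. Symmetric pairs of intervals of length `fs / (2P)` will do: `ρ` is close in `L¹`
to an even uniformly continuous function, which is nearly constant on small cells, and the
fractional cover of the cells by the set is again no better than the `P` best cells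
(`exists_finset_setIntegral_le_sum_cell`). -/

lemma continuous_integral_Lp_two (μ : Measure Ω) [IsProbabilityMeasure μ] :
    Continuous fun u : Lp ℝ 2 μ => ∫ ω, u ω ∂μ := by
  have h (u : Lp ℝ 2 μ) : ∫ ω, u ω ∂μ = inner ℝ (Lp.const 2 μ (1 : ℝ)) u := by
    rw [L2.inner_def]
    refine integral_congr_ae ?_
    filter_upwards [Lp.coeFn_const (p := 2) (μ := μ) (1 : ℝ)] with ω hω
    simp
  simp_rw [h]
  fun_prop

lemma integral_sq_Lp_two (μ : Measure Ω) (u : Lp ℝ 2 μ) : ∫ ω, (u ω) ^ 2 ∂μ = ‖u‖ ^ 2 := by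
  rw [← real_inner_self_eq_norm_sq, L2.inner_def]
  simp [pow_two]

lemma integral_abs_sub_le_norm_sub (μ : Measure Ω) [IsProbabilityMeasure μ] (u v : Lp ℝ 2 μ) :
    ∫ ω, |u ω - v ω| ∂μ ≤ ‖u - v‖ := by
  have h1 : ∫ ω, |u ω - v ω| ∂μ = (eLpNorm (u - v : Lp ℝ 2 μ) 1 μ).toReal := by
    rw [eLpNorm_one_eq_lintegral_enorm, integral_eq_lintegral_of_nonneg_ae
      (ae_of_all _ fun _ => abs_nonneg _)]
    · congr 1
      refine lintegral_congr_ae ?_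
      filter_upwards [Lp.coeFn_sub u v] with ω hω
      rw [hω, Pi.sub_apply, ← Real.norm_eq_abs, ofReal_norm]
    · exact ((Lp.aestronglyMeasurable u).sub (Lp.aestronglyMeasurable v)).norm
  rw [h1, Lp.norm_def]
  refine ENNReal.toReal_mono (Lp.eLpNorm_ne_top _) ?_
  exact eLpNorm_le_eLpNorm_of_exponent_le (by norm_num) (Lp.aestronglyMeasurable _)

lemma norm_cexp_sub_cexp_le (t x y : ℝ) :
    ‖Complex.exp (t * x * Complex.I) - Complex.exp (t * y * Complex.I)‖ ≤ |t| * |x - y| := by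
  have h : Complex.exp (t * x * Complex.I) - Complex.exp (t * y * Complex.I)
      = Complex.exp ((t * y : ℝ) * Complex.I)
        * (Complex.exp (Complex.I * (t * (x - y) : ℝ)) - 1) := by
    rw [mul_sub, ← Complex.exp_add, mul_one]
    congr 2 <;> push_cast <;> ring
  rw [h, norm_mul, Complex.norm_exp_ofReal_mul_I, one_mul, ← abs_mul]
  exact Real.norm_exp_I_mul_ofReal_sub_one_le

/-- The characteristic function at `t` is Lipschitz with constant `|t|` for the `L¹` distance, which
the `L²` distance dominates. -/
lemma continuous_integral_cexp (μ : Measure Ω) [IsProbabilityMeasure μ] (t : ℝ) :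
    Continuous fun u : Lp ℝ 2 μ => ∫ ω, Complex.exp (t * u ω * Complex.I) ∂μ := by
  have hint (u : Lp ℝ 2 μ) : Integrable (fun ω => Complex.exp (t * u ω * Complex.I)) μ := by
    refine Integrable.of_bound (C := 1) ?_ (ae_of_all _ fun ω => ?_)
    · exact (by fun_prop : Continuous fun x : ℝ => Complex.exp (t * x *
        Complex.I)).comp_aestronglyMeasurable
        (Lp.aestronglyMeasurable u)
    · rw [← Complex.ofReal_mul, Complex.norm_exp_ofReal_mul_I]
  refine (LipschitzWith.of_dist_le_mul (K := ‖t‖₊) fun u v => ?_).continuous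
  rw [dist_eq_norm, dist_eq_norm, ← integral_sub (hint u) (hint v)]
  calc ‖∫ ω, (Complex.exp (t * u ω * Complex.I) - Complex.exp (t * v ω * Complex.I)) ∂μ‖
      ≤ ∫ ω, |t| * |u ω - v ω| ∂μ := by
        refine norm_integral_le_of_norm_le ?_ (ae_of_all _ fun ω => norm_cexp_sub_cexp_le _ _ _)
        exact ((((Lp.memLp u).sub (Lp.memLp v)).integrable (by norm_num)).abs).const_mul _
    _ ≤ ‖t‖₊ * ‖u - v‖ := by
        rw [integral_const_mul]
        gcongr
        · simp
        · exact integral_abs_sub_le_norm_sub μ u v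

/-- Mean square limits of Gaussian variables are Gaussian. -/
lemma isClosed_hasGaussianLaw (μ : Measure Ω) [IsProbabilityMeasure μ] :
    IsClosed {u : Lp ℝ 2 μ | HasGaussianLaw u μ} := by
  -- With the variance written as `‖u‖²` minus the squared mean, being Gaussian becomes one equation
  -- for each `t` between continuous functions of `u`.
  have h (u : Lp ℝ 2 μ) : HasGaussianLaw u μ ↔ ∀ t : ℝ,
      ∫ ω, Complex.exp (t * u ω * Complex.I) ∂μ
        = Complex.exp ((t * ∫ ω, u ω ∂μ : ℝ) * Complex.I
          - (t ^ 2 * (‖u‖ ^ 2 - (∫ ω, u ω ∂μ) ^ 2) : ℝ) / 2) := by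
    have hu := Lp.memLp u
    rw [hasGaussianLaw_iff_charFun_map_eq hu.aemeasurable]
    refine forall_congr' fun t => ?_
    rw [charFun_apply_real, integral_map hu.aemeasurable (by fun_prop)]
    simp only [RCLike.inner_apply', conj_trivial]
    rw [integral_const_mul, variance_const_mul, variance_eq_sub hu]
    simp only [Pi.pow_apply, integral_sq_Lp_two]
  simp_rw [h, Set.ofPred_forall]
  refine isClosed_iInter fun t => isClosed_eq (continuous_integral_cexp μ t) ?_
  have := continuous_integral_Lp_two μ
  fun_prop

/-- Cramér–Wold: a linear functional of finitely many of the variables agrees almost everywhere with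
an element of `M`, because `M` is a subspace. -/
lemma isGaussianProcess_of_mem {ι : Type*} (μ : Measure Ω) [IsProbabilityMeasure μ]
    (M : Submodule ℝ (Lp ℝ 2 μ)) (hM : ∀ u ∈ M, HasGaussianLaw u μ) (Y : ι → Ω → ℝ)
    (hY : ∀ i, ∃ u ∈ M, Y i =ᵐ[μ] u) : IsGaussianProcess Y μ := by
  classical
  choose y hyM hy using hY
  have hae (i) : AEMeasurable (Y i) μ := (Lp.memLp (y i)).aemeasurable.congr (hy i).symm
  refine ⟨fun I => ⟨isGaussian_of_isGaussian_map fun L => ?_⟩⟩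
  have hm : AEMeasurable (fun ω ↦ I.restrict (Y · ω)) μ :=
    aemeasurable_pi_lambda _ fun i => hae i
  rw [AEMeasurable.map_map_of_aemeasurable (by fun_prop) hm]
  have hsum : (L ∘ fun ω ↦ I.restrict (Y · ω)) =ᵐ[μ]
      ((∑ i : I, L (Pi.single i 1) • y i : Lp ℝ 2 μ) : Ω → ℝ) := by
    have h1 := Lp.coeFn_finsetSum (p := 2) (μ := μ) Finset.univ (fun i : I => L (Pi.single i 1) • y
        i)
    have h2 : ∀ᵐ ω ∂μ, ∀ i : I, (L (Pi.single i 1) • y i : Lp ℝ 2 μ) ω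
        = L (Pi.single i 1) * Y i ω := by
      rw [ae_all_iff]
      intro i
      filter_upwards [Lp.coeFn_smul (L (Pi.single i 1)) (y i), hy i] with ω h3 h4
      rw [h3, Pi.smul_apply, smul_eq_mul, h4]
    filter_upwards [h1, h2] with ω h1 h2
    rw [h1, Finset.sum_apply]
    simp_rw [h2]
    simp only [Function.comp_apply]
    conv_lhs => rw [← Finset.univ_sum_single (I.restrict (Y · ω)), map_sum]
    refine Finset.sum_congr rfl fun i _ => ?_
    have : (Pi.single i (I.restrict (Y · ω) i) : I → ℝ) = (Y i ω) • Pi.single i 1 := by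
      rw [← Pi.single_smul]; simp
    rw [this, map_smul, smul_eq_mul, mul_comm]
  rw [Measure.map_congr hsum]
  exact (hM _ (M.sum_mem fun i _ => M.smul_mem _ (hyM _))).isGaussian_map

lemma measurable_iSup_comap {Ω ι : Type*} (Y : ι → Ω → ℝ) (i : ι) :
    Measurable[⨆ j, MeasurableSpace.comap (Y j) inferInstance] (Y i) :=
  (comap_measurable (Y i)).mono (le_iSup (fun j => MeasurableSpace.comap (Y j) _) i) le_rfl

/-- A Gaussian variable that is uncorrelated with a jointly Gaussian family has vanishing
conditional expectation with respect to it. -/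
lemma condExp_eq_zero_of_inner_eq_zero {ι : Type*} (μ : Measure Ω) [IsProbabilityMeasure μ]
    (M : Submodule ℝ (Lp ℝ 2 μ)) (hM : ∀ u ∈ M, HasGaussianLaw u μ)
    (hM0 : ∀ u ∈ M, ∫ ω, u ω ∂μ = 0) (Y : ι → Ω → ℝ) (y : ι → Lp ℝ 2 μ)
    (hYm : ∀ i, Measurable (Y i)) (hY : ∀ i, Y i =ᵐ[μ] y i) (hyM : ∀ i, y i ∈ M)
    (r : Lp ℝ 2 μ) (hr : r ∈ M) (hort : ∀ i, inner ℝ (y i) r = 0) :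
    μ[r | ⨆ i, MeasurableSpace.comap (Y i) inferInstance] =ᵐ[μ] 0 := by
  -- The residual is adjoined to the observations as one more index; joint Gaussianity then upgrades
  -- zero covariance to independence.
  have hgauss : IsGaussianProcess (Sum.elim (fun _ : Unit => (r : Ω → ℝ)) Y) μ := by
    refine isGaussianProcess_of_mem μ M hM _ fun i => ?_
    rcases i with i | i
    · exact ⟨r, hr, Filter.EventuallyEq.rfl⟩
    · exact ⟨y i, hyM i, hY i⟩
  have hind := hgauss.indepFun_of_covariance_eq_zero
    (fun _ => (Lp.memLp r).aemeasurable) (fun i => (hYm i).aemeasurable) (fun _ i => by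
      rw [covariance_eq_sub (Lp.memLp r) ((memLp_congr_ae (hY i)).2 (Lp.memLp _)), hM0 r hr]
      have h1 : ∫ ω, (r * Y i) ω ∂μ = inner ℝ (y i) r := by
        rw [L2.inner_def]
        refine integral_congr_ae ?_
        filter_upwards [hY i] with ω hω
        simp [hω]
      rw [h1, hort i]
      simp)
  have hm : (⨆ i, MeasurableSpace.comap (Y i) inferInstance) ≤ ‹MeasurableSpace Ω› :=
    iSup_le fun i => (hYm i).comap_le
  have hcomap : MeasurableSpace.comap (fun ω t => Y t ω) MeasurableSpace.pi
      = ⨆ i, MeasurableSpace.comap (Y i) inferInstance := by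
    rw [MeasurableSpace.pi, MeasurableSpace.comap_iSup]
    simp only [MeasurableSpace.comap_comp]
    rfl
  have hri : Indep (MeasurableSpace.comap (r : Ω → ℝ) inferInstance)
      (⨆ i, MeasurableSpace.comap (Y i) inferInstance) μ := by
    have h2 := (IndepFun_iff_Indep _ _ _).1
      (hind.comp (measurable_pi_apply (X := fun _ : Unit => ℝ) ()) measurable_id)
    rwa [show (id ∘ fun ω t => Y t ω) = fun ω t => Y t ω from rfl, hcomap] at h2
  have hrs := Lp.stronglyMeasurable r
  refine (condExp_indep_eq hrs.measurable.comap_le hm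
    (comap_measurable (r : Ω → ℝ)).stronglyMeasurable hri).trans ?_
  rw [hM0 r hr]
  rfl

/-- For jointly Gaussian variables the conditional expectation is the orthogonal projection onto
the closed linear span of the observations. -/
lemma integral_sub_condExp_sq {ι : Type*} (μ : Measure Ω) [IsProbabilityMeasure μ]
    (M : Submodule ℝ (Lp ℝ 2 μ)) (hMc : IsClosed (M : Set (Lp ℝ 2 μ)))
    (hM : ∀ u ∈ M, HasGaussianLaw u μ)
    (hM0 : ∀ u ∈ M, ∫ ω, u ω ∂μ = 0) (Y : ι → Ω → ℝ) (y : ι → Lp ℝ 2 μ)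
    (hYm : ∀ i, Measurable (Y i)) (hY : ∀ i, Y i =ᵐ[μ] y i) (hyM : ∀ i, y i ∈ M)
    (X : Ω → ℝ) (x : Lp ℝ 2 μ) (hX : X =ᵐ[μ] x) (hx : x ∈ M) :
    ∫ ω, (X ω - (μ[X | ⨆ i, MeasurableSpace.comap (Y i) inferInstance]) ω) ^ 2 ∂μ
      = ‖x - (Submodule.span ℝ (Set.range y)).topologicalClosure.starProjection x‖ ^ 2 := by
  set V := (Submodule.span ℝ (Set.range y)).topologicalClosure with hV
  have hm : (⨆ i, MeasurableSpace.comap (Y i) inferInstance) ≤ ‹MeasurableSpace Ω› :=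
    iSup_le fun i => (hYm i).comap_le
  have hVM : V ≤ M := Submodule.topologicalClosure_minimal _
    (Submodule.span_le.2 (by rintro _ ⟨i, rfl⟩; exact hyM i)) hMc
  set p := V.starProjection x with hp
  have hpV : p ∈ V := Submodule.starProjection_apply_mem _ _
  have hort (i) : inner ℝ (y i) (x - p) = 0 :=
    (V.mem_orthogonal _).1 (Submodule.sub_starProjection_mem_orthogonal x) _
      (Submodule.le_topologicalClosure _ (Submodule.subset_span ⟨i, rfl⟩))
  have h0 := condExp_eq_zero_of_inner_eq_zero μ M hM hM0 Y y hYm hY hyM (x - p)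
    (M.sub_mem hx (hVM hpV)) hort
  -- The classes measurable with respect to the observations form a closed subspace, so mean square
  -- limits of combinations of observations stay in it.
  have hVm : ∀ v ∈ V, AEStronglyMeasurable[⨆ i, MeasurableSpace.comap (Y i) inferInstance] v μ := by
    have hle : V ≤ lpMeas ℝ ℝ (⨆ i, MeasurableSpace.comap (Y i) inferInstance) 2 μ := by
      refine Submodule.topologicalClosure_minimal _ (Submodule.span_le.2 ?_)
        (isClosed_aestronglyMeasurable hm)
      rintro _ ⟨i, rfl⟩
      exact ((measurable_iSup_comap Y i).stronglyMeasurable.aestronglyMeasurable).congr (hY i)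
    exact fun v hv => hle hv
  have hpc : μ[p | ⨆ i, MeasurableSpace.comap (Y i) inferInstance] =ᵐ[μ] p :=
    condExp_of_aestronglyMeasurable' hm (hVm p hpV) ((Lp.memLp p).integrable (by norm_num))
  have hXp : μ[X | ⨆ i, MeasurableSpace.comap (Y i) inferInstance] =ᵐ[μ] p := by
    have h1 : X =ᵐ[μ] (((x - p : Lp ℝ 2 μ) : Ω → ℝ) + p) := by
      filter_upwards [hX, Lp.coeFn_sub x p] with ω h1 h2
      rw [h1, Pi.add_apply, h2, Pi.sub_apply, sub_add_cancel]
    refine (condExp_congr_ae h1).trans ((condExp_add ((Lp.memLp _).integrable (by norm_num))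
      ((Lp.memLp p).integrable (by norm_num)) _).trans ?_)
    filter_upwards [h0, hpc] with ω h2 h3
    rw [Pi.add_apply, h2, h3, Pi.zero_apply, zero_add]
  rw [← integral_sq_Lp_two]
  refine integral_congr_ae ?_
  filter_upwards [hXp, hX, Lp.coeFn_sub x p] with ω h1 h2 h3
  rw [h1, h2, h3, Pi.sub_apply]

end

/-! ### The spectral isometry -/

section

variable {Ω : Type*} [MeasurableSpace Ω]

lemma wave_add (f s t : ℝ) : wave f (s + t) = wave f s * wave f t := by
  simp only [wave, ← Complex.exp_add]
  congr 1; push_cast; ring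

lemma wave_add_left (f g t : ℝ) : wave (f + g) t = wave f t * wave g t := by
  simp only [wave, ← Complex.exp_add]
  congr 1; push_cast; ring

lemma wave_eq_exp (f t : ℝ) : wave f t = Complex.exp ((2 * Real.pi * f * t : ℝ) * Complex.I) := by
  simp only [wave]
  congr 1; push_cast; ring

@[simp] lemma norm_wave (f t : ℝ) : ‖wave f t‖ = 1 := by
  rw [wave_eq_exp, Complex.norm_exp_ofReal_mul_I]

lemma conj_wave (f t : ℝ) : (starRingEnd ℂ) (wave f t) = wave f (-t) := by
  rw [wave_eq_exp, wave_eq_exp, ← Complex.exp_conj]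
  congr 1
  simp only [map_mul, Complex.conj_ofReal, Complex.conj_I]
  push_cast; ring

lemma wave_neg_left (f t : ℝ) : wave (-f) t = (starRingEnd ℂ) (wave f t) := by
  rw [conj_wave, wave, wave]
  congr 1; push_cast; ring

@[fun_prop] lemma continuous_wave : Continuous fun q : ℝ × ℝ => wave q.1 q.2 := by
  unfold wave; fun_prop

@[fun_prop] lemma continuous_wave_left (t : ℝ) : Continuous fun f => wave f t := by
  unfold wave; fun_prop

@[fun_prop] lemma measurable_wave_left (t : ℝ) : Measurable fun f => wave f t :=
  (continuous_wave_left t).measurable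

/-- The measure with density `S`. -/
def psdMeasure (S : ℝ → ℝ) : Measure ℝ := volume.withDensity fun f => ENNReal.ofReal (S f)

lemma integral_psdMeasure {E : Type*} [NormedAddCommGroup E] [NormedSpace ℝ E] {S : ℝ → ℝ}
    (hS : IsPSD S) (g : ℝ → E) : ∫ f, g f ∂psdMeasure S = ∫ f, S f • g f := by
  rw [psdMeasure, integral_withDensity_eq_integral_toReal_smul hS.measurable.ennreal_ofReal
    (ae_of_all _ fun _ => ENNReal.ofReal_lt_top)]
  simp only [ENNReal.toReal_ofReal (hS.nonneg _)]

lemma integrable_psdMeasure {E : Type*} [NormedAddCommGroup E] [NormedSpace ℝ E] {S : ℝ → ℝ}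
    (hS : IsPSD S) {g : ℝ → E} :
    Integrable g (psdMeasure S) ↔ Integrable fun f => S f • g f := by
  rw [psdMeasure, integrable_withDensity_iff_integrable_smul' hS.measurable.ennreal_ofReal
    (ae_of_all _ fun _ => ENNReal.ofReal_lt_top)]
  simp only [ENNReal.toReal_ofReal (hS.nonneg _)]

lemma memLp_psdMeasure {S : ℝ → ℝ} (hS : IsPSD S) {h : ℝ → ℂ} (hh : Measurable h) :
    MemLp h 2 (psdMeasure S) ↔ Integrable fun f => ‖h f‖ ^ 2 * S f := by
  rw [memLp_two_iff_integrable_sq_norm hh.aestronglyMeasurable, integrable_psdMeasure hS]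
  simp only [smul_eq_mul, mul_comm]

lemma norm_sq_Lp_psdMeasure {S : ℝ → ℝ} (hS : IsPSD S) (u : Lp ℂ 2 (psdMeasure S)) :
    ‖u‖ ^ 2 = ∫ f, ‖u f‖ ^ 2 * S f := by
  rw [← real_inner_self_eq_norm_sq, L2.inner_def, integral_psdMeasure hS]
  simp only [real_inner_self_eq_norm_sq, smul_eq_mul, mul_comm]

lemma integral_congr_psdMeasure {S : ℝ → ℝ} (hS : IsPSD S) {g h : ℝ → ℂ}
    (hgh : g =ᵐ[psdMeasure S] h) : ∫ f, ‖g f‖ ^ 2 * S f = ∫ f, ‖h f‖ ^ 2 * S f := by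
  have (g : ℝ → ℂ) : ∫ f, ‖g f‖ ^ 2 * S f = ∫ f, ‖g f‖ ^ 2 ∂psdMeasure S := by
    rw [integral_psdMeasure hS]; simp only [smul_eq_mul, mul_comm]
  rw [this, this]
  refine integral_congr_ae ?_
  filter_upwards [hgh] with f hf
  rw [hf]

/-- A stationary Gaussian signal observed with independent stationary Gaussian noise. -/
structure IsNoisySource (μ : Measure Ω) (SX Sη : ℝ → ℝ) (X : ℝ → Ω → ℝ)
    (η : {g : ℝ → ℂ // IsFilter Sη g} → Ω → ℝ) : Prop where
  psd_signal : IsPSD SX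
  integrable_psd : Integrable SX
  psd_noise : IsPSD Sη
  signal : IsStationaryGaussian μ SX X
  noise : IsStationaryGaussianNoise μ Sη η
  indep : IndepFun (fun ω t => X t ω) (fun ω g => η g ω) μ

/-- The random variables `X s` and `η g`, paired with their frequency responses. -/
def spectralGenerators (μ : Measure Ω) (SX Sη : ℝ → ℝ) (X : ℝ → Ω → ℝ)
    (η : {g : ℝ → ℂ // IsFilter Sη g} → Ω → ℝ) :
    Set (Lp ℝ 2 μ × Lp ℂ 2 (psdMeasure SX) × Lp ℂ 2 (psdMeasure Sη)) :=
  {T | (∃ s, X s =ᵐ[μ] T.1 ∧ (fun f => wave f s) =ᵐ[psdMeasure SX] T.2.1 ∧ T.2.2 = 0) ∨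
    ∃ g, η g =ᵐ[μ] T.1 ∧ T.2.1 = 0 ∧ g.1 =ᵐ[psdMeasure Sη] T.2.2}

/-- The graph of the isometry between random variables and frequency responses. -/
def spectralGraph (μ : Measure Ω) (SX Sη : ℝ → ℝ) (X : ℝ → Ω → ℝ)
    (η : {g : ℝ → ℂ // IsFilter Sη g} → Ω → ℝ) :
    Submodule ℝ (Lp ℝ 2 μ × Lp ℂ 2 (psdMeasure SX) × Lp ℂ 2 (psdMeasure Sη)) :=
  (Submodule.span ℝ (spectralGenerators μ SX Sη X η)).topologicalClosure

variable {μ : Measure Ω} {SX Sη : ℝ → ℝ} {X : ℝ → Ω → ℝ}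
  {η : {g : ℝ → ℂ // IsFilter Sη g} → Ω → ℝ}

lemma inner_Lp_eq_integral_mul {u v : Lp ℝ 2 μ} {U V : Ω → ℝ} (hU : U =ᵐ[μ] u) (hV : V =ᵐ[μ] v) :
    inner ℝ u v = ∫ ω, U ω * V ω ∂μ := by
  rw [L2.inner_def]
  refine integral_congr_ae ?_
  filter_upwards [hU, hV] with ω h1 h2
  rw [h1, h2]
  simp [mul_comm]

lemma inner_Lp_psdMeasure {S : ℝ → ℝ} (hS : IsPSD S) {u v : Lp ℂ 2 (psdMeasure S)} {g h : ℝ → ℂ}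
    (hg : g =ᵐ[psdMeasure S] u) (hh : h =ᵐ[psdMeasure S] v) :
    inner ℝ u v = (∫ f, g f * (starRingEnd ℂ) (h f) * (S f : ℂ)).re := by
  have h0 : inner ℝ u v = RCLike.re (inner ℂ v u) := by
    rw [L2.inner_def, L2.inner_def, ← integral_re (L2.integrable_inner v u)]
    refine integral_congr_ae (ae_of_all _ fun f => ?_)
    simp [mul_comm]
  rw [h0, L2.inner_def]
  have : ∫ f, g f * (starRingEnd ℂ) (h f) * (S f : ℂ) = ∫ f, S f • (g f * (starRingEnd ℂ) (h f)) :=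
      by
    simp only [Complex.real_smul, mul_comm]
  rw [this, ← integral_psdMeasure hS, RCLike.re_eq_complex_re]
  congr 1
  refine integral_congr_ae ?_
  filter_upwards [hg, hh] with f h1 h2
  rw [h1, h2]
  simp

/-- Signal-signal and noise-noise products are the two covariance formulas; mixed products vanish by
independence and centring. -/
lemma inner_fst_of_mem_generators (hm : IsNoisySource μ SX Sη X η)
    {T T' : Lp ℝ 2 μ × Lp ℂ 2 (psdMeasure SX) × Lp ℂ 2 (psdMeasure Sη)}
    (hT : T ∈ spectralGenerators μ SX Sη X η) (hT' : T' ∈ spectralGenerators μ SX Sη X η) :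
    inner ℝ T.1 T'.1 = inner ℝ T.2.1 T'.2.1 + inner ℝ T.2.2 T'.2.2 := by
  have hcross (s : ℝ) (g) : ∫ ω, X s ω * η g ω ∂μ = 0 := by
    have h := (hm.indep.comp (measurable_pi_apply s) (measurable_pi_apply
        g)).integral_mul_eq_mul_integral
      (hm.signal.measurable s).aestronglyMeasurable (hm.noise.measurable g).aestronglyMeasurable
    have h2 := hm.signal.centred s
    simp only [Function.comp_def, Pi.mul_apply, h2, zero_mul] at h
    exact h
  rcases hT with ⟨s, h1, h2, h3⟩ | ⟨g, h1, h2, h3⟩ <;>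
    rcases hT' with ⟨s', h1', h2', h3'⟩ | ⟨g', h1', h2', h3'⟩
  · rw [h3, inner_zero_left, add_zero, inner_Lp_eq_integral_mul h1 h1',
      inner_Lp_psdMeasure hm.psd_signal h2 h2', ← Complex.ofReal_re (∫ ω, X s ω * X s' ω ∂μ),
      hm.signal.spectrum]
    congr 2
    ext f
    rw [conj_wave, sub_eq_add_neg, wave_add, mul_comm]
  · rw [h3, h2', inner_zero_left, inner_zero_right, inner_Lp_eq_integral_mul h1 h1', hcross,
      add_zero]
  · rw [h2, h3', inner_zero_left, inner_zero_right, inner_Lp_eq_integral_mul h1 h1', add_zero]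
    simp_rw [mul_comm (η g _)]
    exact hcross _ _
  · rw [h2, inner_zero_left, zero_add, inner_Lp_eq_integral_mul h1 h1',
      inner_Lp_psdMeasure hm.psd_noise h3 h3', ← Complex.ofReal_re (∫ ω, η g ω * η g' ω ∂μ),
      hm.noise.spectrum]

lemma spectralGraph_induction
    {p : Lp ℝ 2 μ × Lp ℂ 2 (psdMeasure SX) × Lp ℂ 2 (psdMeasure Sη) → Prop}
    (hp : IsClosed {T | p T}) (h : ∀ T ∈ Submodule.span ℝ (spectralGenerators μ SX Sη X η), p T)
    {T : Lp ℝ 2 μ × Lp ℂ 2 (psdMeasure SX) × Lp ℂ 2 (psdMeasure Sη)}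
    (hT : T ∈ spectralGraph μ SX Sη X η) : p T := by
  rw [spectralGraph, ← SetLike.mem_coe, Submodule.topologicalClosure_coe] at hT
  exact closure_minimal (fun T hT => h T hT) hp hT

/-- On the span the identity follows by bilinearity from its polarized form on generators, and the
norm form survives the closure by continuity. Working with a closed graph instead of a map avoids
any question of well-definedness. -/
lemma norm_sq_fst_of_mem_spectralGraph (hm : IsNoisySource μ SX Sη X η)
    {T : Lp ℝ 2 μ × Lp ℂ 2 (psdMeasure SX) × Lp ℂ 2 (psdMeasure Sη)}
    (hT : T ∈ spectralGraph μ SX Sη X η) : ‖T.1‖ ^ 2 = ‖T.2.1‖ ^ 2 + ‖T.2.2‖ ^ 2 := by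
  have hspan : ∀ T ∈ Submodule.span ℝ (spectralGenerators μ SX Sη X η),
      ‖T.1‖ ^ 2 = ‖T.2.1‖ ^ 2 + ‖T.2.2‖ ^ 2 := by
    intro T hT
    simp only [← real_inner_self_eq_norm_sq]
    refine Submodule.span_induction₂ (s := spectralGenerators μ SX Sη X η)
      (t := spectralGenerators μ SX Sη X η) (p := fun T T' _ _ =>
        inner ℝ T.1 T'.1 = inner ℝ T.2.1 T'.2.1 + inner ℝ T.2.2 T'.2.2)
      (fun _ _ h h' => inner_fst_of_mem_generators hm h h') ?_ ?_ ?_ ?_ ?_ ?_ hT hT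
    · intros; simp
    · intros; simp
    · intro x y z _ _ _ h1 h2
      simp only [Prod.fst_add, Prod.snd_add, inner_add_left, h1, h2]; ring
    · intro x y z _ _ _ h1 h2
      simp only [Prod.fst_add, Prod.snd_add, inner_add_right, h1, h2]; ring
    · intro r x y _ _ h1
      simp only [Prod.smul_fst, Prod.smul_snd, real_inner_smul_left, h1]; ring
    · intro r x y _ _ h1
      simp only [Prod.smul_fst, Prod.smul_snd, real_inner_smul_right, h1]; ring
  exact spectralGraph_induction (p := fun T => ‖T.1‖ ^ 2 = ‖T.2.1‖ ^ 2 + ‖T.2.2‖ ^ 2)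
    (isClosed_eq (by fun_prop) (by fun_prop)) hspan hT

lemma hasGaussianLaw_finsupp_sum {T : Type*} {Y : T → Ω → ℝ} (hY : IsGaussianProcess Y μ)
    (c : T →₀ ℝ) : HasGaussianLaw (fun ω => c.sum fun i a => a * Y i ω) μ := by
  simpa [Finsupp.sum] using (hY.smul (fun i => c i)).hasGaussianLaw_fun_sum (I := c.support)

/-- Separating the signal part from the noise part lets Gaussianity and centring be read off from
the two processes. -/
lemma eqOn_span_generators
    {T : Lp ℝ 2 μ × Lp ℂ 2 (psdMeasure SX) × Lp ℂ 2 (psdMeasure Sη)}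
    (hT : T ∈ Submodule.span ℝ (spectralGenerators μ SX Sη X η)) :
    ∃ (c : ℝ →₀ ℝ) (d : {g : ℝ → ℂ // IsFilter Sη g} →₀ ℝ),
      T.1 =ᵐ[μ] fun ω => c.sum (fun s a => a * X s ω) + d.sum fun g a => a * η g ω := by
  classical
  induction hT using Submodule.span_induction with
  | mem x h =>
    rcases h with ⟨s, h1, -⟩ | ⟨g, h1, -⟩
    · exact ⟨Finsupp.single s 1, 0, by simpa using h1.symm⟩
    · exact ⟨0, Finsupp.single g 1, by simpa using h1.symm⟩
  | zero => exact ⟨0, 0, by simp only [Finsupp.sum_zero_index, add_zero]; exact Lp.coeFn_zero ℝ 2 μ⟩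
  | add x y _ _ h1 h2 =>
    obtain ⟨c, d, h⟩ := h1
    obtain ⟨c', d', h'⟩ := h2
    refine ⟨c + c', d + d', ?_⟩
    filter_upwards [h, h', Lp.coeFn_add x.1 y.1] with ω h h' h3
    rw [Prod.fst_add, h3, Pi.add_apply, h, h', Finsupp.sum_add_index' (by simp) (by intros; ring),
      Finsupp.sum_add_index' (by simp) (by intros; ring)]
    ring
  | smul a x _ h1 =>
    obtain ⟨c, d, h⟩ := h1
    refine ⟨a • c, a • d, ?_⟩
    filter_upwards [h, Lp.coeFn_smul a x.1] with ω h h3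
    rw [Prod.smul_fst, h3, Pi.smul_apply, h, Finsupp.sum_smul_index' (by simp),
      Finsupp.sum_smul_index' (by simp)]
    simp only [smul_eq_mul, mul_assoc, ← Finsupp.mul_sum, mul_add]

lemma measurable_finsupp_sum_eval {T : Type*} (c : T →₀ ℝ) :
    Measurable fun x : T → ℝ => c.sum fun i a => a * x i :=
  Finset.measurable_sum _ fun i _ => (measurable_pi_apply i).const_mul _

variable [IsProbabilityMeasure μ]

/-- On the span the variable is a sum of two independent Gaussians, one from each process;
Gaussianity is closed in `L²`. -/
lemma hasGaussianLaw_fst_of_mem_spectralGraph (hm : IsNoisySource μ SX Sη X η)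
    {T : Lp ℝ 2 μ × Lp ℂ 2 (psdMeasure SX) × Lp ℂ 2 (psdMeasure Sη)}
    (hT : T ∈ spectralGraph μ SX Sη X η) : HasGaussianLaw T.1 μ := by
  refine spectralGraph_induction (p := fun T => HasGaussianLaw T.1 μ)
    ((isClosed_hasGaussianLaw μ).preimage continuous_fst) (fun T hT => ?_) hT
  obtain ⟨c, d, h⟩ := eqOn_span_generators hT
  have hi := hm.indep.comp (measurable_finsupp_sum_eval c) (measurable_finsupp_sum_eval d)
  exact (iIndepFun.hasGaussianLaw_fun_add (hasGaussianLaw_finsupp_sum hm.signal.gaussian c)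
    (hasGaussianLaw_finsupp_sum hm.noise.gaussian d) hi).congr h.symm

lemma integral_fst_of_mem_spectralGraph (hm : IsNoisySource μ SX Sη X η)
    {T : Lp ℝ 2 μ × Lp ℂ 2 (psdMeasure SX) × Lp ℂ 2 (psdMeasure Sη)}
    (hT : T ∈ spectralGraph μ SX Sη X η) : ∫ ω, T.1 ω ∂μ = 0 := by
  refine spectralGraph_induction (p := fun T => ∫ ω, T.1 ω ∂μ = 0)
    (isClosed_eq ((continuous_integral_Lp_two μ).comp continuous_fst) continuous_const)
    (fun T hT => ?_) hT
  obtain ⟨c, d, h⟩ := eqOn_span_generators hT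
  have hX (s) : Integrable (X s) μ := (hm.signal.gaussian.hasGaussianLaw_eval s).integrable
  have hη (s) : Integrable (η s) μ := (hm.noise.gaussian.hasGaussianLaw_eval s).integrable
  simp only [Finsupp.sum] at h
  rw [integral_congr_ae h, integral_add
    (integrable_finsetSum _ fun i _ => (hX i).const_mul _)
    (integrable_finsetSum _ fun i _ => (hη i).const_mul _)]
  rw [integral_finsetSum _ fun i _ => (hX i).const_mul _,
    integral_finsetSum _ fun i _ => (hη i).const_mul _]
  simp [integral_const_mul, hm.signal.centred, hm.noise.centred]

end

/-! ### Random variables with prescribed frequency responses -/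

section

variable {Ω : Type*} [MeasurableSpace Ω]

/-- `U` is the random variable with frequency response `h` to the signal and `k` to the noise. -/
def HasSpectrum (μ : Measure Ω) (SX Sη : ℝ → ℝ) (X : ℝ → Ω → ℝ)
    (η : {g : ℝ → ℂ // IsFilter Sη g} → Ω → ℝ) (U : Ω → ℝ) (h k : ℝ → ℂ) : Prop :=
  ∃ T ∈ spectralGraph μ SX Sη X η, U =ᵐ[μ] T.1 ∧ h =ᵐ[psdMeasure SX] T.2.1 ∧
    k =ᵐ[psdMeasure Sη] T.2.2

variable {μ : Measure Ω} {SX Sη : ℝ → ℝ} {X : ℝ → Ω → ℝ}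
  {η : {g : ℝ → ℂ // IsFilter Sη g} → Ω → ℝ} {U U' : Ω → ℝ} {h k h' k' : ℝ → ℂ}

lemma HasSpectrum.add (H : HasSpectrum μ SX Sη X η U h k) (H' : HasSpectrum μ SX Sη X η U' h' k') :
    HasSpectrum μ SX Sη X η (fun ω => U ω + U' ω) (fun f => h f + h' f) fun f => k f + k' f := by
  obtain ⟨T, hT, h1, h2, h3⟩ := H
  obtain ⟨T', hT', h1', h2', h3'⟩ := H'
  exact ⟨T + T', Submodule.add_mem _ hT hT', (h1.add h1').trans (Lp.coeFn_add _ _).symm,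
    (h2.add h2').trans (Lp.coeFn_add _ _).symm, (h3.add h3').trans (Lp.coeFn_add _ _).symm⟩

lemma HasSpectrum.const_mul (H : HasSpectrum μ SX Sη X η U h k) (a : ℝ) :
    HasSpectrum μ SX Sη X η (fun ω => a * U ω) (fun f => a * h f) fun f => a * k f := by
  obtain ⟨T, hT, h1, h2, h3⟩ := H
  refine ⟨a • T, Submodule.smul_mem _ a hT, ?_, ?_, ?_⟩
  · filter_upwards [h1, Lp.coeFn_smul a T.1] with ω h h'
    rw [Prod.smul_fst, h', Pi.smul_apply, h, smul_eq_mul]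
  · filter_upwards [h2, Lp.coeFn_smul a T.2.1] with ω h h'
    rw [Prod.smul_snd, Prod.smul_fst, h', Pi.smul_apply, h, Complex.real_smul]
  · filter_upwards [h3, Lp.coeFn_smul a T.2.2] with ω h h'
    rw [Prod.smul_snd, Prod.smul_snd, h', Pi.smul_apply, h, Complex.real_smul]

lemma hasSpectrum_zero : HasSpectrum μ SX Sη X η 0 0 0 :=
  ⟨0, Submodule.zero_mem _, (Lp.coeFn_zero _ _ _).symm, (Lp.coeFn_zero _ _ _).symm,
    (Lp.coeFn_zero _ _ _).symm⟩

lemma HasSpectrum.finsupp_sum {ι : Type*} {Y : ι → Ω → ℝ} {h k : ι → ℝ → ℂ}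
    (H : ∀ i, HasSpectrum μ SX Sη X η (Y i) (h i) (k i)) (c : ι →₀ ℝ) :
    HasSpectrum μ SX Sη X η (fun ω => c.sum fun i a => a * Y i ω)
      (fun f => c.sum fun i a => a * h i f) fun f => c.sum fun i a => a * k i f := by
  classical
  induction c using Finsupp.induction_linear with
  | zero => simp only [Finsupp.sum_zero_index]; exact hasSpectrum_zero
  | add c d hc hd =>
    convert hc.add hd using 2 <;>
      exact Finsupp.sum_add_index' (by simp) (by intros; push_cast; ring)
  | single i a => simpa using (H i).const_mul a

lemma HasSpectrum.congr (H : HasSpectrum μ SX Sη X η U h k) (hU : U' =ᵐ[μ] U)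
    (hh : h' =ᵐ[psdMeasure SX] h) (hk : k' =ᵐ[psdMeasure Sη] k) :
    HasSpectrum μ SX Sη X η U' h' k' := by
  obtain ⟨T, hT, h1, h2, h3⟩ := H
  exact ⟨T, hT, hU.trans h1, hh.trans h2, hk.trans h3⟩

lemma HasSpectrum.integral_sq (hm : IsNoisySource μ SX Sη X η)
    (H : HasSpectrum μ SX Sη X η U h k) :
    ∫ ω, U ω ^ 2 ∂μ = (∫ f, ‖h f‖ ^ 2 * SX f) + ∫ f, ‖k f‖ ^ 2 * Sη f := by
  obtain ⟨T, hT, h1, h2, h3⟩ := H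
  rw [integral_congr_psdMeasure hm.psd_signal h2, integral_congr_psdMeasure hm.psd_noise h3,
    ← norm_sq_Lp_psdMeasure hm.psd_signal, ← norm_sq_Lp_psdMeasure hm.psd_noise,
    ← norm_sq_fst_of_mem_spectralGraph hm hT, ← integral_sq_Lp_two]
  refine integral_congr_ae ?_
  filter_upwards [h1] with ω h
  rw [h]

lemma integrable_norm_wave_sq_mul {S : ℝ → ℝ} (hS : Integrable S) (t : ℝ) :
    Integrable fun f => ‖wave f t‖ ^ 2 * S f := by
  simpa using hS

lemma hasSpectrum_signal (hm : IsNoisySource μ SX Sη X η) (t : ℝ) :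
    HasSpectrum μ SX Sη X η (X t) (fun f => wave f t) 0 := by
  have h1 : MemLp (X t) 2 μ := (hm.signal.gaussian.hasGaussianLaw_eval t).memLp_two
  have h2 : MemLp (fun f => wave f t) 2 (psdMeasure SX) :=
    (memLp_psdMeasure hm.psd_signal (by fun_prop)).2 (integrable_norm_wave_sq_mul hm.integrable_psd
        t)
  exact ⟨(h1.toLp, h2.toLp, 0), Submodule.le_topologicalClosure _ (Submodule.subset_span
    (Or.inl ⟨t, h1.coeFn_toLp.symm, h2.coeFn_toLp.symm, rfl⟩)), h1.coeFn_toLp.symm,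
    h2.coeFn_toLp.symm, (Lp.coeFn_zero _ _ _).symm⟩

lemma hasSpectrum_noise (hm : IsNoisySource μ SX Sη X η) (g : {g : ℝ → ℂ // IsFilter Sη g}) :
    HasSpectrum μ SX Sη X η (η g) 0 g.1 := by
  have h1 : MemLp (η g) 2 μ := (hm.noise.gaussian.hasGaussianLaw_eval g).memLp_two
  have h2 : MemLp g.1 2 (psdMeasure Sη) :=
    (memLp_psdMeasure hm.psd_noise g.2.measurable).2 g.2.finitePower
  exact ⟨(h1.toLp, 0, h2.toLp), Submodule.le_topologicalClosure _ (Submodule.subset_span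
    (Or.inr ⟨g, h1.coeFn_toLp.symm, rfl, h2.coeFn_toLp.symm⟩)), h1.coeFn_toLp.symm,
    (Lp.coeFn_zero _ _ _).symm, h2.coeFn_toLp.symm⟩

lemma norm_sub_lt_of_integral_sq {u v : Lp ℝ 2 μ} {U V : Ω → ℝ} (hU : U =ᵐ[μ] u) (hV : V =ᵐ[μ] v)
    {δ : ℝ} (hδ : 0 < δ) (h : ∫ ω, (U ω - V ω) ^ 2 ∂μ < δ ^ 2) : ‖u - v‖ < δ := by
  refine lt_of_pow_lt_pow_left₀ 2 hδ.le ?_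
  have h0 : (fun ω => (U ω - V ω) ^ 2) =ᵐ[μ] fun ω => (u - v : Lp ℝ 2 μ) ω ^ 2 := by
    filter_upwards [hU, hV, Lp.coeFn_sub u v] with ω h1 h2 h3
    rw [h3, Pi.sub_apply, h1, h2]
  rwa [← integral_sq_Lp_two, ← integral_congr_ae h0]

lemma norm_sub_lt_of_integral_psd {S : ℝ → ℝ} (hS : IsPSD S) {u v : Lp ℂ 2 (psdMeasure S)}
    {g h : ℝ → ℂ} (hg : g =ᵐ[psdMeasure S] u) (hh : h =ᵐ[psdMeasure S] v)
    {δ : ℝ} (hδ : 0 < δ) (H : ∫ f, ‖g f - h f‖ ^ 2 * S f < δ ^ 2) : ‖u - v‖ < δ := by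
  refine lt_of_pow_lt_pow_left₀ 2 hδ.le ?_
  have h0 : (fun f => g f - h f) =ᵐ[psdMeasure S] (u - v : Lp ℂ 2 (psdMeasure S)) := by
    filter_upwards [hg, hh, Lp.coeFn_sub u v] with f h1 h2 h3
    rw [h3, Pi.sub_apply, h1, h2]
  rwa [norm_sq_Lp_psdMeasure hS, ← integral_congr_psdMeasure hS h0]

/-- In `IsResponse` one and the same combination approximates both the variable and its frequency
response, so the pair is a limit of points of the graph, which is closed. -/
lemma IsResponse.hasSpectrum (hm : IsNoisySource μ SX Sη X η) {H : ℝ → ℂ} {t : ℝ}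
    (hH : MemLp (fun f => H f * wave f t) 2 (psdMeasure SX)) (hU : IsResponse μ SX X H t U) :
    HasSpectrum μ SX Sη X η U (fun f => H f * wave f t) 0 := by
  obtain ⟨hU2, hU⟩ := hU
  refine ⟨(hU2.toLp, hH.toLp, 0), ?_, hU2.coeFn_toLp.symm, hH.coeFn_toLp.symm,
    (Lp.coeFn_zero _ _ _).symm⟩
  have hcl : IsClosed (spectralGraph μ SX Sη X η : Set (Lp ℝ 2 μ × Lp ℂ 2 (psdMeasure SX) × Lp ℂ 2
      (psdMeasure Sη))) := by
    rw [spectralGraph]; exact Submodule.isClosed_topologicalClosure _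
  rw [← SetLike.mem_coe, ← hcl.closure_eq, Metric.mem_closure_iff]
  intro δ hδ
  obtain ⟨c, hc1, hc2⟩ := hU (δ ^ 2) (by positivity)
  obtain ⟨T, hT, h1, h2, h3⟩ := HasSpectrum.finsupp_sum (hasSpectrum_signal hm) c
  refine ⟨T, hT, ?_⟩
  have h30 : T.2.2 = 0 := by
    refine Lp.ext ?_
    refine (h3.symm.trans ?_).trans (Lp.coeFn_zero _ _ _).symm
    refine ae_of_all _ fun f => ?_
    simp
  rw [Prod.dist_eq, Prod.dist_eq, dist_eq_norm, dist_eq_norm, dist_eq_norm]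
  refine max_lt ?_ (max_lt ?_ ?_)
  · exact norm_sub_lt_of_integral_sq hU2.coeFn_toLp.symm h1 hδ hc2
  · exact norm_sub_lt_of_integral_psd hm.psd_signal hH.coeFn_toLp.symm h2 hδ hc1
  · simpa [h30] using hδ

/-- The frequency response of an admissible filter, delayed by `t`, is square integrable against
both densities. -/
lemma IsFilter.memLp_signal (hm : IsNoisySource μ SX Sη X η) {H : ℝ → ℂ}
    (hH : IsFilter (fun f => SX f + Sη f) H) (t : ℝ) :
    MemLp (fun f => H f * wave f t) 2 (psdMeasure SX) := by
  have hmeas := hH.measurable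
  rw [memLp_psdMeasure hm.psd_signal (by fun_prop)]
  refine hH.finitePower.mono' ?_ (ae_of_all _ fun f => ?_)
  · exact ((hmeas.mul (measurable_wave_left t)).norm.pow_const 2 |>.mul
      hm.psd_signal.measurable).aestronglyMeasurable
  · have h1 := hm.psd_signal.nonneg f
    have h2 := hm.psd_noise.nonneg f
    rw [Real.norm_of_nonneg (mul_nonneg (sq_nonneg _) h1), norm_mul, norm_wave, mul_one]
    gcongr
    linarith

lemma IsFilter.isFilter_noise (hm : IsNoisySource μ SX Sη X η) {H : ℝ → ℂ}
    (hH : IsFilter (fun f => SX f + Sη f) H) (t : ℝ) :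
    IsFilter Sη fun f => H f * wave f t := by
  have hmeas := hH.measurable
  refine ⟨by fun_prop, fun f => by rw [hH.hermitian, wave_neg_left, map_mul], ?_⟩
  refine hH.finitePower.mono' ?_ (ae_of_all _ fun f => ?_)
  · exact ((hmeas.mul (measurable_wave_left t)).norm.pow_const 2 |>.mul
      hm.psd_noise.measurable).aestronglyMeasurable
  · have h1 := hm.psd_signal.nonneg f
    have h2 := hm.psd_noise.nonneg f
    rw [Real.norm_of_nonneg (mul_nonneg (sq_nonneg _) h2), norm_mul, norm_wave, mul_one]
    gcongr
    linarith

lemma IsFilterBankOutput.hasSpectrum (hm : IsNoisySource μ SX Sη X η) {P : ℕ}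
    {H : Fin P → ℝ → ℂ} {Z : Fin P → ℝ → Ω → ℝ}
    (hH : ∀ p, IsFilter (fun f => SX f + Sη f) (H p))
    (hZ : IsFilterBankOutput μ SX Sη X η H Z) (p : Fin P) (t : ℝ) :
    HasSpectrum μ SX Sη X η (Z p t) (fun f => H p f * wave f t) fun f => H p f * wave f t := by
  obtain ⟨U, g, hU, hg, hZU⟩ := hZ.response p t
  have h1 := (hU.hasSpectrum hm ((hH p).memLp_signal hm t)).add (hasSpectrum_noise hm g)
  refine h1.congr hZU (ae_of_all _ fun f => ?_) (ae_of_all _ fun f => ?_)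
  · simp
  · simp [hg]

end

/-! ### Density of complex exponentials in weighted `L²` -/

section

lemma integrable_wave_mul {ν : Measure ℝ} {w : ℝ → ℝ} (hw : Integrable w ν) (s : ℝ) :
    Integrable (fun f => w f • wave f s) ν := by
  refine hw.norm.mono' (hw.aestronglyMeasurable.smul
    (continuous_wave_left s).measurable.aestronglyMeasurable) (ae_of_all _ fun f => ?_)
  rw [norm_smul, norm_wave, mul_one]

/-- If the finite measures below `ν` are determined by their integrals against the waves `τ i`,
then an integrable weight that annihilates all these waves vanishes. -/
lemma ae_eq_zero_of_integral_wave_eq_zero {ι : Type*} {τ : ι → ℝ} {ν : Measure ℝ}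
    (hdet : ∀ (m₁ m₂ : Measure ℝ) [IsFiniteMeasure m₁] [IsFiniteMeasure m₂], m₁ ≪ ν → m₂ ≪ ν →
      (∀ i, ∫ f, wave f (τ i) ∂m₁ = ∫ f, wave f (τ i) ∂m₂) → m₁ = m₂)
    {w : ℝ → ℝ} (hw : Integrable w ν) (h : ∀ i, ∫ f, w f • wave f (τ i) ∂ν = 0) : w =ᵐ[ν] 0 := by
  have hm := hw.aestronglyMeasurable.aemeasurable
  have hmn : AEMeasurable (fun f => - w f) ν := hm.neg
  have hfin (w : ℝ → ℝ) (hw : Integrable w ν) :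
      IsFiniteMeasure (ν.withDensity fun f => ENNReal.ofReal (w f)) :=
    isFiniteMeasure_withDensity_ofReal hw.2
  have h1 := hfin w hw
  have h2 := hfin (fun f => - w f) hw.neg
  -- The positive and the negative part of `w` are densities of two finite measures with the same
  -- wave integrals.
  have key : ν.withDensity (fun f => ENNReal.ofReal (w f))
      = ν.withDensity fun f => ENNReal.ofReal (- w f) := by
    refine hdet _ _ (withDensity_absolutelyContinuous _ _) (withDensity_absolutelyContinuous _ _)
      fun i => ?_
    rw [integral_withDensity_eq_integral_toReal_smul₀ hm.ennreal_ofReal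
      (ae_of_all _ fun _ => ENNReal.ofReal_lt_top), integral_withDensity_eq_integral_toReal_smul₀
      hmn.ennreal_ofReal (ae_of_all _ fun _ => ENNReal.ofReal_lt_top), ← sub_eq_zero,
      ← integral_sub, ← h i]
    · refine integral_congr_ae (ae_of_all _ fun f => ?_)
      simp only [ENNReal.toReal_ofReal', ← sub_smul]
      congr 1
      rcases le_total 0 (w f) with h | h
      · rw [max_eq_left h, max_eq_right (by linarith)]; ring
      · rw [max_eq_right h, max_eq_left (by linarith)]; ring
    · simp only [ENNReal.toReal_ofReal']
      exact integrable_wave_mul hw.pos_part _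
    · simp only [ENNReal.toReal_ofReal']
      exact integrable_wave_mul hw.neg_part _
  have h3 := (withDensity_eq_iff hm.ennreal_ofReal hmn.ennreal_ofReal ?_).1 key
  · filter_upwards [h3] with f hf
    rcases le_total 0 (w f) with h | h
    · rw [ENNReal.ofReal_of_nonpos (by linarith : - w f ≤ 0), ENNReal.ofReal_eq_zero] at hf
      exact le_antisymm hf h
    · rw [ENNReal.ofReal_of_nonpos h, eq_comm, ENNReal.ofReal_eq_zero] at hf
      exact le_antisymm h (neg_nonpos.1 hf)
  · exact (hasFiniteIntegral_iff_norm w |>.1 hw.2).ne_top.elim ∘ fun h => by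
      rw [← top_le_iff] at h ⊢
      exact h.trans (lintegral_mono fun f => ENNReal.ofReal_le_ofReal (Real.le_norm_self _))

lemma memLp_wave (ν : Measure ℝ) [IsFiniteMeasure ν] (s : ℝ) : MemLp (fun f => wave f s) 2 ν :=
  MemLp.of_bound (continuous_wave_left s).measurable.aestronglyMeasurable 1
    (ae_of_all _ fun f => by simp)

/-- If `u` is orthogonal to all waves then so is its conjugate, because the times are symmetric;
hence the real and imaginary parts of `u` are real weights annihilated by the waves. This is used
both for all real times and for the sampling times `n / Δ`. -/
lemma topologicalClosure_span_wave_eq_top {ι : Type*} {τ : ι → ℝ} (hτ : ∀ i, ∃ j, τ j = - τ i)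
    {ν : Measure ℝ} [IsFiniteMeasure ν]
    (hdet : ∀ (m₁ m₂ : Measure ℝ) [IsFiniteMeasure m₁] [IsFiniteMeasure m₂], m₁ ≪ ν → m₂ ≪ ν →
      (∀ i, ∫ f, wave f (τ i) ∂m₁ = ∫ f, wave f (τ i) ∂m₂) → m₁ = m₂) :
    (Submodule.span ℂ (Set.range fun i => (memLp_wave ν (τ i)).toLp)).topologicalClosure = ⊤ := by
  rw [Submodule.topologicalClosure_eq_top_iff, eq_bot_iff]
  intro u hu
  have hui : Integrable u ν := (Lp.memLp u).integrable (by norm_num)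
  have h1 (i) : ∫ f, u f * wave f (τ i) ∂ν = 0 := by
    obtain ⟨j, hj⟩ := hτ i
    have h := (Submodule.mem_orthogonal _ _).1 hu _ (Submodule.subset_span ⟨j, rfl⟩)
    rw [L2.inner_def] at h
    rw [← h]
    refine integral_congr_ae ?_
    filter_upwards [(memLp_wave ν (τ j)).coeFn_toLp] with f hf
    rw [hf, hj, RCLike.inner_apply, conj_wave, neg_neg]
  have h2 (i) : ∫ f, (starRingEnd ℂ) (u f) * wave f (τ i) ∂ν = 0 := by
    obtain ⟨j, hj⟩ := hτ i
    rw [← map_eq_zero (starRingEnd ℂ), ← integral_conj, ← h1 j]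
    refine integral_congr_ae (ae_of_all _ fun f => ?_)
    simp only [map_mul, Complex.conj_conj]
    rw [hj, conj_wave]
  have hu1 (i) : Integrable (fun f => u f * wave f (τ i)) ν :=
    hui.mul_bdd (c := 1) (continuous_wave_left _).measurable.aestronglyMeasurable
      (ae_of_all _ fun f => by simp)
  have hu2 (i) : Integrable (fun f => (starRingEnd ℂ) (u f) * wave f (τ i)) ν :=
    (LinearIsometryEquiv.integrable_comp_iff Complex.conjLIE |>.2 hui).mul_bdd (c := 1)
      (continuous_wave_left _).measurable.aestronglyMeasurable (ae_of_all _ fun f => by simp)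
  have hre := ae_eq_zero_of_integral_wave_eq_zero hdet (w := fun f => (u f).re) hui.re fun i => by
    have : ∀ f, (u f).re • wave f (τ i) = (1 / 2 : ℂ) * (u f * wave f (τ i)
        + (starRingEnd ℂ) (u f) * wave f (τ i)) := fun f => by
      rw [← add_mul, Complex.add_conj, Complex.real_smul]; push_cast; ring
    simp_rw [this]
    rw [integral_const_mul, integral_add (hu1 i) (hu2 i), h1, h2]; simp
  have him := ae_eq_zero_of_integral_wave_eq_zero hdet (w := fun f => (u f).im) hui.im fun i => by
    have : ∀ f, (u f).im • wave f (τ i) = (1 / (2 * Complex.I) : ℂ) * (u f * wave f (τ i)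
        - (starRingEnd ℂ) (u f) * wave f (τ i)) := fun f => by
      rw [← sub_mul, Complex.sub_conj, Complex.real_smul]
      push_cast
      field_simp
    simp_rw [this]
    rw [integral_const_mul, integral_sub (hu1 i) (hu2 i), h1, h2]; simp
  rw [Submodule.mem_bot]
  refine Lp.ext ?_
  filter_upwards [hre, him, Lp.coeFn_zero ℂ 2 ν] with f h3 h4 h5
  rw [h5]
  exact Complex.ext h3 h4

lemma exists_finsupp_eLpNorm_lt {ι : Type*} {τ : ι → ℝ} {ν : Measure ℝ} [IsFiniteMeasure ν]
    (hd : (Submodule.span ℂ (Set.range fun i => (memLp_wave ν (τ i)).toLp)).topologicalClosure = ⊤)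
    {q : ℝ → ℂ} (hq : MemLp q 2 ν) {ε : ℝ} (hε : 0 < ε) :
    ∃ c : ι →₀ ℂ, ∫ f, ‖q f - c.sum fun i a => a * wave f (τ i)‖ ^ 2 ∂ν < ε := by
  have hmem : hq.toLp ∈ closure (Submodule.span ℂ
      (Set.range fun i => (memLp_wave ν (τ i)).toLp) : Set (Lp ℂ 2 ν)) := by
    rw [← Submodule.topologicalClosure_coe, hd]; trivial
  obtain ⟨v, hv, hvd⟩ := Metric.mem_closure_iff.1 hmem (Real.sqrt ε) (Real.sqrt_pos.2 hε)
  obtain ⟨c, rfl⟩ := Finsupp.mem_span_range_iff_exists_finsupp.1 hv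
  refine ⟨c, ?_⟩
  rw [dist_eq_norm] at hvd
  have h1 := (sq_lt_sq₀ (norm_nonneg _) (Real.sqrt_nonneg _)).2 hvd
  rw [Real.sq_sqrt hε.le] at h1
  refine lt_of_eq_of_lt ?_ h1
  rw [← real_inner_self_eq_norm_sq, L2.inner_def]
  refine integral_congr_ae ?_
  have h2 := Lp.coeFn_finsetSum (p := 2) (μ := ν) c.support fun i => c i • (memLp_wave ν (τ i)).toLp
  have h3 : ∀ᵐ f ∂ν, ∀ i ∈ c.support, (c i • (memLp_wave ν (τ i)).toLp : Lp ℂ 2 ν) f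
      = c i * wave f (τ i) := by
    refine (Filter.eventually_all_finset c.support).2 fun i _ => ?_
    filter_upwards [Lp.coeFn_smul (c i) (memLp_wave ν (τ i)).toLp,
      (memLp_wave ν (τ i)).coeFn_toLp] with f h h'
    rw [h, Pi.smul_apply, h', smul_eq_mul]
  filter_upwards [hq.coeFn_toLp, h2, h3, Lp.coeFn_sub hq.toLp
    (c.sum fun i a => a • (memLp_wave ν (τ i)).toLp)] with f e1 e2 e3 e4
  rw [real_inner_self_eq_norm_sq, e4, Pi.sub_apply, e1, Finsupp.sum, Finsupp.sum, e2,
    Finset.sum_apply, Finset.sum_congr rfl e3]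

lemma isFiniteMeasure_psdMeasure {W : ℝ → ℝ} (hWi : Integrable W) :
    IsFiniteMeasure (psdMeasure W) := isFiniteMeasure_withDensity_ofReal hWi.2

/-- For a Hermitian target the approximating superposition can be taken with real coefficients. -/
lemma exists_finsupp_real {ι : Type*} {τ : ι → ℝ} {W : ℝ → ℝ} (hW : IsPSD W) (hWi : Integrable W)
    {q : ℝ → ℂ} (hqm : Measurable q) (hqh : ∀ f, q (-f) = (starRingEnd ℂ) (q f))
    (hq : Integrable fun f => ‖q f‖ ^ 2 * W f)
    (hτ : ∀ i, ∃ j, τ j = - τ i)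
    (hdet : ∀ (m₁ m₂ : Measure ℝ) [IsFiniteMeasure m₁] [IsFiniteMeasure m₂],
      m₁ ≪ psdMeasure W → m₂ ≪ psdMeasure W →
      (∀ i, ∫ f, wave f (τ i) ∂m₁ = ∫ f, wave f (τ i) ∂m₂) → m₁ = m₂)
    {ε : ℝ} (hε : 0 < ε) :
    ∃ c : ι →₀ ℝ, ∫ f, ‖q f - c.sum fun i a => (a : ℂ) * wave f (τ i)‖ ^ 2 * W f < ε := by
  have := isFiniteMeasure_psdMeasure hWi
  have hq2 := (memLp_psdMeasure hW hqm).2 hq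
  obtain ⟨c, hc⟩ := exists_finsupp_eLpNorm_lt
    (topologicalClosure_span_wave_eq_top hτ hdet) hq2 hε
  refine ⟨c.mapRange Complex.re Complex.zero_re, lt_of_le_of_lt ?_ hc⟩
  rw [integral_psdMeasure hW]
  simp only [smul_eq_mul]
  set d : ℝ → ℂ := fun f => q f - c.sum fun i a => a * wave f (τ i) with hd
  have hdm : Measurable d := by
    refine hqm.sub (Finset.measurable_sum _ fun i _ => ?_)
    fun_prop
  have hdi : Integrable fun f => W f * ‖d f‖ ^ 2 := by
    have : MemLp d 2 (psdMeasure W) := by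
      refine hq2.sub (memLp_finsetSum _ fun i _ => ?_)
      exact (memLp_wave _ (τ i)).const_mul _
    simpa only [mul_comm] using (memLp_psdMeasure hW hdm).1 this
  have hdn : Integrable fun f => W f * ‖d (-f)‖ ^ 2 := by
    simpa only [hW.even] using hdi.comp_neg
  have hdn' : ∫ f, W f * ‖d (-f)‖ ^ 2 = ∫ f, W f * ‖d f‖ ^ 2 := by
    rw [← integral_neg_eq_self]
    simp only [hW.even, neg_neg]
  -- Taking real parts of the coefficients replaces the residual `d` by its Hermitian part. By
  -- convexity and evenness of `W` this does not increase the weighted norm.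
  have hr (f : ℝ) : q f - (c.mapRange Complex.re Complex.zero_re).sum
      (fun i a => (a : ℂ) * wave f (τ i)) = (1 / 2 : ℂ) * (d f + (starRingEnd ℂ) (d (-f))) := by
    simp only [hd, hqh, map_sub, Complex.conj_conj]
    rw [Finsupp.sum_mapRange_index (by simp), Finsupp.sum, Finsupp.sum, Finsupp.sum, map_sum]
    have e (i) : (c i).re * wave f (τ i) = (1 / 2 : ℂ) * (c i * wave f (τ i)
        + (starRingEnd ℂ) (c i * wave (-f) (τ i))) := by
      rw [map_mul, wave_neg_left, Complex.conj_conj, ← add_mul, Complex.add_conj]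
      push_cast; ring
    rw [Finset.sum_congr rfl fun i _ => e i, ← Finset.mul_sum, Finset.sum_add_distrib]
    ring
  have hle (f : ℝ) : ‖(1 / 2 : ℂ) * (d f + (starRingEnd ℂ) (d (-f)))‖ ^ 2 * W f
      ≤ (1 / 2) * (W f * ‖d f‖ ^ 2 + W f * ‖d (-f)‖ ^ 2) := by
    have h1 : ‖(1 / 2 : ℂ) * (d f + (starRingEnd ℂ) (d (-f)))‖ ≤ (‖d f‖ + ‖d (-f)‖) / 2 := by
      rw [norm_mul]
      have := norm_add_le (d f) ((starRingEnd ℂ) (d (-f)))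
      rw [RCLike.norm_conj] at this
      norm_num
      linarith
    have h2 := pow_le_pow_left₀ (norm_nonneg _) h1 2
    nlinarith [hW.nonneg f, mul_le_mul_of_nonneg_right h2 (hW.nonneg f),
      mul_nonneg (hW.nonneg f) (sq_nonneg (‖d f‖ - ‖d (-f)‖))]
  simp_rw [hr]
  calc _ ≤ ∫ f, (1 / 2) * (W f * ‖d f‖ ^ 2 + W f * ‖d (-f)‖ ^ 2) := by
        refine integral_mono_of_nonneg (ae_of_all _ fun f => ?_) ((hdi.add hdn).const_mul _)
          (ae_of_all _ hle)
        exact mul_nonneg (sq_nonneg _) (hW.nonneg f)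
    _ = ∫ f, W f * ‖d f‖ ^ 2 := by
        rw [integral_const_mul, integral_add hdi hdn, hdn']; ring

lemma measure_eq_of_forall_integral_wave_eq (m₁ m₂ : Measure ℝ) [IsFiniteMeasure m₁]
    [IsFiniteMeasure m₂] (h : ∀ s : ℝ, ∫ f, wave f s ∂m₁ = ∫ f, wave f s ∂m₂) : m₁ = m₂ := by
  refine Measure.ext_of_charFun (funext fun t => ?_)
  rw [charFun_apply_real, charFun_apply_real]
  convert h (t / (2 * Real.pi)) using 3 with f f <;>
  · rw [wave_eq_exp, ← Complex.ofReal_mul]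
    congr 3
    field_simp

/-- The Fourier monomials span a dense subspace of the continuous functions, and integration against
a finite measure is continuous in the sup norm. -/
lemma measure_addCircle_eq_of_forall_integral_fourier_eq {Δ : ℝ} [Fact (0 < Δ)]
    (m₁ m₂ : Measure (AddCircle Δ)) [IsFiniteMeasure m₁] [IsFiniteMeasure m₂]
    (h : ∀ n : ℤ, ∫ x, fourier n x ∂m₁ = ∫ x, fourier n x ∂m₂) : m₁ = m₂ := by
  have hint (m : Measure (AddCircle Δ)) [IsFiniteMeasure m] (g : C(AddCircle Δ, ℂ)) :
      Integrable g m := Integrable.of_bound g.continuous.aestronglyMeasurable ‖g‖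
        (ae_of_all _ g.norm_coe_le_norm)
  have hcont (m : Measure (AddCircle Δ)) [IsFiniteMeasure m] :
      Continuous fun g : C(AddCircle Δ, ℂ) => ∫ x, g x ∂m := by
    refine (LipschitzWith.of_dist_le_mul (K := (m Set.univ).toNNReal) fun u v => ?_).continuous
    rw [dist_eq_norm, dist_eq_norm, ← integral_sub (hint m u) (hint m v)]
    refine (norm_integral_le_of_norm_le_const (C := ‖u - v‖)
      (ae_of_all _ (u - v).norm_coe_le_norm)).trans ?_
    rw [mul_comm]; rfl
  have hall (g : C(AddCircle Δ, ℂ)) : ∫ x, g x ∂m₁ = ∫ x, g x ∂m₂ := by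
    have hg : g ∈ closure (Submodule.span ℂ (Set.range (fourier (T := Δ))) : Set C(AddCircle Δ, ℂ))
        := by
      rw [← Submodule.topologicalClosure_coe, span_fourier_closure_eq_top]; trivial
    refine closure_minimal (t := {g : C(AddCircle Δ, ℂ) | ∫ x, g x ∂m₁ = ∫ x, g x ∂m₂})
      (fun g hg => ?_) (isClosed_eq (hcont m₁) (hcont m₂)) hg
    change ∫ x, g x ∂m₁ = ∫ x, g x ∂m₂
    induction hg using Submodule.span_induction with
    | mem x hx => obtain ⟨n, rfl⟩ := hx; exact h n
    | zero => simp
    | add x y _ _ h1 h2 =>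
      simp only [ContinuousMap.add_apply]
      rw [integral_add (hint m₁ x) (hint m₁ y), integral_add (hint m₂ x) (hint m₂ y), h1, h2]
    | smul a x _ h1 =>
      simp only [ContinuousMap.smul_apply, smul_eq_mul, integral_const_mul, h1]
  refine ext_of_forall_integral_eq_of_IsFiniteMeasure fun g => ?_
  have h1 := hall ⟨fun x => (g x : ℂ), by fun_prop⟩
  simp only [ContinuousMap.coe_mk, integral_complex_ofReal] at h1
  exact_mod_cast h1

/-- A finite measure carried by a set without aliasing is determined by its values on the waves
sampled at the rate `Δ`. -/
lemma measure_eq_of_forall_integral_wave_int_eq {Δ : ℝ} (hΔ : 0 < Δ) {F : Set ℝ}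
    (hF : MeasurableSet F) (hinj : Set.InjOn ((↑) : ℝ → AddCircle Δ) F) (m₁ m₂ : Measure ℝ)
    [IsFiniteMeasure m₁] [IsFiniteMeasure m₂] (h₁ : m₁ Fᶜ = 0) (h₂ : m₂ Fᶜ = 0)
    (h : ∀ n : ℤ, ∫ f, wave f (n / Δ) ∂m₁ = ∫ f, wave f (n / Δ) ∂m₂) : m₁ = m₂ := by
  have : Fact (0 < Δ) := ⟨hΔ⟩
  have hπ : Measurable ((↑) : ℝ → AddCircle Δ) := AddCircle.measurable_mk'
  have hmap : m₁.map ((↑) : ℝ → AddCircle Δ) = m₂.map ((↑) : ℝ → AddCircle Δ) := by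
    refine measure_addCircle_eq_of_forall_integral_fourier_eq _ _ fun n => ?_
    rw [integral_map hπ.aemeasurable (fourier n).continuous.aestronglyMeasurable,
      integral_map hπ.aemeasurable (fourier n).continuous.aestronglyMeasurable]
    convert h n using 3 with f f <;>
    · rw [fourier_coe_apply, wave]
      congr 1
      push_cast
      ring
  ext A hA
  -- By injectivity on `F` the image of `A ∩ F` is measurable (Lusin–Souslin), so the measure of `A`
  -- can be read off from the pushforward to the circle.
  have hB := (hA.inter hF).image_of_measurable_injOn hπ (hinj.mono Set.inter_subset_right)
  have key (m : Measure ℝ) (hm : m Fᶜ = 0) :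
      m A = m.map ((↑) : ℝ → AddCircle Δ) ((↑) '' (A ∩ F)) := by
    rw [Measure.map_apply hπ hB, ← measure_inter_add_sdiff A hF,
      ← measure_inter_add_sdiff (_ ⁻¹' _) hF, measure_mono_null (Set.sdiff_subset_compl _ _) hm,
      measure_mono_null (Set.sdiff_subset_compl _ _) hm]
    congr 2
    ext x
    constructor
    · rintro ⟨h1, h2⟩; exact ⟨⟨x, ⟨h1, h2⟩, rfl⟩, h2⟩
    · rintro ⟨⟨y, ⟨h1, h2⟩, h3⟩, h4⟩
      rw [← hinj h2 h4 h3]; exact ⟨h1, h2⟩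
  rw [key m₁ h₁, key m₂ h₂, hmap]

end

/-! ### Existence of filter outputs; the error as a distance between frequency responses -/

section

variable {Ω : Type*} [MeasurableSpace Ω] {μ : Measure Ω} {SX Sη : ℝ → ℝ} {X : ℝ → Ω → ℝ}
  {η : {g : ℝ → ℂ // IsFilter Sη g} → Ω → ℝ}

/-- Real combinations of waves converge to the delayed response in `L²(S_X)`. Their noise components
are zero, so the isometry makes the corresponding combinations of `X` a Cauchy sequence, whose limit
is the output. -/
lemma exists_isResponse (hm : IsNoisySource μ SX Sη X η) {H : ℝ → ℂ}
    (hH : IsFilter (fun f => SX f + Sη f) H) (t : ℝ) :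
    ∃ U : Ω → ℝ, Measurable U ∧ IsResponse μ SX X H t U := by
  have hHm := hH.measurable
  have hq := hH.memLp_signal hm t
  have happ (ε : ℝ) (hε : 0 < ε) := exists_finsupp_real (τ := fun s : ℝ => s) hm.psd_signal
    hm.integrable_psd (q := fun f => H f * wave f t) (by fun_prop)
    (fun f => by rw [hH.hermitian, wave_neg_left, map_mul])
    ((memLp_psdMeasure hm.psd_signal (by fun_prop)).1 hq) (fun s => ⟨-s, rfl⟩)
    (fun m₁ m₂ _ _ _ _ h => measure_eq_of_forall_integral_wave_eq m₁ m₂ h) hε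
  have hpos (n : ℕ) : (0 : ℝ) < 1 / (n + 1) := by positivity
  choose c hc using fun n : ℕ => happ ((1 / (n + 1)) ^ 2) (pow_pos (hpos n) 2)
  choose T hT h1 h2 h3 using fun n => HasSpectrum.finsupp_sum (hasSpectrum_signal hm) (c n)
  have h30 (n) : (T n).2.2 = 0 := by
    refine Lp.ext (((h3 n).symm.trans ?_).trans (Lp.coeFn_zero _ _ _).symm)
    exact ae_of_all _ fun f => by simp
  have hW (n) : dist (T n).2.1 hq.toLp < 1 / (n + 1) := by
    rw [dist_comm, dist_eq_norm]
    exact norm_sub_lt_of_integral_psd hm.psd_signal hq.coeFn_toLp.symm (h2 n) (hpos n) (hc n)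
  have hWt : Tendsto (fun n => (T n).2.1) atTop (𝓝 hq.toLp) :=
    tendsto_iff_dist_tendsto_zero.2 (squeeze_zero (fun _ => dist_nonneg) (fun n => (hW n).le)
      tendsto_one_div_add_atTop_nhds_zero_nat)
  have hiso (n m) : dist (T n).1 (T m).1 = dist (T n).2.1 (T m).2.1 := by
    have h := norm_sq_fst_of_mem_spectralGraph hm (Submodule.sub_mem _ (hT n) (hT m))
    simp only [Prod.fst_sub, Prod.snd_sub, h30, sub_zero, norm_zero] at h
    rw [dist_eq_norm, dist_eq_norm, ← sq_eq_sq₀ (norm_nonneg _) (norm_nonneg _), h]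
    ring
  have hcau : CauchySeq fun n => (T n).1 := by
    have := hWt.cauchySeq
    rw [Metric.cauchySeq_iff] at this ⊢
    simpa only [hiso] using this
  obtain ⟨U, hU⟩ := cauchySeq_tendsto_of_complete hcau
  refine ⟨U, (Lp.stronglyMeasurable U).measurable, Lp.memLp U, fun ε hε => ?_⟩
  have hev1 : ∀ᶠ n : ℕ in atTop, ((1 : ℝ) / (n + 1)) ^ 2 < ε := by
    have : Tendsto (fun n : ℕ => ((1 : ℝ) / (n + 1)) ^ 2) atTop (𝓝 0) := by
      simpa using tendsto_one_div_add_atTop_nhds_zero_nat (𝕜 := ℝ).pow 2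
    exact this.eventually_lt_const hε
  have hev2 : ∀ᶠ n in atTop, ‖U - (T n).1‖ ^ 2 < ε := by
    have : Tendsto (fun n => ‖U - (T n).1‖ ^ 2) atTop (𝓝 0) := by
      simpa using ((tendsto_const_nhds (x := U)).sub hU).norm.pow 2
    exact this.eventually_lt_const hε
  obtain ⟨n, hn1, hn2⟩ := (hev1.and hev2).exists
  refine ⟨c n, (hc n).trans hn1, lt_of_eq_of_lt ?_ hn2⟩
  rw [← integral_sq_Lp_two]
  refine integral_congr_ae ?_
  filter_upwards [h1 n, Lp.coeFn_sub U (T n).1] with ω e1 e2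
  rw [e2, Pi.sub_apply, e1]

lemma exists_isFilterBankOutput (hm : IsNoisySource μ SX Sη X η) {P : ℕ} {H : Fin P → ℝ → ℂ}
    (hH : ∀ p, IsFilter (fun f => SX f + Sη f) (H p)) :
    ∃ Z, IsFilterBankOutput μ SX Sη X η H Z := by
  choose U hUm hU using fun p t => exists_isResponse hm (hH p) t
  exact ⟨fun p t ω => U p t ω + η ⟨_, (hH p).isFilter_noise hm t⟩ ω,
    fun p t => (hUm p t).add (hm.noise.measurable _),
    fun p t => ⟨U p t, _, hU p t, fun f => rfl, Filter.EventuallyEq.rfl⟩⟩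

/-- The mean squared error at time `t` in estimating `X` from the samples `Y`. -/
def mseAt (μ : Measure Ω) (X : ℝ → Ω → ℝ) {P : ℕ} (Y : Fin P → ℤ → Ω → ℝ) (t : ℝ) : ℝ :=
  ∫ ω, (X t ω - (μ[X t | sigmaSamples Y]) ω) ^ 2 ∂μ

/-- The frequency response of a finite linear combination of samples. -/
def combResponse (fs : ℝ) {P : ℕ} (H : Fin P → ℝ → ℂ) (c : Fin P × ℤ →₀ ℝ) (f : ℝ) : ℂ :=
  c.sum fun i a => (a : ℂ) * (H i.1 f * wave f ((i.2 : ℝ) * (P : ℝ) / fs))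

/-- The mean squared error in estimating `X t` by the linear estimate with frequency
response `G`. -/
def spectralError (SX Sη : ℝ → ℝ) (t : ℝ) (G : ℝ → ℂ) : ℝ :=
  (∫ f, ‖wave f t - G f‖ ^ 2 * SX f) + ∫ f, ‖G f‖ ^ 2 * Sη f

lemma integral_signal_sub_comb_sq (hm : IsNoisySource μ SX Sη X η) {P : ℕ} {H : Fin P → ℝ → ℂ}
    (hH : ∀ p, IsFilter (fun f => SX f + Sη f) (H p)) {Z : Fin P → ℝ → Ω → ℝ}
    (hZ : IsFilterBankOutput μ SX Sη X η H Z) (fs t : ℝ) (c : Fin P × ℤ →₀ ℝ) :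
    ∫ ω, (X t ω - c.sum fun i a => a * samples fs Z i.1 i.2 ω) ^ 2 ∂μ
      = spectralError SX Sη t (combResponse fs H c) := by
  have h1 := (hasSpectrum_signal hm t).add ((HasSpectrum.finsupp_sum
    (fun i : Fin P × ℤ => hZ.hasSpectrum hm hH i.1 ((i.2 : ℝ) * (P : ℝ) / fs)) c).const_mul (-1))
  have h2 := h1.integral_sq hm
  rw [spectralError]
  convert h2 using 3
  · rw [neg_one_mul, ← sub_eq_add_neg]; rfl
  · funext f; push_cast; rw [neg_one_mul, ← sub_eq_add_neg]; rfl
  · funext f; push_cast; rw [Pi.zero_apply, zero_add, neg_one_mul, norm_neg]; rfl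

/-- Mean square continuity is dominated convergence in the spectral integral, with majorant `4 S_X`.
-/
lemma continuous_of_ae_eq_signal (hm : IsNoisySource μ SX Sη X η) (x : ℝ → Lp ℝ 2 μ)
    (hx : ∀ t, X t =ᵐ[μ] x t) : Continuous x := by
  have hn (s t : ℝ) : ‖x s - x t‖ ^ 2 = ∫ f, ‖wave f s - wave f t‖ ^ 2 * SX f := by
    have h := ((hasSpectrum_signal hm s).add ((hasSpectrum_signal hm t).const_mul
        (-1))).integral_sq hm
    rw [← integral_sq_Lp_two]
    simp only [Pi.zero_apply, mul_zero, add_zero, norm_zero] at h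
    rw [zero_pow two_ne_zero] at h
    simp only [zero_mul, integral_zero, add_zero] at h
    have e : ∫ ω, (x s - x t : Lp ℝ 2 μ) ω ^ 2 ∂μ = ∫ ω, (X s ω + -1 * X t ω) ^ 2 ∂μ := by
      refine integral_congr_ae ?_
      filter_upwards [hx s, hx t, Lp.coeFn_sub (x s) (x t)] with ω h1 h2 h3
      rw [h3, Pi.sub_apply, ← h1, ← h2]; ring
    rw [e, h]
    refine integral_congr_ae (ae_of_all _ fun f => ?_)
    simp only
    congr 3
    push_cast; ring
  rw [continuous_iff_continuousAt]
  intro t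
  have h0 : Tendsto (fun s => ‖x s - x t‖ ^ 2) (𝓝 t) (𝓝 0) := by
    simp_rw [hn]
    have h1 : ∫ f, ‖wave f t - wave f t‖ ^ 2 * SX f = 0 := by simp
    rw [← h1]
    refine tendsto_integral_filter_of_dominated_convergence (fun f => 4 * SX f) ?_ ?_
      (hm.integrable_psd.const_mul 4) ?_
    · refine Filter.Eventually.of_forall fun s => ?_
      have := hm.psd_signal.measurable
      exact (by fun_prop : Measurable fun f => ‖wave f s - wave f t‖ ^ 2 * SX
          f).aestronglyMeasurable
    · refine Filter.Eventually.of_forall fun s => ae_of_all _ fun f => ?_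
      have h2 : ‖wave f s - wave f t‖ ≤ 2 := by
        refine (norm_sub_le _ _).trans ?_
        simp only [norm_wave]; norm_num
      rw [Real.norm_of_nonneg (mul_nonneg (sq_nonneg _) (hm.psd_signal.nonneg f))]
      have := hm.psd_signal.nonneg f
      gcongr
      nlinarith [norm_nonneg (wave f s - wave f t)]
    · refine ae_of_all _ fun f => ?_
      have hc : Continuous fun s => ‖wave f s - wave f t‖ ^ 2 * SX f := by
        have : Continuous fun s => wave f s := continuous_wave.comp (by fun_prop : Continuous fun s
            => (f, s))
        fun_prop
      exact hc.tendsto t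
  have h2 : Tendsto (fun s => ‖x s - x t‖) (𝓝 t) (𝓝 0) := by
    have := h0.sqrt
    simpa [Real.sqrt_sq] using this
  exact tendsto_iff_norm_sub_tendsto_zero.2 h2

lemma norm_sub_sum_sq_eq (hm : IsNoisySource μ SX Sη X η) {P : ℕ} {H : Fin P → ℝ → ℂ}
    (hH : ∀ p, IsFilter (fun f => SX f + Sη f) (H p)) {Z : Fin P → ℝ → Ω → ℝ}
    (hZ : IsFilterBankOutput μ SX Sη X η H Z) {fs t : ℝ} {x : Lp ℝ 2 μ}
    {y : Fin P × ℤ → Lp ℝ 2 μ} (hx : X t =ᵐ[μ] x) (hy : ∀ i, samples fs Z i.1 i.2 =ᵐ[μ] y i)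
    (c : Fin P × ℤ →₀ ℝ) :
    ‖x - c.sum fun i a => a • y i‖ ^ 2 = spectralError SX Sη t (combResponse fs H c) := by
  rw [← integral_signal_sub_comb_sq hm hH hZ, ← integral_sq_Lp_two]
  refine integral_congr_ae ?_
  have h2 := Lp.coeFn_finsetSum (p := 2) (μ := μ) c.support fun i => c i • y i
  have h3 : ∀ᵐ ω ∂μ, ∀ i ∈ c.support, (c i • y i : Lp ℝ 2 μ) ω = c i * samples fs Z i.1 i.2 ω := by
    refine (Filter.eventually_all_finset c.support).2 fun i _ => ?_
    filter_upwards [Lp.coeFn_smul (c i) (y i), hy i] with ω h h'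
    rw [h, Pi.smul_apply, h', smul_eq_mul]
  filter_upwards [hx, h2, h3, Lp.coeFn_sub x (c.sum fun i a => a • y i)] with f e1 e2 e3 e4
  rw [e4, Pi.sub_apply, e1, Finsupp.sum, Finsupp.sum, e2, Finset.sum_apply, Finset.sum_congr rfl e3]

variable [IsProbabilityMeasure μ]

/-- The mean squared error as a squared distance to a closed subspace. -/
lemma exists_mseAt_eq_norm_sq (hm : IsNoisySource μ SX Sη X η) {P : ℕ} {H : Fin P → ℝ → ℂ}
    (hH : ∀ p, IsFilter (fun f => SX f + Sη f) (H p)) {Z : Fin P → ℝ → Ω → ℝ}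
    (hZ : IsFilterBankOutput μ SX Sη X η H Z) (fs : ℝ) :
    ∃ (x : ℝ → Lp ℝ 2 μ) (y : Fin P × ℤ → Lp ℝ 2 μ), Continuous x ∧
      (∀ t, X t =ᵐ[μ] x t) ∧ (∀ i, samples fs Z i.1 i.2 =ᵐ[μ] y i) ∧
      ∀ t, mseAt μ X (samples fs Z) t
        = ‖x t - (Submodule.span ℝ (Set.range y)).topologicalClosure.starProjection (x t)‖ ^ 2 := by
  choose TX hTX hX _ _ using fun t => hasSpectrum_signal hm t
  choose TY hTY hY _ _ using fun i : Fin P × ℤ =>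
    hZ.hasSpectrum hm hH i.1 ((i.2 : ℝ) * (P : ℝ) / fs)
  refine ⟨fun t => (TX t).1, fun i => (TY i).1, continuous_of_ae_eq_signal hm _ hX, hX, hY, fun t
      => ?_⟩
  -- `M` is the Gaussian Hilbert space containing the signal and all samples; Gaussianity and
  -- centring pass to the closure.
  set M := ((spectralGraph μ SX Sη X η).map (LinearMap.fst ℝ _ _)).topologicalClosure with hM
  have hsub {T} (hT : T ∈ spectralGraph μ SX Sη X η) : T.1 ∈ M :=
    Submodule.le_topologicalClosure _ ⟨T, hT, rfl⟩
  have hind {p : Lp ℝ 2 μ → Prop} (hp : IsClosed {u | p u})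
      (h : ∀ T ∈ spectralGraph μ SX Sη X η, p T.1) (u) (hu : u ∈ M) : p u := by
    rw [hM, ← SetLike.mem_coe, Submodule.topologicalClosure_coe] at hu
    refine closure_minimal ?_ hp hu
    rintro _ ⟨T, hT, rfl⟩
    exact h T hT
  have hsig : sigmaSamples (samples fs Z)
      = ⨆ i : Fin P × ℤ, MeasurableSpace.comap (samples fs Z i.1 i.2) inferInstance := by
    rw [iSup_prod]
  rw [mseAt, hsig]
  exact integral_sub_condExp_sq μ M (Submodule.isClosed_topologicalClosure _)
    (hind (isClosed_hasGaussianLaw μ) fun T hT => hasGaussianLaw_fst_of_mem_spectralGraph hm hT)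
    (hind (isClosed_eq (continuous_integral_Lp_two μ) continuous_const)
      fun T hT => integral_fst_of_mem_spectralGraph hm hT)
    (fun i : Fin P × ℤ => samples fs Z i.1 i.2) _ (fun i => hZ.measurable _ _) hY
    (fun i => hsub (hTY i)) (X t) _ (hX t) (hsub (hTX t))

lemma continuous_mseAt (hm : IsNoisySource μ SX Sη X η) {P : ℕ} {H : Fin P → ℝ → ℂ}
    (hH : ∀ p, IsFilter (fun f => SX f + Sη f) (H p)) {Z : Fin P → ℝ → Ω → ℝ}
    (hZ : IsFilterBankOutput μ SX Sη X η H Z) (fs : ℝ) :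
    Continuous (mseAt μ X (samples fs Z)) := by
  obtain ⟨x, y, hx, -, -, h⟩ := exists_mseAt_eq_norm_sq hm hH hZ fs
  rw [funext h]
  fun_prop

lemma mseAt_le_spectralError (hm : IsNoisySource μ SX Sη X η) {P : ℕ} {H : Fin P → ℝ → ℂ}
    (hH : ∀ p, IsFilter (fun f => SX f + Sη f) (H p)) {Z : Fin P → ℝ → Ω → ℝ}
    (hZ : IsFilterBankOutput μ SX Sη X η H Z) (fs t : ℝ) (c : Fin P × ℤ →₀ ℝ) :
    mseAt μ X (samples fs Z) t ≤ spectralError SX Sη t (combResponse fs H c) := by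
  obtain ⟨x, y, -, hx, hy, h⟩ := exists_mseAt_eq_norm_sq hm hH hZ fs
  rw [h, ← norm_sub_sum_sq_eq hm hH hZ (hx t) hy c, Submodule.starProjection_minimal]
  refine pow_le_pow_left₀ (Real.iInf_nonneg fun _ => norm_nonneg _) ?_ 2
  refine ciInf_le_of_le ⟨0, by rintro _ ⟨v, rfl⟩; exact norm_nonneg _⟩
    ⟨c.sum fun i a => a • y i, Submodule.le_topologicalClosure _
      (Finsupp.mem_span_range_iff_exists_finsupp.2 ⟨c, rfl⟩)⟩ le_rfl

/-- Together with `mseAt_le_spectralError` this makes the error at time `t` the infimum of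
`spectralError` over finite real combinations of samples, which reduces the remaining estimates to
frequency responses. -/
lemma exists_spectralError_lt (hm : IsNoisySource μ SX Sη X η) {P : ℕ} {H : Fin P → ℝ → ℂ}
    (hH : ∀ p, IsFilter (fun f => SX f + Sη f) (H p)) {Z : Fin P → ℝ → Ω → ℝ}
    (hZ : IsFilterBankOutput μ SX Sη X η H Z) (fs t : ℝ) {ε : ℝ} (hε : 0 < ε) :
    ∃ c : Fin P × ℤ →₀ ℝ, spectralError SX Sη t (combResponse fs H c)
      < mseAt μ X (samples fs Z) t + ε := by
  obtain ⟨x, y, -, hx, hy, h⟩ := exists_mseAt_eq_norm_sq hm hH hZ fs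
  set V := Submodule.span ℝ (Set.range y)
  have hp : V.topologicalClosure.starProjection (x t) ∈ closure (V : Set (Lp ℝ 2 μ)) := by
    rw [← Submodule.topologicalClosure_coe]
    exact Submodule.starProjection_apply_mem _ _
  have hopen : IsOpen {v : Lp ℝ 2 μ | ‖x t - v‖ ^ 2 < mseAt μ X (samples fs Z) t + ε} :=
    isOpen_lt (by fun_prop) continuous_const
  obtain ⟨v, hv1, hv2⟩ := mem_closure_iff.1 hp _ hopen (by
    change ‖_‖ ^ 2 < mseAt μ X (samples fs Z) t + ε
    rw [h]; linarith)
  obtain ⟨c, rfl⟩ := Finsupp.mem_span_range_iff_exists_finsupp.1 hv2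
  exact ⟨c, by rw [← norm_sub_sum_sq_eq hm hH hZ (hx t) hy c]; exact hv1⟩

end

/-! ### Periodicity of the error and existence of the time average -/

section

/-- Subtracting the linear growth `t m` from the primitive of `g` leaves a continuous periodic
function `B`, hence a bounded one, which the factor `1 / (2T)` kills. -/
lemma tendsto_average_of_periodic {g : ℝ → ℝ} (hg : Continuous g) {τ : ℝ} (hτ : 0 < τ)
    (hp : Function.Periodic g τ) :
    Tendsto (fun T : ℝ => 1 / (2 * T) * ∫ t in (-T)..T, g t) atTop
      (𝓝 (1 / τ * ∫ t in (0 : ℝ)..τ, g t)) := by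
  set m := 1 / τ * ∫ t in (0 : ℝ)..τ, g t with hm
  set B : ℝ → ℝ := fun t => (∫ s in (0 : ℝ)..t, g s) - t * m with hB
  have hgi (a b : ℝ) : IntervalIntegrable g volume a b := hg.intervalIntegrable a b
  have hBc : Continuous B := by
    have := intervalIntegral.continuous_primitive (fun a b => hgi a b) 0
    fun_prop
  have hBp : Function.Periodic B τ := fun t => by
    have h1 := intervalIntegral.integral_add_adjacent_intervals (hgi 0 t) (hgi t (t + τ))
    have h2 := hp.intervalIntegral_add_eq t 0
    rw [zero_add] at h2
    simp only [hB]
    rw [← h1, h2, hm]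
    field_simp
    ring
  obtain ⟨C, hC⟩ := (hBp.isBounded_of_continuous hτ.ne' hBc).exists_norm_le
  have hC' (t : ℝ) : |B t| ≤ C := hC _ ⟨t, rfl⟩
  have key : ∀ T : ℝ, T ≠ 0 → 1 / (2 * T) * ∫ t in (-T)..T, g t = m + (B T - B (-T)) * (1 / (2 *
      T)) := by
    intro T hT
    have h1 := intervalIntegral.integral_interval_sub_left (hgi 0 T) (hgi 0 (-T))
    simp only [hB]
    rw [← h1]
    field_simp
    ring
  have hlim : Tendsto (fun T : ℝ => (B T - B (-T)) * (1 / (2 * T))) atTop (𝓝 0) := by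
    refine squeeze_zero_norm' (a := fun T => 2 * C * (1 / (2 * T))) ?_ ?_
    · filter_upwards [eventually_gt_atTop 0] with T hT
      rw [norm_mul, Real.norm_of_nonneg (by positivity : 0 ≤ 1 / (2 * T))]
      gcongr
      refine (norm_sub_le _ _).trans ?_
      rw [Real.norm_eq_abs, Real.norm_eq_abs]
      linarith [hC' T, hC' (-T)]
    · have : Tendsto (fun T : ℝ => C * T⁻¹) atTop (𝓝 (C * 0)) := tendsto_inv_atTop_zero.const_mul C
      rw [mul_zero] at this
      refine this.congr fun T => ?_
      ring
  have h3 := hlim.const_add m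
  rw [add_zero] at h3
  refine h3.congr' ?_
  filter_upwards [eventually_gt_atTop 0] with T hT
  rw [key T hT.ne']

variable {Ω : Type*} [MeasurableSpace Ω] {μ : Measure Ω} {SX Sη : ℝ → ℝ} {X : ℝ → Ω → ℝ}
  {η : {g : ℝ → ℂ // IsFilter Sη g} → Ω → ℝ}

lemma spectralError_wave_mul (SX Sη : ℝ → ℝ) (t s : ℝ) (G : ℝ → ℂ) :
    spectralError SX Sη (t + s) (fun f => wave f s * G f) = spectralError SX Sη t G := by
  simp only [spectralError, wave_add, norm_mul, norm_wave, one_mul]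
  congr 2
  ext f
  rw [mul_comm (wave f t), ← mul_sub, norm_mul, norm_wave, one_mul]

/-- Delaying all coefficients by `k` sampling periods delays the linear estimate. -/
lemma exists_combResponse_eq_wave_mul (fs : ℝ) {P : ℕ} (H : Fin P → ℝ → ℂ) (c : Fin P × ℤ →₀ ℝ)
    (k : ℤ) : ∃ d : Fin P × ℤ →₀ ℝ,
      combResponse fs H d = fun f => wave f (k * (P / fs)) * combResponse fs H c f := by
  refine ⟨c.embDomain ((Equiv.prodCongr (Equiv.refl _) (Equiv.addRight k)).toEmbedding), ?_⟩
  ext f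
  rw [combResponse, Finsupp.sum_embDomain, combResponse, Finsupp.mul_sum]
  refine Finsupp.sum_congr fun i _ => ?_
  have : wave f (((i.2 + k : ℤ) : ℝ) * P / fs) = wave f (k * (P / fs)) * wave f (i.2 * P / fs) := by
    rw [← wave_add]
    congr 1
    push_cast; ring
  simp only [Equiv.coe_toEmbedding, Equiv.prodCongr_apply, Prod.map_fst, Prod.map_snd,
    Equiv.refl_apply, Equiv.coe_addRight, this]
  ring

variable [IsProbabilityMeasure μ]

/-- A nearly optimal combination for time `t`, delayed by `k` sampling periods, has the same
spectral error at the delayed time. -/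
lemma mseAt_add_le (hm : IsNoisySource μ SX Sη X η) {P : ℕ} {H : Fin P → ℝ → ℂ}
    (hH : ∀ p, IsFilter (fun f => SX f + Sη f) (H p)) {Z : Fin P → ℝ → Ω → ℝ}
    (hZ : IsFilterBankOutput μ SX Sη X η H Z) (fs t : ℝ) (k : ℤ) :
    mseAt μ X (samples fs Z) (t + k * (P / fs)) ≤ mseAt μ X (samples fs Z) t := by
  refine le_of_forall_pos_le_add fun ε hε => ?_
  obtain ⟨c, hc⟩ := exists_spectralError_lt hm hH hZ fs t hε
  obtain ⟨d, hd⟩ := exists_combResponse_eq_wave_mul fs H c k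
  refine (mseAt_le_spectralError hm hH hZ fs _ d).trans ?_
  rw [hd, spectralError_wave_mul]
  exact hc.le

lemma periodic_mseAt (hm : IsNoisySource μ SX Sη X η) {P : ℕ} {H : Fin P → ℝ → ℂ}
    (hH : ∀ p, IsFilter (fun f => SX f + Sη f) (H p)) {Z : Fin P → ℝ → Ω → ℝ}
    (hZ : IsFilterBankOutput μ SX Sη X η H Z) (fs : ℝ) :
    Function.Periodic (mseAt μ X (samples fs Z)) (P / fs) := fun t => by
  have h1 := mseAt_add_le hm hH hZ fs t 1
  have h2 := mseAt_add_le hm hH hZ fs (t + P / fs) (-1)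
  push_cast at h1 h2
  rw [one_mul] at h1
  rw [neg_one_mul, add_neg_cancel_right] at h2
  exact le_antisymm h1 h2

/-- The mean squared error averaged over one sampling period. -/
def meanMse (μ : Measure Ω) (X : ℝ → Ω → ℝ) {P : ℕ} (fs : ℝ) (Z : Fin P → ℝ → Ω → ℝ) : ℝ :=
  1 / (P / fs) * ∫ t in (0 : ℝ)..(P / fs), mseAt μ X (samples fs Z) t

lemma hasMMSE_meanMse (hm : IsNoisySource μ SX Sη X η) {P : ℕ} (hP : 0 < P) {H : Fin P → ℝ → ℂ}
    (hH : ∀ p, IsFilter (fun f => SX f + Sη f) (H p)) {Z : Fin P → ℝ → Ω → ℝ}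
    (hZ : IsFilterBankOutput μ SX Sη X η H Z) {fs : ℝ} (hfs : 0 < fs) :
    HasMMSE μ X (samples fs Z) (meanMse μ X fs Z) :=
  tendsto_average_of_periodic (continuous_mseAt hm hH hZ fs)
    (div_pos (Nat.cast_pos.2 hP) hfs) (periodic_mseAt hm hH hZ fs)

lemma mseAt_nonneg (μ : Measure Ω) (X : ℝ → Ω → ℝ) {P : ℕ} (Y : Fin P → ℤ → Ω → ℝ) (t : ℝ) :
    0 ≤ mseAt μ X Y t := integral_nonneg fun _ => sq_nonneg _

end

/-! ### Approximating rotating vectors from a finite-dimensional space -/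

section

/-- Take for `A` the `P` largest values. The weight outside `A` does not exceed the deficit `∑ (1 -
w k)` inside `A`, and every value inside is at least the largest value outside, so moving the weight
inwards loses nothing. The lemma serves both bounds: for the aliases in a fibre and for the cells
that replace an optimal set. -/
lemma exists_finset_sum_mul_le {ι : Type*} [Fintype ι] (P : ℕ) (ρ w : ι → ℝ)
    (hρ : ∀ k, 0 ≤ ρ k) (hw0 : ∀ k, 0 ≤ w k) (hw1 : ∀ k, w k ≤ 1) (hw : ∑ k, w k ≤ P) :
    ∃ A : Finset ι, A.card ≤ P ∧ ∑ k, w k * ρ k ≤ ∑ k ∈ A, ρ k := by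
  classical
  rcases le_or_gt (Fintype.card ι) P with hP | hP
  · exact ⟨Finset.univ, hP, Finset.sum_le_sum fun k _ =>
      mul_le_of_le_one_left (hρ k) (hw1 k)⟩
  have hne : (Finset.powersetCard P (Finset.univ : Finset ι)).Nonempty :=
    Finset.powersetCard_nonempty.2 hP.le
  obtain ⟨A, hA, hmax⟩ := Finset.exists_max_image _ (fun A => ∑ k ∈ A, ρ k) hne
  have hAc : A.card = P := (Finset.mem_powersetCard.1 hA).2
  have hexch : ∀ a ∈ A, ∀ k ∉ A, ρ k ≤ ρ a := by
    intro a ha k hk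
    have hk' : k ∉ A.erase a := fun h => hk (Finset.mem_of_mem_erase h)
    have h := hmax (insert k (A.erase a)) (Finset.mem_powersetCard.2 ⟨Finset.subset_univ _, by
      rw [Finset.card_insert_of_notMem hk', Finset.card_erase_of_mem ha, hAc]
      have : 0 < P := hAc ▸ Finset.card_pos.2 ⟨a, ha⟩
      omega⟩)
    rw [Finset.sum_insert hk'] at h
    have := Finset.add_sum_erase A ρ ha
    linarith
  have hcne : Aᶜ.Nonempty := by
    rw [← Finset.card_pos, Finset.card_compl, hAc]; omega
  obtain ⟨j, hj, hjmax⟩ := Finset.exists_max_image Aᶜ ρ hcne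
  refine ⟨A, hAc.le, ?_⟩
  rw [← Finset.sum_add_sum_compl A] at hw ⊢
  have h1 : ∑ k ∈ Aᶜ, w k * ρ k ≤ ρ j * ∑ k ∈ Aᶜ, w k := by
    rw [Finset.mul_sum]
    refine Finset.sum_le_sum fun k hk => ?_
    rw [mul_comm]
    exact mul_le_mul_of_nonneg_right (hjmax k hk) (hw0 k)
  have h2 : ρ j * ∑ k ∈ Aᶜ, w k ≤ ρ j * ∑ k ∈ A, (1 - w k) := by
    refine mul_le_mul_of_nonneg_left ?_ (hρ j)
    rw [Finset.sum_sub_distrib, Finset.sum_const, hAc]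
    simp only [nsmul_eq_mul, mul_one]
    linarith
  have h3 : ρ j * ∑ k ∈ A, (1 - w k) ≤ ∑ k ∈ A, (1 - w k) * ρ k := by
    rw [Finset.mul_sum]
    refine Finset.sum_le_sum fun k hk => ?_
    rw [mul_comm]
    exact mul_le_mul_of_nonneg_left (hexch k hk j (Finset.mem_compl.1 hj)) (by linarith [hw1 k])
  have h4 : ∑ k ∈ A, w k * ρ k + ∑ k ∈ A, (1 - w k) * ρ k = ∑ k ∈ A, ρ k := by
    rw [← Finset.sum_add_distrib]
    exact Finset.sum_congr rfl fun k _ => by ring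
  linarith

/-- Induction on `s`: the best index so far is compared with the new one on a measurable set. It
serves to choose the best aliases of each frequency. -/
lemma exists_measurable_argmax {α ι : Type*} [MeasurableSpace α] (s : Finset ι) (hs : s.Nonempty)
    (g : ι → α → ℝ) (hg : ∀ i, Measurable (g i)) :
    ∃ A : α → ι, (∀ i, MeasurableSet {x | A x = i}) ∧ (∀ x, A x ∈ s) ∧
      ∀ x, ∀ i ∈ s, g i x ≤ g (A x) x := by
  classical
  induction hs using Finset.Nonempty.cons_induction with
  | singleton a =>
    exact ⟨fun _ => a, fun i => MeasurableSet.const _, fun _ => Finset.mem_singleton_self a,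
      fun x i hi => by rw [Finset.mem_singleton.1 hi]⟩
  | cons a s ha hs ih =>
    obtain ⟨A, hA, hAs, hAmax⟩ := ih
    have hAm : Measurable fun x => g (A x) x := by
      have : (fun x => g (A x) x) = fun x => ∑ i ∈ s, Set.indicator {x | A x = i} (g i) x := by
        funext x
        rw [Finset.sum_eq_single (A x)]
        · rw [Set.indicator_of_mem (by simp)]
        · intro i _ hi; exact Set.indicator_of_notMem (fun h => hi h.symm) _
        · intro h; exact absurd (hAs x) h
      rw [this]
      exact Finset.measurable_sum _ fun i _ => (hg i).indicator (hA i)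
    have hms : MeasurableSet {x | g (A x) x ≤ g a x} := measurableSet_le hAm (hg a)
    refine ⟨fun x => if g (A x) x ≤ g a x then a else A x, fun i => ?_, fun x => ?_, fun x i hi =>
        ?_⟩
    · have : {x | (if g (A x) x ≤ g a x then a else A x) = i}
          = ({x | g (A x) x ≤ g a x} ∩ {_x | a = i}) ∪ ({x | g (A x) x ≤ g a x}ᶜ ∩ {x | A x = i})
              := by
        ext x
        by_cases h : g (A x) x ≤ g a x <;> simp [h]
      rw [this]
      exact (hms.inter (MeasurableSet.const _)).union (hms.compl.inter (hA i))
    · dsimp only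
      split_ifs
      · exact Finset.mem_cons_self _ _
      · exact Finset.mem_cons_of_mem (hAs x)
    · dsimp only
      rcases Finset.mem_cons.1 hi with rfl | hi
      · split_ifs with h
        · exact le_rfl
        · exact (not_le.1 h).le
      · split_ifs with h
        · exact (hAmax x i hi).trans h
        · exact hAmax x i hi

/-- Total weight of a subspace in the coordinate directions. -/
lemma exists_weights {ι : Type*} [Fintype ι] (J : Submodule ℂ (EuclideanSpace ℂ ι)) {P : ℕ}
    (hJ : Module.finrank ℂ J ≤ P) :
    ∃ (n : ℕ) (v : Fin n → EuclideanSpace ℂ ι),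
      (∀ x, ‖x - J.starProjection x‖ ^ 2 = ‖x‖ ^ 2 - ∑ i, ‖inner ℂ (v i) x‖ ^ 2) ∧
      (∀ k, ∑ i, ‖v i k‖ ^ 2 ≤ 1) ∧ ∑ k, ∑ i, ‖v i k‖ ^ 2 ≤ P := by
  classical
  -- For an orthonormal basis of `J`, the weight of a coordinate is the squared norm of the
  -- projection of its unit vector: at most `1` by Bessel, and `dim J` in total.
  set e := stdOrthonormalBasis ℂ J
  have ho : Orthonormal ℂ fun i => (e i : EuclideanSpace ℂ ι) :=
    e.orthonormal.comp_linearIsometry J.subtypeₗᵢ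
  refine ⟨_, fun i => (e i : EuclideanSpace ℂ ι), fun x => ?_, fun k => ?_, ?_⟩
  · have h1 : ‖J.starProjection x‖ ^ 2 = ∑ i, ‖inner ℂ (e i : EuclideanSpace ℂ ι) x‖ ^ 2 := by
      have h := e.sum_sq_norm_inner_right (J.orthogonalProjectionOnto x)
      rw [Submodule.starProjection_apply, Submodule.norm_coe, ← h]
      refine Finset.sum_congr rfl fun i _ => ?_
      rw [Submodule.inner_orthogonalProjectionOnto_eq_of_mem_left]
    have h2 := J.norm_sq_eq_add_norm_sq_starProjection x
    rw [← h1, h2, Submodule.starProjection_orthogonal_val]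
    ring
  · have h := ho.sum_inner_products_le (EuclideanSpace.single k (1 : ℂ)) (s := Finset.univ)
    simpa [EuclideanSpace.inner_single_right] using h
  · rw [Finset.sum_comm]
    have h (i) : ∑ k, ‖(e i : EuclideanSpace ℂ ι) k‖ ^ 2 = 1 := by
      rw [← EuclideanSpace.norm_sq_eq, ho.norm_eq_one, one_pow]
    simp only [h, Finset.sum_const, Finset.card_univ, Fintype.card_fin, nsmul_eq_mul, mul_one]
    exact_mod_cast hJ

lemma integral_wave_int_mul {Δ : ℝ} (hΔ : 0 < Δ) (k : ℤ) :
    ∫ t in (0 : ℝ)..(1 / Δ), wave (k * Δ) t = if k = 0 then ((1 / Δ : ℝ) : ℂ) else 0 := by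
  split_ifs with h
  · simp [h, wave]
  · have hc : (2 * (Real.pi : ℂ) * Complex.I * ((k * Δ : ℝ) : ℂ)) ≠ 0 := by
      have h1 : ((k : ℝ) * Δ) ≠ 0 := mul_ne_zero (Int.cast_ne_zero.2 h) hΔ.ne'
      have h2 : (((k : ℝ) * Δ : ℝ) : ℂ) ≠ 0 := Complex.ofReal_ne_zero.2 h1
      simp only [ne_eq, mul_eq_zero, h2, or_false]
      norm_num [Real.pi_ne_zero]
    simp only [wave]
    rw [integral_exp_mul_complex hc]
    have h3 : 2 * (Real.pi : ℂ) * Complex.I * ((k * Δ : ℝ) : ℂ) * ((1 / Δ : ℝ) : ℂ)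
        = k * (2 * Real.pi * Complex.I) := by
      have : (Δ : ℂ) ≠ 0 := Complex.ofReal_ne_zero.2 hΔ.ne'
      push_cast
      field_simp
    rw [h3, Complex.exp_int_mul_two_pi_mul_I]
    simp

/-- Parseval's identity over one period for waves at distinct frequencies spaced by `Δ`. -/
lemma integral_norm_sq_sum_wave {Δ : ℝ} (hΔ : 0 < Δ) (K : Finset ℤ) (a : K → ℂ) (f : ℝ) :
    ∫ t in (0 : ℝ)..(1 / Δ), ‖∑ k : K, a k * wave (f + k * Δ) t‖ ^ 2 = 1 / Δ * ∑ k, ‖a k‖ ^ 2 := by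
  classical
  have hc (x : ℝ) : Continuous fun t => wave x t := by unfold wave; fun_prop
  have e (t : ℝ) : ((‖∑ k : K, a k * wave (f + k * Δ) t‖ ^ 2 : ℝ) : ℂ)
      = ∑ k : K, ∑ l : K, a k * (starRingEnd ℂ) (a l) * wave (((k - l : ℤ) : ℝ) * Δ) t := by
    rw [← Complex.normSq_eq_norm_sq, ← Complex.mul_conj, map_sum, Finset.sum_mul_sum]
    refine Finset.sum_congr rfl fun k _ => Finset.sum_congr rfl fun l _ => ?_
    have : wave (f + k * Δ) t = wave (((k - l : ℤ) : ℝ) * Δ) t * wave (f + l * Δ) t := by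
      rw [← wave_add_left]; congr 1; push_cast; ring
    rw [this, map_mul]
    have h1 : wave (f + l * Δ) t * (starRingEnd ℂ) (wave (f + l * Δ) t) = 1 := by
      rw [Complex.mul_conj, Complex.normSq_eq_norm_sq]; simp
    linear_combination (a k * (starRingEnd ℂ) (a l) * wave (((k - l : ℤ) : ℝ) * Δ) t) * h1
  have h : ((∫ t in (0 : ℝ)..(1 / Δ), ‖∑ k : K, a k * wave (f + k * Δ) t‖ ^ 2 : ℝ) : ℂ)
      = ((1 / Δ * ∑ k, ‖a k‖ ^ 2 : ℝ) : ℂ) := by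
    rw [← intervalIntegral.integral_ofReal]
    simp_rw [e]
    rw [intervalIntegral.integral_finsetSum fun k _ => by
      refine Continuous.intervalIntegrable ?_ _ _
      fun_prop]
    have h2 (k : K) : ∫ t in (0 : ℝ)..(1 / Δ),
        ∑ l : K, a k * (starRingEnd ℂ) (a l) * wave (((k - l : ℤ) : ℝ) * Δ) t = ∑ l : K,
        ∫ t in (0 : ℝ)..(1 / Δ), a k * (starRingEnd ℂ) (a l) * wave (((k - l : ℤ) : ℝ) * Δ) t :=
      intervalIntegral.integral_finsetSum fun l _ =>
        Continuous.intervalIntegrable (by fun_prop) _ _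
    simp_rw [h2]
    simp only [intervalIntegral.integral_const_mul, integral_wave_int_mul hΔ]
    push_cast
    rw [Finset.mul_sum]
    refine Finset.sum_congr rfl fun k _ => ?_
    rw [Finset.sum_eq_single k]
    · rw [if_pos (sub_self _), Complex.mul_conj, Complex.normSq_eq_norm_sq]; push_cast; ring
    · intro l _ hl
      rw [if_neg, mul_zero]
      exact fun h => hl (Subtype.ext (sub_eq_zero.1 h).symm)
    · simp
  exact_mod_cast h

/-- On average over a period, the vectors `(b k e^{2πi (f + kΔ) t})` cannot be approximated from a
`P`-dimensional space better than by their `P` largest coordinates. -/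
lemma exists_finset_le_integral_norm_sub_starProjection {Δ : ℝ} (hΔ : 0 < Δ) (K : Finset ℤ)
    (b : K → ℝ) (f : ℝ) (J : Submodule ℂ (EuclideanSpace ℂ K)) {P : ℕ}
    (hJ : Module.finrank ℂ J ≤ P) (x : ℝ → EuclideanSpace ℂ K)
    (hx : ∀ t k, x t k = b k * wave (f + k * Δ) t) :
    ∃ A : Finset K, A.card ≤ P ∧ 1 / Δ * (∑ k, b k ^ 2 - ∑ k ∈ A, b k ^ 2)
      ≤ ∫ t in (0 : ℝ)..(1 / Δ), ‖x t - J.starProjection (x t)‖ ^ 2 := by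
  obtain ⟨n, v, h1, h2, h3⟩ := exists_weights J hJ
  obtain ⟨A, hA, hsum⟩ := exists_finset_sum_mul_le P (fun k => b k ^ 2)
    (fun k => ∑ i, ‖v i k‖ ^ 2) (fun _ => sq_nonneg _)
    (fun _ => Finset.sum_nonneg fun _ _ => sq_nonneg _) h2 h3
  refine ⟨A, hA, ?_⟩
  have hnorm (t : ℝ) : ‖x t‖ ^ 2 = ∑ k, b k ^ 2 := by
    rw [EuclideanSpace.norm_sq_eq]
    refine Finset.sum_congr rfl fun k _ => ?_
    rw [hx, norm_mul, norm_wave, mul_one, Complex.norm_real, Real.norm_eq_abs, sq_abs]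
  have hinner (i : Fin n) (t : ℝ) : inner ℂ (v i) (x t)
      = ∑ k : K, ((b k : ℂ) * (starRingEnd ℂ) (v i k)) * wave (f + k * Δ) t := by
    rw [PiLp.inner_apply]
    refine Finset.sum_congr rfl fun k _ => ?_
    rw [RCLike.inner_apply, hx]; ring
  simp_rw [h1, hnorm, hinner]
  have hc (x : ℝ) : Continuous fun t => wave x t := by unfold wave; fun_prop
  have hci (i : Fin n) : Continuous fun t =>
      ‖∑ k : K, ((b k : ℂ) * (starRingEnd ℂ) (v i k)) * wave (f + k * Δ) t‖ ^ 2 := by fun_prop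
  rw [intervalIntegral.integral_sub (by simp)
      ((continuous_finsetSum _ fun i _ => hci i).intervalIntegrable _ _),
    intervalIntegral.integral_finsetSum fun i _ => (hci i).intervalIntegrable _ _]
  -- As `J` does not move with `t`, each inner product is a trigonometric sum with constant
  -- coefficients, and Parseval removes the cross terms between coordinates.
  simp_rw [integral_norm_sq_sum_wave hΔ]
  rw [intervalIntegral.integral_const, sub_zero, smul_eq_mul, ← Finset.mul_sum, ← mul_sub]
  refine mul_le_mul_of_nonneg_left ?_ (by positivity)
  have : ∑ i, ∑ k, ‖(b k : ℂ) * (starRingEnd ℂ) (v i k)‖ ^ 2 = ∑ k, (∑ i, ‖v i k‖ ^ 2) * b k ^ 2 :=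
      by
    rw [Finset.sum_comm]
    refine Finset.sum_congr rfl fun k _ => ?_
    rw [Finset.sum_mul]
    refine Finset.sum_congr rfl fun i _ => ?_
    rw [norm_mul, RCLike.norm_conj, Complex.norm_real, Real.norm_eq_abs, mul_pow, sq_abs, mul_comm]
  rw [this]
  linarith

end

/-! ### Whitening, completing the square, and unfolding of the frequency axis -/

section

/-- The density of the part of the signal power that is recoverable from the noisy signal. -/
def wienerDensity (SX Sη : ℝ → ℝ) (f : ℝ) : ℝ := SX f ^ 2 / (SX f + Sη f)

/-- The target frequency response after whitening of the noisy signal. -/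
def whitened (SX Sη : ℝ → ℝ) (f : ℝ) : ℝ := SX f / Real.sqrt (SX f + Sη f)

section

variable {SX Sη : ℝ → ℝ}

lemma wienerDensity_nonneg (hX : IsPSD SX) (hη : IsPSD Sη) (f : ℝ) : 0 ≤ wienerDensity SX Sη f :=
  div_nonneg (sq_nonneg _) (add_nonneg (hX.nonneg f) (hη.nonneg f))

lemma wienerDensity_le (hX : IsPSD SX) (hη : IsPSD Sη) (f : ℝ) : wienerDensity SX Sη f ≤ SX f := by
  have h1 := hX.nonneg f
  have h2 := hη.nonneg f
  refine div_le_of_le_mul₀ (by linarith) h1 ?_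
  nlinarith [mul_nonneg h1 h2]

lemma measurable_wienerDensity (hX : IsPSD SX) (hη : IsPSD Sη) :
    Measurable (wienerDensity SX Sη) :=
  (hX.measurable.pow_const 2).div (hX.measurable.add hη.measurable)

lemma measurable_whitened (hX : IsPSD SX) (hη : IsPSD Sη) : Measurable (whitened SX Sη) :=
  hX.measurable.div (hX.measurable.add hη.measurable).sqrt

lemma integrable_wienerDensity (hX : IsPSD SX) (hη : IsPSD Sη) (hi : Integrable SX) :
    Integrable (wienerDensity SX Sη) :=
  hi.mono' (measurable_wienerDensity hX hη).aestronglyMeasurable (ae_of_all _ fun f => by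
    rw [Real.norm_of_nonneg (wienerDensity_nonneg hX hη f)]; exact wienerDensity_le hX hη f)

lemma wienerDensity_even (hX : IsPSD SX) (hη : IsPSD Sη) (f : ℝ) :
    wienerDensity SX Sη (-f) = wienerDensity SX Sη f := by
  simp only [wienerDensity, hX.even, hη.even]

lemma whitened_sq (hX : IsPSD SX) (hη : IsPSD Sη) (f : ℝ) :
    whitened SX Sη f ^ 2 = wienerDensity SX Sη f := by
  rw [whitened, div_pow, Real.sq_sqrt (add_nonneg (hX.nonneg f) (hη.nonneg f)), wienerDensity]

/-- Completing the square in the mean squared error. -/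
lemma norm_sq_mul_add_norm_sq_mul (hX : IsPSD SX) (hη : IsPSD Sη) (f : ℝ) {w : ℂ} (hw : ‖w‖ = 1)
    (G : ℂ) : ‖w - G‖ ^ 2 * SX f + ‖G‖ ^ 2 * Sη f = (SX f - wienerDensity SX Sη f)
      + ‖(whitened SX Sη f : ℂ) * w - (Real.sqrt (SX f + Sη f) : ℂ) * G‖ ^ 2 := by
  have h1 := hX.nonneg f
  have h2 := hη.nonneg f
  -- Where `S_X + S_η` vanishes, so do both densities, and the convention `0 / 0 = 0` makes both
  -- sides zero.
  rcases (add_nonneg h1 h2).eq_or_lt with h | h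
  · have h3 : SX f = 0 := by linarith
    have h4 : Sη f = 0 := by linarith
    simp [whitened, wienerDensity, h3, h4]
  · set r := Real.sqrt (SX f + Sη f) with hr
    have hr0 : 0 < r := Real.sqrt_pos.2 h
    have hr2 : r ^ 2 = SX f + Sη f := Real.sq_sqrt h.le
    have hb : whitened SX Sη f * r = SX f := div_mul_cancel₀ _ hr0.ne'
    have hρ := whitened_sq hX hη f
    set b := whitened SX Sη f
    have hns (z : ℂ) : ‖z‖ ^ 2 = z.re ^ 2 + z.im ^ 2 := by
      rw [← Complex.normSq_eq_norm_sq, Complex.normSq_apply]; ring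
    have hw2 : w.re ^ 2 + w.im ^ 2 = 1 := by rw [← hns, hw, one_pow]
    rw [← hρ]
    simp only [hns, Complex.sub_re, Complex.sub_im, Complex.mul_re, Complex.mul_im,
      Complex.ofReal_re, Complex.ofReal_im, zero_mul, sub_zero, add_zero]
    have hSη : Sη f = r ^ 2 - b * r := by rw [hb, hr2]; ring
    rw [hSη, ← hb]
    linear_combination (b * r - b ^ 2) * hw2

lemma integrable_residual (hX : IsPSD SX) (hη : IsPSD Sη) (hi : Integrable SX) (t : ℝ) {G : ℝ → ℂ}
    (hG : Measurable G) (hG1 : Integrable fun f => ‖G f‖ ^ 2 * SX f)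
    (hG2 : Integrable fun f => ‖G f‖ ^ 2 * Sη f) :
    (Integrable fun f => ‖wave f t - G f‖ ^ 2 * SX f) ∧
    Integrable fun f => ‖(whitened SX Sη f : ℂ) * wave f t
      - (Real.sqrt (SX f + Sη f) : ℂ) * G f‖ ^ 2 := by
  have h1 : Integrable fun f => ‖wave f t - G f‖ ^ 2 * SX f := by
    refine (memLp_psdMeasure hX (by fun_prop)).1 (MemLp.sub ?_ ((memLp_psdMeasure hX hG).2 hG1))
    exact (memLp_psdMeasure hX (by fun_prop)).2 (integrable_norm_wave_sq_mul hi t)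
  refine ⟨h1, ?_⟩
  refine ((h1.add hG2).sub (hi.sub (integrable_wienerDensity hX hη hi))).congr
    (ae_of_all _ fun f => ?_)
  have := norm_sq_mul_add_norm_sq_mul hX hη f (norm_wave f t) (G f)
  simp only [Pi.add_apply, Pi.sub_apply]
  linarith

/-- The first term is the price of the noise alone, whatever `G` is; all effects of sampling are in
the second, an approximation problem in unweighted `L²`. -/
lemma spectralError_eq (hX : IsPSD SX) (hη : IsPSD Sη) (hi : Integrable SX) (t : ℝ) {G : ℝ → ℂ}
    (hG : Measurable G) (hG1 : Integrable fun f => ‖G f‖ ^ 2 * SX f)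
    (hG2 : Integrable fun f => ‖G f‖ ^ 2 * Sη f) :
    spectralError SX Sη t G = ((∫ f, SX f) - ∫ f, wienerDensity SX Sη f)
      + ∫ f, ‖(whitened SX Sη f : ℂ) * wave f t - (Real.sqrt (SX f + Sη f) : ℂ) * G f‖ ^ 2 := by
  obtain ⟨h1, h2⟩ := integrable_residual hX hη hi t hG hG1 hG2
  have hρ := integrable_wienerDensity hX hη hi
  rw [spectralError, ← integral_add h1 hG2, ← integral_sub hi hρ, ← integral_add (f := fun f => SX
      f - wienerDensity SX Sη f) (hi.sub hρ) h2]
  exact integral_congr_ae (ae_of_all _ fun f =>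
    norm_sq_mul_add_norm_sq_mul hX hη f (norm_wave f t) (G f))

lemma measurable_combResponse {P : ℕ} {H : Fin P → ℝ → ℂ} (hH : ∀ p, Measurable (H p)) (fs : ℝ)
    (c : Fin P × ℤ →₀ ℝ) : Measurable (combResponse fs H c) := by
  unfold combResponse Finsupp.sum
  have := hH
  fun_prop

lemma integrable_combResponse {S : ℝ → ℝ} (hS : IsPSD S) {P : ℕ} {H : Fin P → ℝ → ℂ}
    (hH : ∀ p, Measurable (H p)) (hHi : ∀ p, Integrable fun f => ‖H p f‖ ^ 2 * S f) (fs : ℝ)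
    (c : Fin P × ℤ →₀ ℝ) : Integrable fun f => ‖combResponse fs H c f‖ ^ 2 * S f := by
  refine (memLp_psdMeasure hS (measurable_combResponse hH fs c)).1 ?_
  unfold combResponse Finsupp.sum
  refine memLp_finsetSum _ fun i _ => MemLp.const_mul ?_ _
  have := hH i.1
  refine (memLp_psdMeasure hS (by fun_prop)).2 ?_
  simpa using hHi i.1

lemma IsFilter.integrable_left (hX : IsPSD SX) (hη : IsPSD Sη) {H : ℝ → ℂ}
    (hH : IsFilter (fun f => SX f + Sη f) H) : Integrable fun f => ‖H f‖ ^ 2 * SX f := by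
  have h := hH.measurable
  have h' := hX.measurable
  refine hH.finitePower.mono' (by fun_prop) (ae_of_all _ fun f => ?_)
  have h1 := hX.nonneg f
  have h2 := hη.nonneg f
  rw [Real.norm_of_nonneg (mul_nonneg (sq_nonneg _) h1)]
  gcongr
  linarith

lemma IsFilter.integrable_right (hX : IsPSD SX) (hη : IsPSD Sη) {H : ℝ → ℂ}
    (hH : IsFilter (fun f => SX f + Sη f) H) : Integrable fun f => ‖H f‖ ^ 2 * Sη f :=
  IsFilter.integrable_left hη hX (by simpa only [add_comm] using hH)

end

/-- The union of the sets `E i`, shifted by the multiples `κ i` of `Δ`. -/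
def shiftedUnion {ι : Type*} (Δ : ℝ) (κ : ι → ℤ) (E : ι → Set ℝ) : Set ℝ :=
  ⋃ i, (fun f => f - κ i * Δ) ⁻¹' E i

section

variable {ι : Type*} [Fintype ι] {Δ : ℝ} {κ : ι → ℤ} {E : ι → Set ℝ}

lemma measurableSet_shiftedUnion (hE : ∀ i, MeasurableSet (E i)) :
    MeasurableSet (shiftedUnion Δ κ E) :=
  MeasurableSet.iUnion fun i => measurable_id.sub_const _ (hE i)

lemma volume_shiftedUnion_le : volume (shiftedUnion Δ κ E) ≤ ∑ i, volume (E i) := by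
  refine (measure_iUnion_fintype_le _ _).trans (Finset.sum_le_sum fun i _ => le_of_eq ?_)
  simpa only [sub_eq_add_neg] using measure_preimage_add_right volume (-(κ i * Δ)) (E i)

lemma eq_of_sub_mul_mem_Ico (hΔ : 0 < Δ) {f : ℝ} {m n : ℤ} (hm : f - m * Δ ∈ Set.Ico 0 Δ)
    (hn : f - n * Δ ∈ Set.Ico 0 Δ) : m = n := by
  have h1 : ((m - n : ℤ) : ℝ) * Δ < 1 * Δ := by push_cast; linarith [hm.1, hn.2]
  have h2 : ((n - m : ℤ) : ℝ) * Δ < 1 * Δ := by push_cast; linarith [hn.1, hm.2]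
  have h3 : m - n < 1 := by exact_mod_cast lt_of_mul_lt_mul_right h1 hΔ.le
  have h4 : n - m < 1 := by exact_mod_cast lt_of_mul_lt_mul_right h2 hΔ.le
  omega

/-- Translates of subsets of `[0, Δ)` by distinct multiples of `Δ` are disjoint. This passes between
integrals over the line and integrals over fibres. -/
lemma setIntegral_shiftedUnion (hΔ : 0 < Δ) (hκ : Function.Injective κ)
    (hE : ∀ i, MeasurableSet (E i)) (hEs : ∀ i, E i ⊆ Set.Ico 0 Δ) {φ : ℝ → ℝ}
    (hφ : Integrable φ) :
    ∫ f in shiftedUnion Δ κ E, φ f = ∑ i, ∫ f in E i, φ (f + κ i * Δ) := by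
  rw [shiftedUnion, integral_iUnion_fintype
    (s := fun i => (fun f : ℝ => f - κ i * Δ) ⁻¹' E i) (fun i => measurable_id.sub_const _ (hE i))]
  · refine Finset.sum_congr rfl fun i _ => ?_
    have hmp : MeasurePreserving (fun f : ℝ => f - κ i * Δ) := measurePreserving_sub_right _ _
    have h := hmp.setIntegral_preimage_emb (MeasurableEquiv.subRight (κ i * Δ)).measurableEmbedding
      (fun f => φ (f + κ i * Δ)) (E i)
    simpa using h
  · intro i j hij
    refine Set.disjoint_left.2 fun f h1 h2 => hij (hκ ?_)
    exact eq_of_sub_mul_mem_Ico hΔ (hEs i h1) (hEs j h2)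
  · exact fun i => hφ.integrableOn

end

end

/-! ### The lower bound in each fibre and the choice of the best aliases -/

section

variable {SX Sη : ℝ → ℝ}

/-- The squared distance in the fibre over `f` between the target at time `t` and the linear
combination of the filters with coefficients `C`. -/
def fibreError (SX Sη : ℝ → ℝ) (Δ : ℝ) (K : Finset ℤ) {P : ℕ} (H : Fin P → ℝ → ℂ)
    (C : Fin P → ℂ) (t f : ℝ) : ℝ :=
  ∑ k : K, ‖(whitened SX Sη (f + k * Δ) : ℂ) * wave (f + k * Δ) t
    - (Real.sqrt (SX (f + k * Δ) + Sη (f + k * Δ)) : ℂ) * ∑ p, C p * H p (f + k * Δ)‖ ^ 2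

/-- The infimum of `fibreError` over the coefficients, written as a countable infimum. -/
def fibreDist (SX Sη : ℝ → ℝ) (Δ : ℝ) (K : Finset ℤ) {P : ℕ} (H : Fin P → ℝ → ℂ)
    (t f : ℝ) : ENNReal :=
  ⨅ n : ℕ, ENNReal.ofReal (fibreError SX Sη Δ K H (TopologicalSpace.denseSeq (Fin P → ℂ) n) t f)

lemma measurable_fibreDist (hX : IsPSD SX) (hη : IsPSD Sη) (Δ : ℝ) (K : Finset ℤ) {P : ℕ}
    {H : Fin P → ℝ → ℂ} (hH : ∀ p, Measurable (H p)) :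
    Measurable fun q : ℝ × ℝ => fibreDist SX Sη Δ K H q.1 q.2 := by
  refine Measurable.iInf fun n => Measurable.ennreal_ofReal ?_
  unfold fibreError
  refine Finset.measurable_sum _ fun k _ => ?_
  have h1 : Measurable fun q : ℝ × ℝ => whitened SX Sη (q.2 + k * Δ) :=
    (measurable_whitened hX hη).comp (by fun_prop)
  have h2 : Measurable fun q : ℝ × ℝ => wave (q.2 + k * Δ) q.1 :=
    continuous_wave.measurable.comp (by fun_prop : Measurable fun q : ℝ × ℝ => (q.2 + k * Δ, q.1))
  have h3 : Measurable fun q : ℝ × ℝ => Real.sqrt (SX (q.2 + k * Δ) + Sη (q.2 + k * Δ)) :=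
    ((hX.measurable.add hη.measurable).comp (by fun_prop : Measurable fun q : ℝ × ℝ => q.2 + k *
        Δ)).sqrt
  have h4 (p) : Measurable fun q : ℝ × ℝ => H p (q.2 + k * Δ) := (hH p).comp (by fun_prop)
  fun_prop

/-- A dense sequence of coefficient vectors suffices because the error is continuous in them;
countability is what makes the distance jointly measurable in `t` and `f`, as Tonelli requires. -/
lemma fibreDist_le (Δ : ℝ) (K : Finset ℤ) {P : ℕ} (H : Fin P → ℝ → ℂ) (C : Fin P → ℂ) (t f : ℝ) :
    fibreDist SX Sη Δ K H t f ≤ ENNReal.ofReal (fibreError SX Sη Δ K H C t f) := by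
  have hc : Continuous fun C : Fin P → ℂ => ENNReal.ofReal (fibreError SX Sη Δ K H C t f) := by
    refine ENNReal.continuous_ofReal.comp ?_
    unfold fibreError
    fun_prop
  refine (TopologicalSpace.denseRange_denseSeq (Fin P → ℂ)).induction_on C
    (isClosed_le continuous_const hc) fun n => iInf_le _ n

/-- The coefficients of a linear combination of samples, as functions of the frequency. -/
lemma exists_periodic_coeff {Δ : ℝ} (hΔ : 0 < Δ) {fs : ℝ} {P : ℕ} (hfs : P / fs = 1 / Δ)
    (H : Fin P → ℝ → ℂ) (c : Fin P × ℤ →₀ ℝ) :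
    ∃ C : ℝ → Fin P → ℂ, ∀ (f : ℝ) (k : ℤ),
      combResponse fs H c (f + k * Δ) = ∑ p, C f p * H p (f + k * Δ) := by
  classical
  refine ⟨fun f p => c.sum fun i a =>
    if i.1 = p then (a : ℂ) * wave f ((i.2 : ℝ) * (P : ℝ) / fs) else 0, fun f k => ?_⟩
  simp only [Finsupp.sum, Finset.sum_mul, combResponse]
  rw [Finset.sum_comm]
  refine Finset.sum_congr rfl fun i _ => ?_
  -- Aliasing: sampling instants are multiples of `1 / Δ`, where frequencies differing by `kΔ` give
  -- the same wave.
  have hw : wave (k * Δ) ((i.2 : ℝ) * (P : ℝ) / fs) = 1 := by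
    have e : (i.2 : ℝ) * (P : ℝ) / fs = i.2 * (1 / Δ) := by rw [← hfs]; ring
    rw [e, wave, show 2 * (Real.pi : ℂ) * Complex.I * ((k * Δ : ℝ) : ℂ) * ((i.2 * (1 / Δ) : ℝ) : ℂ)
      = ((k * i.2 : ℤ) : ℂ) * (2 * Real.pi * Complex.I) by
        have : (Δ : ℂ) ≠ 0 := Complex.ofReal_ne_zero.2 hΔ.ne'
        push_cast; field_simp]
    exact Complex.exp_int_mul_two_pi_mul_I _
  rw [Finset.sum_eq_single i.1]
  · rw [if_pos rfl, wave_add_left, hw]; ring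
  · intro p _ hp; rw [if_neg hp.symm, zero_mul]
  · simp

/-- The coefficients of the response depend on `f` but not on the alias `k`, so in each fibre the
residual is at least the distance to the span of the filters. Aliases outside the finite window `K`
are discarded, which only lowers the integral. -/
lemma lintegral_fibreDist_le (hX : IsPSD SX) (hη : IsPSD Sη) (hi : Integrable SX) {Δ : ℝ}
    (hΔ : 0 < Δ) {fs : ℝ} {P : ℕ} (hfs : P / fs = 1 / Δ) {H : Fin P → ℝ → ℂ}
    (hH : ∀ p, IsFilter (fun f => SX f + Sη f) (H p)) (K : Finset ℤ) (c : Fin P × ℤ →₀ ℝ) (t : ℝ) :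
    ENNReal.ofReal ((∫ f, SX f) - ∫ f, wienerDensity SX Sη f)
      + ∫⁻ f in Set.Ico 0 Δ, fibreDist SX Sη Δ K H t f
      ≤ ENNReal.ofReal (spectralError SX Sη t (combResponse fs H c)) := by
  have hHm := fun p => (hH p).measurable
  have hG := measurable_combResponse hHm fs c
  have hG1 := integrable_combResponse hX hHm (fun p => (hH p).integrable_left hX hη) fs c
  have hG2 := integrable_combResponse hη hHm (fun p => (hH p).integrable_right hX hη) fs c
  have hC0 : 0 ≤ (∫ f, SX f) - ∫ f, wienerDensity SX Sη f := sub_nonneg.2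
    (integral_mono (integrable_wienerDensity hX hη hi) hi (wienerDensity_le hX hη))
  have hφ := (integrable_residual hX hη hi t hG hG1 hG2).2
  set φ := fun f => ‖(whitened SX Sη f : ℂ) * wave f t
    - (Real.sqrt (SX f + Sη f) : ℂ) * combResponse fs H c f‖ ^ 2 with hφdef
  have hφ0 : ∀ f, 0 ≤ φ f := fun f => sq_nonneg _
  rw [spectralError_eq hX hη hi t hG hG1 hG2,
    ENNReal.ofReal_add hC0 (integral_nonneg hφ0)]
  gcongr
  obtain ⟨C, hC⟩ := exists_periodic_coeff hΔ hfs H c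
  have hshift (k : K) : Integrable fun f => φ (f + k * Δ) := hφ.comp_add_right _
  calc ∫⁻ f in Set.Ico 0 Δ, fibreDist SX Sη Δ K H t f
      ≤ ∫⁻ f in Set.Ico 0 Δ, ENNReal.ofReal (∑ k : K, φ (f + k * Δ)) := by
        refine lintegral_mono fun f => (fibreDist_le Δ K H (C f) t f).trans (le_of_eq ?_)
        simp only [fibreError, hφdef, hC]
    _ = ENNReal.ofReal (∫ f in Set.Ico 0 Δ, ∑ k : K, φ (f + k * Δ)) := by
        rw [ofReal_integral_eq_lintegral_ofReal]
        · exact (integrable_finsetSum _ fun k _ => hshift k).integrableOn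
        · exact ae_of_all _ fun f => Finset.sum_nonneg fun k _ => hφ0 _
    _ = ENNReal.ofReal (∫ f in shiftedUnion Δ (fun k : K => (k : ℤ)) fun _ => Set.Ico 0 Δ, φ f) :=
        by
        rw [setIntegral_shiftedUnion hΔ Subtype.val_injective (fun _ => measurableSet_Ico)
          (fun _ => subset_rfl) hφ, integral_finsetSum _ fun k _ => (hshift k).integrableOn]
    _ ≤ ENNReal.ofReal (∫ f, φ f) :=
        ENNReal.ofReal_le_ofReal (setIntegral_le_integral hφ (ae_of_all _ hφ0))

/-- The sum of the values of the recoverable power density at the aliases of `f` in `A`. -/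
def aliasSum (SX Sη : ℝ → ℝ) (Δ : ℝ) {K : Finset ℤ} (A : Finset K) (f : ℝ) : ℝ :=
  ∑ k ∈ A, wienerDensity SX Sη (f + (k : ℤ) * Δ)

/-- Over a fixed `f` the `P` whitened filters span a space independent of `t`, so the
finite-dimensional bound applies to the rotating target. -/
lemma le_lintegral_fibreDist (hX : IsPSD SX) (hη : IsPSD Sη) {Δ : ℝ} (hΔ : 0 < Δ) (K : Finset ℤ)
    {P : ℕ} (H : Fin P → ℝ → ℂ) (f : ℝ) : ∃ A : Finset K, A.card ≤ P ∧
      ENNReal.ofReal (1 / Δ * (aliasSum SX Sη Δ (Finset.univ : Finset K) f - aliasSum SX Sη Δ A f))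
        ≤ ∫⁻ t in Set.Ioc 0 (1 / Δ), fibreDist SX Sη Δ K H t f := by
  set u : Fin P → EuclideanSpace ℂ K := fun p => WithLp.toLp 2 fun k =>
    (Real.sqrt (SX (f + k * Δ) + Sη (f + k * Δ)) : ℂ) * H p (f + k * Δ) with hu
  set x : ℝ → EuclideanSpace ℂ K := fun t => WithLp.toLp 2 fun k =>
    (whitened SX Sη (f + k * Δ) : ℂ) * wave (f + k * Δ) t with hx
  set J := Submodule.span ℂ (Set.range u)
  have hJ : Module.finrank ℂ J ≤ P := by
    have := finrank_range_le_card (R := ℂ) u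
    simpa [Set.finrank] using this
  obtain ⟨A, hA, h⟩ := exists_finset_le_integral_norm_sub_starProjection hΔ K
    (fun k => whitened SX Sη (f + k * Δ)) f J hJ x (fun t k => rfl)
  refine ⟨A, hA, ?_⟩
  simp only [whitened_sq hX hη] at h
  refine (ENNReal.ofReal_le_ofReal h).trans ?_
  have hxc : Continuous x := by
    have hc (y : ℝ) : Continuous fun t => wave y t := by unfold wave; fun_prop
    refine (PiLp.continuous_toLp 2 _).comp (continuous_pi fun k => ?_)
    exact continuous_const.mul (hc _)
  have hcont : Continuous fun t => ‖x t - J.starProjection (x t)‖ ^ 2 := by fun_prop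
  rw [intervalIntegral.integral_of_le (by positivity), ofReal_integral_eq_lintegral_ofReal
    ((hcont.intervalIntegrable 0 (1 / Δ)).1) (ae_of_all _ fun t => sq_nonneg _)]
  refine lintegral_mono fun t => le_iInf fun n => ENNReal.ofReal_le_ofReal ?_
  set d := TopologicalSpace.denseSeq (Fin P → ℂ) n
  have hv : ∑ p, d p • u p ∈ J :=
    J.sum_mem fun p _ => J.smul_mem _ (Submodule.subset_span ⟨p, rfl⟩)
  have e : fibreError SX Sη Δ K H d t f = ‖x t - ∑ p, d p • u p‖ ^ 2 := by
    rw [EuclideanSpace.norm_sq_eq, fibreError]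
    refine Finset.sum_congr rfl fun k _ => ?_
    congr 2
    simp only [hx, hu, PiLp.sub_apply, WithLp.ofLp_sum, Finset.sum_apply, PiLp.smul_apply,
        smul_eq_mul]
    rw [Finset.mul_sum]
    congr 1
    exact Finset.sum_congr rfl fun p _ => by ring
  rw [e, Submodule.starProjection_minimal]
  refine pow_le_pow_left₀ (Real.iInf_nonneg fun _ => norm_nonneg _) ?_ 2
  exact ciInf_le_of_le ⟨0, by rintro _ ⟨v, rfl⟩; exact norm_nonneg _⟩ ⟨_, hv⟩ le_rfl

lemma bddAbove_landau (hX : IsPSD SX) (hη : IsPSD Sη) (hi : Integrable SX) (fs : ℝ) :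
    BddAbove {r : ℝ | ∃ F : Set ℝ, MeasurableSet F ∧ volume F ≤ ENNReal.ofReal fs ∧
      r = ∫ f in F, SX f ^ 2 / (SX f + Sη f)} := by
  refine ⟨∫ f, wienerDensity SX Sη f, ?_⟩
  rintro _ ⟨F, -, -, rfl⟩
  exact setIntegral_le_integral (integrable_wienerDensity hX hη hi)
    (ae_of_all _ (wienerDensity_nonneg hX hη))

lemma setIntegral_le_landau (hX : IsPSD SX) (hη : IsPSD Sη) (hi : Integrable SX) {fs : ℝ}
    {F : Set ℝ} (hF : MeasurableSet F) (hFv : volume F ≤ ENNReal.ofReal fs) :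
    ∫ f in F, wienerDensity SX Sη f ≤ (∫ f, SX f) - landauBound SX Sη fs := by
  rw [landauBound, sub_sub_cancel]
  exact le_csSup (bddAbove_landau hX hη hi fs) ⟨F, hF, hFv, rfl⟩

lemma measurable_aliasSum (hX : IsPSD SX) (hη : IsPSD Sη) (Δ : ℝ) {K : Finset ℤ} (A : Finset K) :
    Measurable (aliasSum SX Sη Δ A) :=
  Finset.measurable_sum _ fun _ _ => (measurable_wienerDensity hX hη).comp (measurable_add_const _)

lemma integrable_aliasSum (hX : IsPSD SX) (hη : IsPSD Sη) (hi : Integrable SX) (Δ : ℝ)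
    {K : Finset ℤ} (A : Finset K) : Integrable (aliasSum SX Sη Δ A) :=
  integrable_finsetSum _ fun _ _ => (integrable_wienerDensity hX hη hi).comp_add_right _

/-- Choosing measurably the `P` best aliases of each frequency gives a set of measure `P Δ`. -/
lemma exists_best_aliases (hX : IsPSD SX) (hη : IsPSD Sη) (hi : Integrable SX) {Δ : ℝ} (hΔ : 0 < Δ)
    (K : Finset ℤ) (P : ℕ) : ∃ g : ℝ → ℝ, IntegrableOn g (Set.Ico 0 Δ) ∧
      (∀ f, ∀ A : Finset K, A.card ≤ P → aliasSum SX Sη Δ A f ≤ g f) ∧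
      (∀ f, g f ≤ aliasSum SX Sη Δ (Finset.univ : Finset K) f) ∧
      ∫ f in Set.Ico 0 Δ, g f ≤ (∫ f, SX f) - landauBound SX Sη (P * Δ) := by
  classical
  set s := (Finset.univ : Finset (Finset K)).filter fun A => A.card ≤ P with hs
  obtain ⟨A, hA, hAs, hmax⟩ := exists_measurable_argmax s ⟨∅, by simp [hs]⟩
    (fun A => aliasSum SX Sη Δ A) (fun A => measurable_aliasSum hX hη Δ A)
  have hρ := integrable_wienerDensity hX hη hi
  have hρ0 := wienerDensity_nonneg hX hη
  -- The chosen aliases form the union of the sets `E k + kΔ`. Its measure is at most the integral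
  -- over `[0, Δ)` of the number of chosen aliases, hence at most `PΔ`.
  set E : K → Set ℝ := fun k => Set.Ico 0 Δ ∩ {f | k ∈ A f} with hE
  have hmem (k : K) : MeasurableSet {f | k ∈ A f} := by
    have : {f | k ∈ A f} = ⋃ B : Finset K, {f | A f = B} ∩ {_f | k ∈ B} := by
      ext f; simp
    rw [this]
    exact MeasurableSet.iUnion fun B => (hA B).inter (MeasurableSet.const _)
  have hEm (k) : MeasurableSet (E k) := measurableSet_Ico.inter (hmem k)
  have hgk (f : ℝ) : aliasSum SX Sη Δ (A f) f
      = ∑ k : K, Set.indicator {f | k ∈ A f} (fun f => wienerDensity SX Sη (f + (k : ℤ) * Δ)) f :=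
          by
    simp only [aliasSum, Set.indicator_apply, Set.mem_ofPred_eq]
    rw [Finset.sum_ite_mem, Finset.univ_inter]
  have hint (k : K) : Integrable
      (Set.indicator {f | k ∈ A f} fun f => wienerDensity SX Sη (f + (k : ℤ) * Δ)) :=
    (hρ.comp_add_right _).indicator (hmem k)
  refine ⟨fun f => aliasSum SX Sη Δ (A f) f, ?_, fun f B hB => hmax f B (by simp [hs, hB]), ?_, ?_⟩
  · simp_rw [hgk]
    exact (integrable_finsetSum _ fun k _ => hint k).integrableOn
  · exact fun f => Finset.sum_le_sum_of_subset_of_nonneg (Finset.subset_univ _) fun _ _ _ => hρ0 _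
  · have h1 : ∫ f in Set.Ico 0 Δ, aliasSum SX Sη Δ (A f) f
        = ∫ f in shiftedUnion Δ (fun k : K => (k : ℤ)) E, wienerDensity SX Sη f := by
      rw [setIntegral_shiftedUnion hΔ Subtype.val_injective hEm (fun _ => Set.inter_subset_left) hρ]
      simp_rw [hgk]
      rw [integral_finsetSum _ fun k _ => (hint k).integrableOn]
      refine Finset.sum_congr rfl fun k _ => ?_
      rw [setIntegral_indicator (hmem k)]
    rw [h1]
    refine setIntegral_le_landau hX hη hi (measurableSet_shiftedUnion hEm) ?_
    refine volume_shiftedUnion_le.trans ?_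
    have h2 (k : K) : volume (E k) = ∫⁻ f in Set.Ico 0 Δ, Set.indicator {f | k ∈ A f} 1 f := by
      rw [lintegral_indicator_one (hmem k), Measure.restrict_apply (hmem k), Set.inter_comm]
    simp_rw [h2]
    rw [← lintegral_finsetSum _ fun k _ => measurable_one.indicator (hmem k)]
    calc ∫⁻ f in Set.Ico 0 Δ, ∑ k : K, Set.indicator {f | k ∈ A f} 1 f
        ≤ ∫⁻ _f in Set.Ico 0 Δ, (P : ENNReal) := by
          refine lintegral_mono fun f => ?_
          have : ∑ k : K, Set.indicator {f | k ∈ A f} (1 : ℝ → ENNReal) f = (A f).card := by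
            simp only [Set.indicator_apply, Set.mem_ofPred_eq, Pi.one_apply]
            rw [Finset.sum_ite_mem, Finset.univ_inter]
            simp
          rw [this]
          exact Nat.cast_le.2 (Finset.mem_filter.1 (hAs f)).2
      _ = ENNReal.ofReal (P * Δ) := by
          rw [setLIntegral_const, Real.volume_Ico, sub_zero, ENNReal.ofReal_mul (Nat.cast_nonneg _),
            ENNReal.ofReal_natCast]

end

/-! ### The lower bound for every filter bank -/

section

variable {Ω : Type*} [MeasurableSpace Ω] {μ : Measure Ω} [IsProbabilityMeasure μ] {SX Sη : ℝ → ℝ}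
  {X : ℝ → Ω → ℝ} {η : {g : ℝ → ℂ // IsFilter Sη g} → Ω → ℝ}

/-- The error is averaged over a period, time and frequency are interchanged by Tonelli, and the
fibre bound is integrated over `[0, Δ)`. Only the aliases in `K` are accounted for; as the window
exhausts the line the two integrals of `wienerDensity` cancel. -/
lemma setIntegral_shiftedUnion_le_meanMse (hm : IsNoisySource μ SX Sη X η) {P : ℕ} (hP : 0 < P)
    {H : Fin P → ℝ → ℂ} (hH : ∀ p, IsFilter (fun f => SX f + Sη f) (H p))
    {Z : Fin P → ℝ → Ω → ℝ} (hZ : IsFilterBankOutput μ SX Sη X η H Z) {fs : ℝ} (hfs : 0 < fs)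
    (K : Finset ℤ) :
    landauBound SX Sη fs - (∫ f, wienerDensity SX Sη f)
      + ∫ f in shiftedUnion (fs / P) (fun k : K => (k : ℤ)) fun _ => Set.Ico 0 (fs / P),
        wienerDensity SX Sη f ≤ meanMse μ X fs Z := by
  have hX := hm.psd_signal
  have hi := hm.integrable_psd
  have hη := hm.psd_noise
  have hP' : (0 : ℝ) < P := Nat.cast_pos.2 hP
  set Δ := fs / P with hΔdef
  have hΔ : 0 < Δ := div_pos hfs hP'
  have hτ : (P : ℝ) / fs = 1 / Δ := by rw [hΔdef, one_div_div]
  have hPΔ : (P : ℝ) * Δ = fs := by rw [hΔdef]; field_simp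
  have hτ0 : 0 < 1 / Δ := by positivity
  obtain ⟨g, hg, hgA, hgu, hgi⟩ := exists_best_aliases hX hη hi hΔ K P
  rw [hPΔ] at hgi
  have hρ := integrable_wienerDensity hX hη hi
  have hcont := continuous_mseAt hm hH hZ fs
  have hC0 : 0 ≤ (∫ f, SX f) - ∫ f, wienerDensity SX Sη f := sub_nonneg.2
    (integral_mono hρ hi (wienerDensity_le hX hη))
  set C0 := (∫ f, SX f) - ∫ f, wienerDensity SX Sη f with hC0def
  have hU : ∫ f in shiftedUnion Δ (fun k : K => (k : ℤ)) fun _ => Set.Ico 0 Δ,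
      wienerDensity SX Sη f = ∫ f in Set.Ico 0 Δ, aliasSum SX Sη Δ (Finset.univ : Finset K) f := by
    rw [setIntegral_shiftedUnion hΔ Subtype.val_injective (fun _ => measurableSet_Ico)
      (fun _ => subset_rfl) hρ]
    unfold aliasSum
    rw [integral_finsetSum _ fun k _ => (hρ.comp_add_right _).integrableOn]
  have hai := (integrable_aliasSum hX hη hi Δ (Finset.univ : Finset K)).integrableOn (s := Set.Ico
      0 Δ)
  have hpt (t : ℝ) : ENNReal.ofReal C0 + ∫⁻ f in Set.Ico 0 Δ, fibreDist SX Sη Δ K H t f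
      ≤ ENNReal.ofReal (mseAt μ X (samples fs Z) t) := by
    refine ENNReal.le_of_forall_pos_le_add fun ε hε _ => ?_
    obtain ⟨c, hc⟩ := exists_spectralError_lt hm hH hZ fs t (NNReal.coe_pos.2 hε)
    refine (lintegral_fibreDist_le hX hη hi hΔ hτ hH K c t).trans ?_
    refine (ENNReal.ofReal_le_ofReal hc.le).trans ?_
    rw [ENNReal.ofReal_add (mseAt_nonneg _ _ _ _) ε.coe_nonneg, ENNReal.ofReal_coe_nnreal]
  have hfib : ENNReal.ofReal (∫ f in Set.Ico 0 Δ,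
      1 / Δ * (aliasSum SX Sη Δ (Finset.univ : Finset K) f - g f))
      ≤ ∫⁻ t in Set.Ioc 0 (1 / Δ), ∫⁻ f in Set.Ico 0 Δ, fibreDist SX Sη Δ K H t f := by
    rw [lintegral_lintegral_swap
      (measurable_fibreDist hX hη Δ K fun p => (hH p).measurable).aemeasurable,
      ofReal_integral_eq_lintegral_ofReal
        (f := fun f => 1 / Δ * (aliasSum SX Sη Δ Finset.univ f - g f)) ((hai.sub hg).const_mul _)
        (ae_of_all _ fun f => mul_nonneg hτ0.le (sub_nonneg.2 (hgu f)))]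
    refine lintegral_mono fun f => ?_
    obtain ⟨A, hA, h⟩ := le_lintegral_fibreDist hX hη hΔ K H f
    refine le_trans (ENNReal.ofReal_le_ofReal ?_) h
    have := hgA f A hA
    gcongr
  have key : ENNReal.ofReal (1 / Δ * C0 + ∫ f in Set.Ico 0 Δ,
      1 / Δ * (aliasSum SX Sη Δ (Finset.univ : Finset K) f - g f))
      ≤ ENNReal.ofReal (∫ t in (0 : ℝ)..(1 / Δ), mseAt μ X (samples fs Z) t) := by
    rw [intervalIntegral.integral_of_le hτ0.le, ofReal_integral_eq_lintegral_ofReal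
      (hcont.intervalIntegrable _ _).1 (ae_of_all _ fun t => mseAt_nonneg _ _ _ _)]
    refine le_trans ?_ (lintegral_mono hpt)
    rw [lintegral_add_left measurable_const, setLIntegral_const, Real.volume_Ioc, sub_zero,
      ENNReal.ofReal_add (by positivity) (integral_nonneg fun f =>
        mul_nonneg hτ0.le (sub_nonneg.2 (hgu f))), ENNReal.ofReal_mul hτ0.le, mul_comm]
    gcongr
  rw [ENNReal.ofReal_le_ofReal_iff (intervalIntegral.integral_nonneg hτ0.le
    fun t _ => mseAt_nonneg _ _ _ _), integral_const_mul, integral_sub hai hg, ← hU] at key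
  rw [meanMse, hτ, one_div_one_div]
  have h2 := mul_le_mul_of_nonneg_left key hΔ.le
  have h3 : Δ * (1 / Δ) = 1 := mul_one_div_cancel hΔ.ne'
  rw [mul_add, ← mul_assoc, ← mul_assoc, h3, one_mul, one_mul] at h2
  linarith

lemma iUnion_shiftedUnion_eq_univ {Δ : ℝ} (hΔ : 0 < Δ) :
    ⋃ M : ℕ, shiftedUnion Δ (fun k : Finset.Ico (-(M : ℤ)) M => (k : ℤ)) (fun _ => Set.Ico 0 Δ)
      = Set.univ := by
  refine Set.eq_univ_of_forall fun f => ?_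
  set k := ⌊f / Δ⌋ with hk
  rw [Set.mem_iUnion]
  refine ⟨k.natAbs + 1, Set.mem_iUnion.2 ⟨⟨k, ?_⟩, ?_⟩⟩
  · rw [Finset.mem_Ico]; omega
  · have h1 := Int.floor_le (f / Δ)
    have h2 := Int.lt_floor_add_one (f / Δ)
    rw [le_div_iff₀ hΔ] at h1
    rw [div_lt_iff₀ hΔ] at h2
    constructor <;> simp only [hk] <;> linarith

/-- No filter bank beats the bound. -/
lemma landauBound_le_meanMse (hm : IsNoisySource μ SX Sη X η) {P : ℕ} (hP : 0 < P)
    {H : Fin P → ℝ → ℂ} (hH : ∀ p, IsFilter (fun f => SX f + Sη f) (H p))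
    {Z : Fin P → ℝ → Ω → ℝ} (hZ : IsFilterBankOutput μ SX Sη X η H Z) {fs : ℝ} (hfs : 0 < fs) :
    landauBound SX Sη fs ≤ meanMse μ X fs Z := by
  have hΔ : 0 < fs / P := div_pos hfs (Nat.cast_pos.2 hP)
  have hρ := integrable_wienerDensity hm.psd_signal hm.psd_noise hm.integrable_psd
  have hlim := tendsto_setIntegral_of_monotone (μ := volume) (f := wienerDensity SX Sη)
    (s := fun M : ℕ => shiftedUnion (fs / P) (fun k : Finset.Ico (-(M : ℤ)) M => (k : ℤ))
      (fun _ => Set.Ico 0 (fs / P))) (fun M => measurableSet_shiftedUnion fun _ =>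
          measurableSet_Ico)
    (fun M N hMN => by
      refine Set.iUnion_subset fun k => ?_
      refine Set.subset_iUnion_of_subset ⟨k, ?_⟩ subset_rfl
      have := Finset.mem_Ico.1 k.2
      rw [Finset.mem_Ico]; omega) hρ.integrableOn
  rw [iUnion_shiftedUnion_eq_univ hΔ, setIntegral_univ] at hlim
  have h2 := hlim.const_add (landauBound SX Sη fs - ∫ f, wienerDensity SX Sη f)
  rw [sub_add_cancel] at h2
  exact le_of_tendsto' h2 fun M => setIntegral_shiftedUnion_le_meanMse hm hP hH hZ hfs _

end

/-! ### Achievability with alias-free bands -/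

section

section

variable {SX Sη : ℝ → ℝ}

/-- A bounded real filter that passes exactly the band `E`. -/
def bandFilter (S : ℝ → ℝ) (E : Set ℝ) (f : ℝ) : ℂ := ((E.indicator (fun f => 1 / (1 + S f)) f : ℝ)
    : ℂ)

/-- The gain `1 / (1 + S)` of the band filter is chosen for this: `S / (1 + S)² ≤ 1`, so the output
power is finite on a band of finite measure even where `S` is not locally integrable. -/
lemma integrable_indicator_div_sq {S : ℝ → ℝ} (hS : IsPSD S) {E : Set ℝ} (hE : MeasurableSet E)
    (hEv : volume E < ⊤) : Integrable (E.indicator fun f => S f / (1 + S f) ^ 2) := by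
  rw [integrable_indicator_iff hE]
  have hm := hS.measurable
  refine Measure.integrableOn_of_bounded (M := 1) hEv.ne
    (by fun_prop : Measurable fun f => S f / (1 + S f) ^ 2).aestronglyMeasurable
    (ae_of_all _ fun f => ?_)
  have h := hS.nonneg f
  rw [Real.norm_of_nonneg (by positivity)]
  refine div_le_one_of_le₀ ?_ (by positivity)
  nlinarith

lemma indicator_neg_eq {g : ℝ → ℝ} (hg : ∀ f, g (-f) = g f) {E : Set ℝ} (hE : ∀ f, -f ∈ E ↔ f ∈ E)
    (f : ℝ) : E.indicator g (-f) = E.indicator g f := by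
  by_cases h : f ∈ E
  · rw [Set.indicator_of_mem h, Set.indicator_of_mem ((hE f).2 h), hg]
  · rw [Set.indicator_of_notMem h, Set.indicator_of_notMem (mt (hE f).1 h)]

lemma isFilter_bandFilter {S : ℝ → ℝ} (hS : IsPSD S) {E : Set ℝ} (hE : MeasurableSet E)
    (hEv : volume E < ⊤) (hEs : ∀ f, -f ∈ E ↔ f ∈ E) : IsFilter S (bandFilter S E) where
  measurable := by
    have hm := hS.measurable
    exact Complex.measurable_ofReal.comp
      ((by fun_prop : Measurable fun f => 1 / (1 + S f)).indicator hE)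
  hermitian f := by
    rw [bandFilter, bandFilter, Complex.conj_ofReal,
      indicator_neg_eq (fun f => by rw [hS.even]) hEs]
  finitePower := by
    refine (integrable_indicator_div_sq hS hE hEv).congr (ae_of_all _ fun f => ?_)
    simp only [bandFilter, Complex.norm_real, Real.norm_eq_abs, sq_abs]
    by_cases h : f ∈ E
    · simp only [Set.indicator_of_mem h]
      rw [div_pow, one_pow, one_div_mul_eq_div]
    · simp [Set.indicator_of_notMem h]

/-- Factoring out the gain of the band filter turns the whitened problem into the approximation of
an explicit target by plain exponentials `z`, with the weight `S / (1 + S)²`, where `S = S_X + S_η`.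
-/
lemma norm_sq_whitened_sub (hX : IsPSD SX) (hη : IsPSD Sη) (f : ℝ) (w z : ℂ) :
    ‖(whitened SX Sη f : ℂ) * w - (Real.sqrt (SX f + Sη f) : ℂ) * (((1 / (1 + (SX f + Sη f)) : ℝ) :
        ℂ) * z)‖ ^ 2
      = ‖((SX f / (SX f + Sη f) * (1 + (SX f + Sη f)) : ℝ) : ℂ) * w - z‖ ^ 2
        * ((SX f + Sη f) / (1 + (SX f + Sη f)) ^ 2) := by
  have hs : 0 ≤ SX f + Sη f := add_nonneg (hX.nonneg f) (hη.nonneg f)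
  set s := SX f + Sη f with hsdef
  have h1 : (0 : ℝ) < 1 + s := by linarith
  have hb : whitened SX Sη f = Real.sqrt s * (1 / (1 + s)) * (SX f / s * (1 + s)) := by
    rw [whitened, ← hsdef]
    rcases hs.eq_or_lt with h | h
    · rw [← h]; simp
    · have h2 := Real.sqrt_pos.2 h
      have h3 := Real.mul_self_sqrt hs
      field_simp
      rw [sq, h3]
  have hz : (whitened SX Sη f : ℂ) * w - (Real.sqrt s : ℂ) * (((1 / (1 + s) : ℝ) : ℂ) * z)
      = ((Real.sqrt s * (1 / (1 + s)) : ℝ) : ℂ) * (((SX f / s * (1 + s) : ℝ) : ℂ) * w - z) := by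
    rw [hb]; push_cast; ring
  rw [hz, norm_mul, mul_pow, Complex.norm_real, Real.norm_eq_abs, sq_abs, mul_pow, Real.sq_sqrt hs,
    div_pow, one_pow]
  rw [mul_one_div, mul_comm]

/-- On an alias-free band, samples of one branch recover the whitened target. -/
lemma exists_setIntegral_band_lt (hX : IsPSD SX) (hη : IsPSD Sη) (hi : Integrable SX) {Δ : ℝ}
    (hΔ : 0 < Δ) {E : Set ℝ} (hE : MeasurableSet E) (hEv : volume E < ⊤)
    (hEs : ∀ f, -f ∈ E ↔ f ∈ E) (hinj : Set.InjOn ((↑) : ℝ → AddCircle Δ) E) (t : ℝ) {ε : ℝ}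
    (hε : 0 < ε) :
    ∃ c : ℤ →₀ ℝ, ∫ f in E, ‖(whitened SX Sη f : ℂ) * wave f t - (Real.sqrt (SX f + Sη f) : ℂ) *
      (((1 / (1 + (SX f + Sη f)) : ℝ) : ℂ) * c.sum fun n a => (a : ℂ) * wave f (n / Δ))‖ ^ 2 < ε :=
          by
  have hXm := hX.measurable
  have hηm := hη.measurable
  have hS : IsPSD fun f => SX f + Sη f := ⟨hXm.add hηm, fun f => add_nonneg (hX.nonneg f)
      (hη.nonneg f),
    fun f => by rw [hX.even, hη.even]⟩
  set W : ℝ → ℝ := E.indicator fun f => (SX f + Sη f) / (1 + (SX f + Sη f)) ^ 2 with hWdef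
  have hWi : Integrable W := integrable_indicator_div_sq hS hE hEv
  have hW : IsPSD W := by
    refine ⟨Measurable.indicator (by fun_prop) hE, fun f => Set.indicator_nonneg (fun f _ => ?_) f,
      indicator_neg_eq (fun f => by rw [hX.even, hη.even]) hEs⟩
    have := hS.nonneg f
    positivity
  set q : ℝ → ℂ := fun f =>
    ((SX f / (SX f + Sη f) * (1 + (SX f + Sη f)) : ℝ) : ℂ) * wave f t with hqdef
  have hqm : Measurable q := by fun_prop
  have hpt (f : ℝ) (z : ℂ) : ‖q f - z‖ ^ 2 * W f = E.indicator (fun f =>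
      ‖(whitened SX Sη f : ℂ) * wave f t - (Real.sqrt (SX f + Sη f) : ℂ) *
        (((1 / (1 + (SX f + Sη f)) : ℝ) : ℂ) * z)‖ ^ 2) f := by
    by_cases h : f ∈ E
    · rw [hWdef, Set.indicator_of_mem h, Set.indicator_of_mem h, norm_sq_whitened_sub hX hη]
    · rw [hWdef, Set.indicator_of_notMem h, Set.indicator_of_notMem h, mul_zero]
  have hq : Integrable fun f => ‖q f‖ ^ 2 * W f := by
    refine ((integrable_wienerDensity hX hη hi).indicator hE).congr (ae_of_all _ fun f => ?_)
    have := hpt f 0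
    simp only [sub_zero, mul_zero] at this
    refine Eq.trans ?_ this.symm
    by_cases h : f ∈ E
    · rw [Set.indicator_of_mem h, Set.indicator_of_mem h, norm_mul, norm_wave, mul_one,
        Complex.norm_real, Real.norm_eq_abs, sq_abs, whitened_sq hX hη]
    · rw [Set.indicator_of_notMem h, Set.indicator_of_notMem h]
  have hac : psdMeasure W Eᶜ = 0 := by
    rw [psdMeasure, withDensity_apply _ hE.compl, setLIntegral_congr_fun (g := fun _ => 0) hE.compl
      (fun f hf => by rw [hWdef, Set.indicator_of_notMem hf, ENNReal.ofReal_zero])]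
    simp
  -- The sampling theorem in the form of a density statement: measures carried by the alias-free set
  -- `E` are determined by their integrals against the waves at the times `n / Δ`.
  obtain ⟨c, hc⟩ := exists_finsupp_real (τ := fun n : ℤ => (n : ℝ) / Δ) hW hWi hqm (fun f => by
      simp only [hqdef, hX.even, hη.even, map_mul, Complex.conj_ofReal, wave_neg_left]) hq
    (fun n => ⟨-n, by push_cast; ring⟩)
    (fun m₁ m₂ _ _ h₁ h₂ h => measure_eq_of_forall_integral_wave_int_eq hΔ hE hinj m₁ m₂ (h₁ hac)
      (h₂ hac) h) hε
  refine ⟨c, ?_⟩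
  rw [← integral_indicator hE]
  refine lt_of_eq_of_lt (integral_congr_ae (ae_of_all _ fun f => ?_)) hc
  exact ((hpt f _).trans (by by_cases h : f ∈ E <;> simp [h])).symm

lemma combResponse_sum_mapDomain (fs : ℝ) {P : ℕ} (H : Fin P → ℝ → ℂ) (c : Fin P → ℤ →₀ ℝ) (f : ℝ) :
    combResponse fs H (∑ p, (c p).mapDomain (Prod.mk p)) f
      = ∑ p, H p f * (c p).sum fun n a => (a : ℂ) * wave f ((n : ℝ) * (P : ℝ) / fs) := by
  rw [combResponse, ← Finsupp.sum_finsetSum_index (by simp) (by intros; push_cast; ring)]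
  refine Finset.sum_congr rfl fun p _ => ?_
  rw [Finsupp.sum_mapDomain_index (by simp) (by intros; push_cast; ring), Finsupp.mul_sum]
  refine Finsupp.sum_congr fun n _ => ?_
  ring

end

section

variable {Ω : Type*} [MeasurableSpace Ω] {μ : Measure Ω} [IsProbabilityMeasure μ] {SX Sη : ℝ → ℝ}
  {X : ℝ → Ω → ℝ} {η : {g : ℝ → ℂ // IsFilter Sη g} → Ω → ℝ}

/-- A bank of filters passing disjoint alias-free bands. -/
lemma mseAt_bandFilter_le (hm : IsNoisySource μ SX Sη X η) {P : ℕ} (hP : 0 < P) {fs : ℝ}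
    (hfs : 0 < fs) {E : Fin P → Set ℝ} (hE : ∀ p, MeasurableSet (E p))
    (hEv : ∀ p, volume (E p) < ⊤) (hEs : ∀ p f, -f ∈ E p ↔ f ∈ E p)
    (hinj : ∀ p, Set.InjOn ((↑) : ℝ → AddCircle (fs / P)) (E p))
    (hd : Pairwise (Function.onFun Disjoint E)) {Z : Fin P → ℝ → Ω → ℝ}
    (hZ : IsFilterBankOutput μ SX Sη X η (fun p => bandFilter (fun f => SX f + Sη f) (E p)) Z)
    (t : ℝ) :
    mseAt μ X (samples fs Z) t ≤ (∫ f, SX f) - ∑ p, ∫ f in E p, wienerDensity SX Sη f := by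
  have hX := hm.psd_signal
  have hi := hm.integrable_psd
  have hη := hm.psd_noise
  have hP' : (0 : ℝ) < P := Nat.cast_pos.2 hP
  have hΔ : 0 < fs / P := div_pos hfs hP'
  have hS : IsPSD fun f => SX f + Sη f := ⟨hX.measurable.add hη.measurable,
    fun f => add_nonneg (hX.nonneg f) (hη.nonneg f), fun f => by rw [hX.even, hη.even]⟩
  have hH p := isFilter_bandFilter hS (hE p) (hEv p) (hEs p)
  have hρ := integrable_wienerDensity hX hη hi
  refine le_of_forall_pos_le_add fun ε hε => ?_
  choose c hc using fun p => exists_setIntegral_band_lt hX hη hi hΔ (hE p) (hEv p) (hEs p) (hinj p)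
      t
    (div_pos hε hP')
  set C := ∑ p, (c p).mapDomain (Prod.mk p) with hC
  refine (mseAt_le_spectralError hm hH hZ fs t C).trans ?_
  set G := combResponse fs (fun p => bandFilter (fun f => SX f + Sη f) (E p)) C with hG
  have hGm : Measurable G := measurable_combResponse (fun p => (hH p).measurable) fs C
  have hG1 := integrable_combResponse hX (fun p => (hH p).measurable)
    (fun p => (hH p).integrable_left hX hη) fs C
  have hG2 := integrable_combResponse hη (fun p => (hH p).measurable)
    (fun p => (hH p).integrable_right hX hη) fs C
  rw [spectralError_eq hX hη hi t hGm hG1 hG2]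
  have hres := (integrable_residual hX hη hi t hGm hG1 hG2).2
  set R := fun f => ‖(whitened SX Sη f : ℂ) * wave f t - (Real.sqrt (SX f + Sη f) : ℂ) * G f‖ ^ 2
  set U := ⋃ p, E p with hU
  have hUm : MeasurableSet U := MeasurableSet.iUnion hE
  have hsum {g : ℝ → ℝ} (hg : Integrable g) : ∫ f in U, g f = ∑ p, ∫ f in E p, g f :=
    integral_iUnion_fintype hE hd fun p => hg.integrableOn
  -- Outside the bands nothing is transmitted and all of the recoverable power is lost. Inside band
  -- `p` only branch `p` is active, with a residual below `ε / P`.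
  have hout : ∫ f in Uᶜ, R f = ∫ f in Uᶜ, wienerDensity SX Sη f := by
    refine setIntegral_congr_fun hUm.compl fun f hf => ?_
    have : G f = 0 := by
      rw [hG, hC, combResponse_sum_mapDomain]
      refine Finset.sum_eq_zero fun p _ => ?_
      rw [bandFilter, Set.indicator_of_notMem fun h => hf (Set.mem_iUnion_of_mem p h)]
      simp
    simp only [R, this, mul_zero, sub_zero, norm_mul, norm_wave, mul_one,
        Complex.norm_real, Real.norm_eq_abs, sq_abs, whitened_sq hX hη]
  have hin (p : Fin P) : ∫ f in E p, R f < ε / P := by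
    refine lt_of_eq_of_lt (setIntegral_congr_fun (hE p) fun f hf => ?_) (hc p)
    have : G f = ((1 / (1 + (SX f + Sη f)) : ℝ) : ℂ) *
        (c p).sum fun n a => (a : ℂ) * wave f (n / (fs / P)) := by
      rw [hG, hC, combResponse_sum_mapDomain, Finset.sum_eq_single p]
      · rw [bandFilter, Set.indicator_of_mem hf]
        simp only [div_div_eq_mul_div]
      · intro p' _ hp'
        rw [bandFilter, Set.indicator_of_notMem fun h => Set.disjoint_left.1 (hd hp') h hf]
        simp
      · simp
    simp only [R, this]
  rw [← integral_add_compl hUm hres, ← integral_add_compl hUm hρ, hout, hsum hres, hsum hρ]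
  have : ∑ p, ∫ f in E p, R f ≤ ε := by
    refine (Finset.sum_le_sum fun p _ => (hin p).le).trans_eq ?_
    simp only [Finset.sum_const, Finset.card_univ, Fintype.card_fin, nsmul_eq_mul]
    field_simp
  linarith

lemma meanMse_bandFilter_le (hm : IsNoisySource μ SX Sη X η) {P : ℕ} (hP : 0 < P) {fs : ℝ}
    (hfs : 0 < fs) {E : Fin P → Set ℝ} (hE : ∀ p, MeasurableSet (E p))
    (hEv : ∀ p, volume (E p) < ⊤) (hEs : ∀ p f, -f ∈ E p ↔ f ∈ E p)
    (hinj : ∀ p, Set.InjOn ((↑) : ℝ → AddCircle (fs / P)) (E p))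
    (hd : Pairwise (Function.onFun Disjoint E)) {Z : Fin P → ℝ → Ω → ℝ}
    (hZ : IsFilterBankOutput μ SX Sη X η (fun p => bandFilter (fun f => SX f + Sη f) (E p)) Z) :
    meanMse μ X fs Z ≤ (∫ f, SX f) - ∑ p, ∫ f in E p, wienerDensity SX Sη f := by
  have hX := hm.psd_signal
  have hη := hm.psd_noise
  have hS : IsPSD fun f => SX f + Sη f := ⟨hX.measurable.add hη.measurable,
    fun f => add_nonneg (hX.nonneg f) (hη.nonneg f), fun f => by rw [hX.even, hη.even]⟩
  have hH p := isFilter_bandFilter hS (hE p) (hEv p) (hEs p)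
  have hτ : (0 : ℝ) < P / fs := div_pos (Nat.cast_pos.2 hP) hfs
  rw [meanMse, one_div, inv_mul_le_iff₀ hτ]
  refine (intervalIntegral.integral_mono_on hτ.le
    ((continuous_mseAt hm hH hZ fs).intervalIntegrable _ _) intervalIntegrable_const
    fun t _ => mseAt_bandFilter_le hm hP hfs hE hEv hEs hinj hd hZ t).trans_eq ?_
  rw [intervalIntegral.integral_const, sub_zero, smul_eq_mul]

end

end

/-! ### Replacing an optimal set by a union of cells -/

section

/-- The `j`-th symmetric pair of frequency intervals of length `h`. -/
def cell (h : ℝ) (j : ℕ) : Set ℝ := {f | j * h < |f| ∧ |f| < (j + 1) * h}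

lemma measurableSet_cell (h : ℝ) (j : ℕ) : MeasurableSet (cell h j) :=
  (measurableSet_lt measurable_const measurable_id.abs).inter
    (measurableSet_lt measurable_id.abs measurable_const)

lemma neg_mem_cell {h : ℝ} {j : ℕ} (f : ℝ) : -f ∈ cell h j ↔ f ∈ cell h j := by
  simp [cell]

lemma volume_cell {h : ℝ} (hh : 0 < h) (j : ℕ) : volume (cell h j) = ENNReal.ofReal (2 * h) := by
  have hj : 0 ≤ j * h := by positivity
  have : cell h j = Set.Ioo (j * h) ((j + 1) * h) ∪ Set.Ioo (-((j + 1) * h)) (-(j * h)) := by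
    ext f
    simp only [cell, Set.mem_ofPred_eq, Set.mem_union, Set.mem_Ioo, lt_abs, abs_lt]
    constructor
    · rintro ⟨h1 | h1, h2, h3⟩
      · exact Or.inl ⟨h1, h3⟩
      · exact Or.inr ⟨h2, by linarith⟩
    · rintro (⟨h1, h2⟩ | ⟨h1, h2⟩)
      · exact ⟨Or.inl h1, by linarith, h2⟩
      · exact ⟨Or.inr (by linarith), h1, by linarith⟩
  rw [this, measure_union _ measurableSet_Ioo, Real.volume_Ioo, Real.volume_Ioo,
    ← ENNReal.ofReal_add (by nlinarith) (by nlinarith)]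
  · congr 1; ring
  · refine Set.disjoint_left.2 fun f h1 h2 => ?_
    linarith [h1.1, h2.2]

lemma pairwise_disjoint_cell {h : ℝ} (hh : 0 < h) : Pairwise (Function.onFun Disjoint (cell h)) :=
    by
  have key {j k : ℕ} (hjk : j < k) : Disjoint (cell h j) (cell h k) := by
    refine Set.disjoint_left.2 fun f h1 h2 => ?_
    have h3 : (j : ℝ) + 1 ≤ k := by exact_mod_cast hjk
    have := mul_le_mul_of_nonneg_right h3 hh.le
    linarith [h1.2, h2.1]
  intro j k hjk
  rcases hjk.lt_or_gt with h1 | h1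
  · exact key h1
  · exact (key h1).symm

/-- Modulo `2h` the positive and the negative interval of the cell fall into different halves of a
period, whatever the parity of `j`. So the pair is alias-free although it is symmetric, as a real
filter demands. -/
lemma injOn_cell {h : ℝ} (hh : 0 < h) (j : ℕ) :
    Set.InjOn ((↑) : ℝ → AddCircle (2 * h)) (cell h j) := by
  intro f hf f' hf' hff'
  obtain ⟨k, hk⟩ := AddSubgroup.mem_zmultiples_iff.1 ((QuotientAddGroup.eq).1 hff')
  rw [zsmul_eq_mul] at hk
  obtain ⟨h1, h2⟩ := hf
  obtain ⟨h3, h4⟩ := hf'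
  have hj : 0 ≤ j * h := by positivity
  -- For points of opposite signs the distance lies strictly between `2jh` and `2(j + 1)h`, which
  -- leaves no room for a multiple of `2h`.
  have aux {m : ℤ} (a b : ℤ) (hab : b ≤ a + 1) (hm1 : (a : ℝ) * (2 * h) < m * (2 * h))
      (hm2 : (m : ℝ) * (2 * h) < b * (2 * h)) : False := by
    have h5 : (a : ℝ) < m := lt_of_mul_lt_mul_right hm1 (by positivity)
    have h6 : (m : ℝ) < b := lt_of_mul_lt_mul_right hm2 (by positivity)
    have h7 : a < m := by exact_mod_cast h5
    have h8 : m < b := by exact_mod_cast h6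
    omega
  rcases le_total 0 f with hf | hf <;> rcases le_total 0 f' with hf' | hf'
  · rw [abs_of_nonneg hf] at h1 h2
    rw [abs_of_nonneg hf'] at h3 h4
    have : k = 0 := by
      by_contra hne
      rcases lt_or_gt_of_ne hne with hlt | hlt
      · have : (k : ℝ) ≤ -1 := by exact_mod_cast Int.le_sub_one_of_lt hlt
        nlinarith
      · have : (1 : ℝ) ≤ k := by exact_mod_cast hlt
        nlinarith
    rw [this] at hk; push_cast at hk; linarith
  · rw [abs_of_nonneg hf] at h1 h2
    rw [abs_of_nonpos hf'] at h3 h4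
    refine (aux (m := k) (-(j + 1)) (-j) (by omega) ?_ ?_).elim <;> push_cast <;> linarith
  · rw [abs_of_nonpos hf] at h1 h2
    rw [abs_of_nonneg hf'] at h3 h4
    refine (aux (m := k) j (j + 1) (by omega) ?_ ?_).elim <;> push_cast <;> linarith
  · rw [abs_of_nonpos hf] at h1 h2
    rw [abs_of_nonpos hf'] at h3 h4
    have : k = 0 := by
      by_contra hne
      rcases lt_or_gt_of_ne hne with hlt | hlt
      · have : (k : ℝ) ≤ -1 := by exact_mod_cast Int.le_sub_one_of_lt hlt
        nlinarith
      · have : (1 : ℝ) ≤ k := by exact_mod_cast hlt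
        nlinarith
    rw [this] at hk; push_cast at hk; linarith

lemma volume_compl_iUnion_cell {h : ℝ} (hh : 0 < h) : volume (⋃ j, cell h j)ᶜ = 0 := by
  have hsub : (⋃ j, cell h j)ᶜ ⊆ (Set.range fun j : ℕ => (j : ℝ) * h) ∪
      Set.range fun j : ℕ => -((j : ℝ) * h) := by
    intro f hf
    have h1 := Nat.floor_le (div_nonneg (abs_nonneg f) hh.le)
    have h2 := Nat.lt_floor_add_one (|f| / h)
    rw [le_div_iff₀ hh] at h1
    rw [div_lt_iff₀ hh] at h2
    have h3 : (⌊|f| / h⌋₊ : ℝ) * h = |f| := by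
      by_contra hne
      exact hf (Set.mem_iUnion.2 ⟨⌊|f| / h⌋₊, lt_of_le_of_ne h1 hne, h2⟩)
    rcases abs_choice f with h4 | h4
    · exact Or.inl ⟨_, h3.trans h4⟩
    · exact Or.inr ⟨⌊|f| / h⌋₊, by linarith⟩
  exact measure_mono_null hsub
    (((Set.countable_range _).union (Set.countable_range _)).measure_zero _)

/-- An even integrable function is close in mean to a uniformly continuous one. -/
lemma exists_even_uniformContinuous_integral_sub_le {ρ : ℝ → ℝ} (hρ : Integrable ρ)
    (hρ0 : ∀ f, 0 ≤ ρ f) (hρe : ∀ f, ρ (-f) = ρ f) {ε : ℝ} (hε : 0 < ε) :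
    ∃ G : ℝ → ℝ, UniformContinuous G ∧ Integrable G ∧ (∀ f, 0 ≤ G f) ∧ (∀ f, G (-f) = G f) ∧
      ∫ f, |ρ f - G f| ≤ ε := by
  obtain ⟨g, hgs, hg, hgc, hgi⟩ := hρ.exists_hasCompactSupport_integral_sub_le hε
  have hgu : UniformContinuous g := hgc.uniformContinuous_of_tendsto_cocompact
    (hgs.is_zero_at_infty)
  have hu : UniformContinuous fun f => |g f| := uniformContinuous_norm.comp hgu
  -- Since `ρ` is nonnegative and even, neither the absolute value nor the symmetrization increases
  -- the `L¹` distance to it.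
  refine ⟨fun f => (1 / 2 : ℝ) • (|g f| + |g (-f)|), (hu.add (hu.comp
      uniformContinuous_neg)).const_smul (1 / 2 : ℝ),
    (hgi.abs.add hgi.comp_neg.abs).smul (1 / 2 : ℝ), fun f => by positivity,
    fun f => by simp only [neg_neg, add_comm], ?_⟩
  have hd : Integrable fun f => ‖ρ f - g f‖ := (hρ.sub hgi).norm
  have hd' : Integrable fun f => ‖ρ (-f) - g (-f)‖ := hd.comp_neg
  calc ∫ f, |ρ f - (1 / 2 : ℝ) • (|g f| + |g (-f)|)|
      ≤ ∫ f, (1 / 2 : ℝ) * (‖ρ f - g f‖ + ‖ρ (-f) - g (-f)‖) := by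
        refine integral_mono_of_nonneg (ae_of_all _ fun f => abs_nonneg _)
          ((hd.add hd').const_mul _) (ae_of_all _ fun f => ?_)
        have h1 := abs_abs_sub_abs_le_abs_sub (ρ f) (g f)
        have h2 := abs_abs_sub_abs_le_abs_sub (ρ f) (g (-f))
        rw [abs_of_nonneg (hρ0 f)] at h1 h2
        simp only [hρe, Real.norm_eq_abs, smul_eq_mul]
        rw [abs_le] at h1 h2 ⊢
        constructor <;> linarith
    _ = ∫ f, ‖ρ f - g f‖ := by
        rw [integral_const_mul, integral_add hd hd', integral_neg_eq_self fun f => ‖ρ f - g f‖]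
        ring
    _ ≤ ε := hg

lemma sum_setIntegral_le_integral {ι : Type*} {D : ℝ → ℝ} (hD : Integrable D) (hD0 : ∀ f, 0 ≤ D f)
    {A : ι → Set ℝ} (hA : ∀ i, MeasurableSet (A i)) (hd : Pairwise (Function.onFun Disjoint A))
    (J : Finset ι) : ∑ j ∈ J, ∫ f in A j, D f ≤ ∫ f, D f := by
  rw [← integral_biUnion_finset J (fun i _ => hA i) (hd.set_pairwise _) fun i _ => hD.integrableOn]
  exact setIntegral_le_integral hD (ae_of_all _ hD0)

/-- Any set of measure at most `P` cells can be replaced by a union of at most `P` cells, with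
little loss. -/
lemma exists_finset_setIntegral_le_sum_cell {ρ G : ℝ → ℝ} (hρ : Integrable ρ) (hG : Integrable G)
    (hG0 : ∀ f, 0 ≤ G f) (hGe : ∀ f, G (-f) = G f) {h δ : ℝ} (hh : 0 < h)
    (hδ : ∀ x y, |x - y| < h → |G x - G y| < δ) {P : ℕ} {F : Set ℝ} (hF : MeasurableSet F)
    (hFv : volume F ≤ ENNReal.ofReal (P * (2 * h))) {ε : ℝ} (hε : 0 < ε) :
    ∃ J : Finset ℕ, J.card ≤ P ∧ ∫ f in F, ρ f
      ≤ (∑ j ∈ J, ∫ f in cell h j, ρ f) + 2 * (∫ f, |ρ f - G f|) + 2 * δ * (P * (2 * h)) + ε := by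
  have hδ0 : 0 < δ := (abs_nonneg _).trans_lt (hδ 0 0 (by simpa using hh))
  have hmF (j : ℕ) : MeasurableSet (F ∩ cell h j) := hF.inter (measurableSet_cell h j)
  have hdF : Pairwise (Function.onFun Disjoint fun j => F ∩ cell h j) := fun j k hjk =>
    (pairwise_disjoint_cell hh hjk).mono Set.inter_subset_right Set.inter_subset_right
  have hFtop : volume F ≠ ⊤ := (hFv.trans_lt ENNReal.ofReal_lt_top).ne
  have hFr : volume.real F ≤ P * (2 * h) := ENNReal.toReal_le_of_le_ofReal (by positivity) hFv
  have hcr (j : ℕ) : volume.real (cell h j) = 2 * h := by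
    rw [Measure.real, volume_cell hh, ENNReal.toReal_ofReal (by positivity)]
  have hct (j : ℕ) : volume (cell h j) ≠ ⊤ := by rw [volume_cell hh]; exact ENNReal.ofReal_ne_top
  -- Evenness of `G` lets a single value serve both intervals of the cell.
  have hclose {j : ℕ} {f : ℝ} (hf : f ∈ cell h j) : |G f - G (j * h)| < δ := by
    have h1 : G f = G |f| := by
      rcases abs_choice f with h4 | h4 <;> rw [h4]
      rw [hGe]
    rw [h1]
    refine hδ _ _ ?_
    rw [abs_of_pos (by linarith [hf.1])]
    linarith [hf.2]
  have hDi : Integrable fun f => |ρ f - G f| := (hρ.sub hG).abs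
  set D := ∫ f, |ρ f - G f| with hD
  have hsum := hasSum_integral_iUnion (f := ρ) hmF hdF hρ.integrableOn
  have hFU : ∫ f in ⋃ j, F ∩ cell h j, ρ f = ∫ f in F, ρ f := by
    rw [← Set.inter_iUnion]
    refine setIntegral_congr_set ?_
    have : (⋃ j, cell h j) =ᵐ[volume] Set.univ := by
      rw [ae_eq_univ]; exact volume_compl_iUnion_cell hh
    simpa using (ae_eq_refl F).inter this
  rw [hFU] at hsum
  -- Truncation to finitely many cells costs the final `ε`; after it the exchange lemma applies,
  -- with weights the fractions of the cells covered by `F`.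
  obtain ⟨N, hN⟩ := ((tendsto_order.1 hsum.tendsto_sum_nat).1 ((∫ f in F, ρ f) - ε) (by
      linarith)).exists
  have hFsum : ∑ j ∈ Finset.range N, volume.real (F ∩ cell h j) ≤ P * (2 * h) := by
    refine le_trans ?_ hFr
    rw [← measureReal_biUnion_finset (hdF.set_pairwise _) fun j _ => hmF j]
    exact measureReal_mono (Set.iUnion₂_subset fun j _ => Set.inter_subset_left) hFtop
  obtain ⟨A, hA, hAsum⟩ := exists_finset_sum_mul_le P (fun j : Fin N => G (j * h))
    (fun j => volume.real (F ∩ cell h j) / (2 * h)) (fun _ => hG0 _) (fun _ => by positivity)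
    (fun j => by
      rw [div_le_one (by positivity), ← hcr j]
      exact measureReal_mono Set.inter_subset_right (hct j)) (by
      rw [← Finset.sum_div, div_le_iff₀ (by positivity)]
      exact (Fin.sum_univ_eq_sum_range (fun j => volume.real (F ∩ cell h j)) N).trans_le hFsum)
  rw [Fin.sum_univ_eq_sum_range (fun j => volume.real (F ∩ cell h j) / (2 * h) * G (j * h)) N]
    at hAsum
  have hAsum' : ∑ j ∈ A, G (j * h) = ∑ j ∈ A.map Fin.valEmbedding, G (j * h) := by
    rw [Finset.sum_map]; rfl
  rw [hAsum'] at hAsum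
  set J := A.map Fin.valEmbedding with hJ
  have hJc : J.card ≤ P := by rwa [hJ, Finset.card_map]
  refine ⟨J, hJc, ?_⟩
  -- Passing from `ρ` to the cell values of `G`, and back to `ρ` on the selected cells, costs each
  -- time at most `∫ |ρ - G|` plus `δ` times a measure at most `P (2h)`; hence the two factors `2`
  -- in the conclusion.
  have hup (j : ℕ) : ∫ f in F ∩ cell h j, ρ f ≤ (∫ f in F ∩ cell h j, |ρ f - G f|)
      + volume.real (F ∩ cell h j) * (G (j * h) + δ) := by
    have hfin : volume (F ∩ cell h j) ≠ ⊤ :=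
      ((measure_mono Set.inter_subset_left).trans_lt hFtop.lt_top).ne
    have hc : IntegrableOn (fun _ => G (j * h) + δ) (F ∩ cell h j) := integrableOn_const hfin
    rw [← smul_eq_mul, ← setIntegral_const, ← integral_add hDi.integrableOn hc]
    refine setIntegral_mono_on hρ.integrableOn (hDi.integrableOn.add hc) (hmF j) fun f hf => ?_
    have h1 := abs_lt.1 (hclose hf.2)
    have h2 := le_abs_self (ρ f - G f)
    linarith
  have hlow (j : ℕ) : 2 * h * G (j * h) ≤ (∫ f in cell h j, ρ f)
      + (∫ f in cell h j, |ρ f - G f|) + 2 * h * δ := by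
    have hc (x : ℝ) : IntegrableOn (fun _ => x) (cell h j) := integrableOn_const (hct j)
    have hv (x : ℝ) : 2 * h * x = ∫ _ in cell h j, x := by
      rw [setIntegral_const, hcr, smul_eq_mul]
    rw [hv, hv,
      ← integral_add hρ.integrableOn hDi.integrableOn,
      ← integral_add (f := fun f => ρ f + |ρ f - G f|) (hρ.integrableOn.add hDi.integrableOn) (hc
          δ)]
    refine setIntegral_mono_on (hc _) ((hρ.integrableOn.add hDi.integrableOn).add (hc δ))
      (measurableSet_cell h j) fun f hf => ?_
    have h1 := abs_lt.1 (hclose hf)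
    have h2 := neg_abs_le (ρ f - G f)
    linarith
  have e1 := Finset.sum_le_sum fun j (_ : j ∈ Finset.range N) => hup j
  have e2 := Finset.sum_le_sum fun j (_ : j ∈ J) => hlow j
  have e3 := sum_setIntegral_le_integral hDi (fun _ => abs_nonneg _) hmF hdF (Finset.range N)
  have e4 := sum_setIntegral_le_integral hDi (fun _ => abs_nonneg _) (measurableSet_cell h)
    (pairwise_disjoint_cell hh) J
  rw [Finset.sum_add_distrib] at e1
  rw [Finset.sum_add_distrib, Finset.sum_add_distrib, ← Finset.mul_sum, Finset.sum_const,
    nsmul_eq_mul] at e2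
  have e5 : ∑ j ∈ Finset.range N, volume.real (F ∩ cell h j) * (G (j * h) + δ)
      = 2 * h * (∑ j ∈ Finset.range N, volume.real (F ∩ cell h j) / (2 * h) * G (j * h))
        + δ * ∑ j ∈ Finset.range N, volume.real (F ∩ cell h j) := by
    rw [Finset.mul_sum, Finset.mul_sum, ← Finset.sum_add_distrib]
    refine Finset.sum_congr rfl fun j _ => ?_
    field_simp
  have e6 := mul_le_mul_of_nonneg_left hAsum (by positivity : 0 ≤ 2 * h)
  have e7 := mul_le_mul_of_nonneg_left hFsum hδ0.le
  have e8 : (J.card : ℝ) * (2 * h * δ) ≤ P * (2 * h * δ) :=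
    mul_le_mul_of_nonneg_right (Nat.cast_le.2 hJc) (by positivity)
  linarith

lemma eventually_exists_finset_setIntegral_le_sum_cell {ρ : ℝ → ℝ} (hρ : Integrable ρ)
    (hρ0 : ∀ f, 0 ≤ ρ f) (hρe : ∀ f, ρ (-f) = ρ f) {fs : ℝ} (hfs : 0 < fs) {F : Set ℝ}
    (hF : MeasurableSet F) (hFv : volume F ≤ ENNReal.ofReal fs) {ε : ℝ} (hε : 0 < ε) :
    ∀ᶠ P : ℕ in atTop, ∃ J : Finset ℕ, J.card = P ∧ ∫ f in F, ρ f
      ≤ (∑ j ∈ J, ∫ f in cell (fs / P / 2) j, ρ f) + ε := by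
  -- Budget: `2 · ε/6` for the `L¹` approximation, `ε/3` for the oscillation on cells and `ε/6` for
  -- the truncation, less than `ε` in total.
  obtain ⟨G, hGu, hG, hG0, hGe, hGρ⟩ := exists_even_uniformContinuous_integral_sub_le hρ hρ0 hρe
    (ε := ε / 6) (by positivity)
  obtain ⟨r, hr, hδ⟩ := Metric.uniformContinuous_iff.1 hGu (ε / (6 * fs)) (by positivity)
  have hlim : Tendsto (fun P : ℕ => fs / P / 2) atTop (𝓝 0) := by
    simpa using (tendsto_const_div_atTop_nhds_zero_nat fs).div_const 2
  filter_upwards [hlim.eventually (gt_mem_nhds hr), eventually_gt_atTop 0] with P hPr hP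
  have hP' : (0 : ℝ) < P := Nat.cast_pos.2 hP
  have hfsP : (P : ℝ) * (2 * (fs / P / 2)) = fs := by field_simp
  obtain ⟨J, hJ, h⟩ := exists_finset_setIntegral_le_sum_cell hρ hG hG0 hGe
    (by positivity : 0 < fs / P / 2) (fun x y hxy => hδ (hxy.trans hPr)) (P := P) hF
    (by rwa [hfsP]) (by positivity : 0 < ε / 6)
  -- Exactly `P` cells are needed to index the branches; additional cells only add nonnegative
  -- integrals.
  obtain ⟨J', hJ', hc⟩ := Infinite.exists_superset_card_eq J P hJ
  refine ⟨J', hc, ?_⟩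
  have h1 : ∑ j ∈ J, ∫ f in cell (fs / P / 2) j, ρ f ≤ ∑ j ∈ J', ∫ f in cell (fs / P / 2) j, ρ f :=
    Finset.sum_le_sum_of_subset_of_nonneg hJ' fun j _ _ => integral_nonneg hρ0
  have h2 : 2 * (ε / (6 * fs)) * (P * (2 * (fs / P / 2))) = ε / 3 := by
    rw [hfsP]; field_simp; norm_num
  linarith

end

/-! ### Convergence of the optimal error -/

section

section

variable {Ω : Type*} [MeasurableSpace Ω] {μ : Measure Ω} [IsProbabilityMeasure μ] {SX Sη : ℝ → ℝ}
  {X : ℝ → Ω → ℝ} {η : {g : ℝ → ℂ // IsFilter Sη g} → Ω → ℝ}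

/-- With sufficiently many branches the bound is attained up to `ε`. -/
lemma eventually_exists_meanMse_lt (hm : IsNoisySource μ SX Sη X η) {fs : ℝ} (hfs : 0 < fs) {ε : ℝ}
    (hε : 0 < ε) : ∀ᶠ P : ℕ in atTop, ∃ H : Fin P → ℝ → ℂ,
      (∀ p, IsFilter (fun f => SX f + Sη f) (H p)) ∧
      ∀ Z, IsFilterBankOutput μ SX Sη X η H Z → meanMse μ X fs Z < landauBound SX Sη fs + ε := by
  have hX := hm.psd_signal
  have hi := hm.integrable_psd
  have hη := hm.psd_noise
  have hS : IsPSD fun f => SX f + Sη f := ⟨hX.measurable.add hη.measurable,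
    fun f => add_nonneg (hX.nonneg f) (hη.nonneg f), fun f => by rw [hX.even, hη.even]⟩
  have hne : {r : ℝ | ∃ F : Set ℝ, MeasurableSet F ∧ volume F ≤ ENNReal.ofReal fs ∧
      r = ∫ f in F, SX f ^ 2 / (SX f + Sη f)}.Nonempty := ⟨_, ∅, MeasurableSet.empty, by simp, rfl⟩
  obtain ⟨_, ⟨F, hF, hFv, rfl⟩, hlt⟩ := exists_lt_of_lt_csSup hne (sub_lt_self _ (half_pos hε))
  filter_upwards [eventually_exists_finset_setIntegral_le_sum_cell
    (integrable_wienerDensity hX hη hi) (wienerDensity_nonneg hX hη) (wienerDensity_even hX hη)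
    hfs hF hFv (half_pos hε), eventually_gt_atTop 0] with P hJ hP
  obtain ⟨J, hJc, hJ⟩ := hJ
  have hP' : (0 : ℝ) < P := Nat.cast_pos.2 hP
  have hh : 0 < fs / P / 2 := by positivity
  set e := (J.equivFinOfCardEq hJc).symm with he
  set E : Fin P → Set ℝ := fun p => cell (fs / P / 2) (e p) with hE
  have hEv p : volume (E p) < ⊤ := by rw [hE, volume_cell hh]; exact ENNReal.ofReal_lt_top
  refine ⟨fun p => bandFilter (fun f => SX f + Sη f) (E p),
    fun p => isFilter_bandFilter hS (measurableSet_cell _ _) (hEv p) neg_mem_cell, fun Z hZ => ?_⟩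
  refine (meanMse_bandFilter_le hm hP hfs (fun p => measurableSet_cell _ _) hEv
    (fun p => neg_mem_cell) (fun p => ?_) (fun p p' hpp => ?_) hZ).trans_lt ?_
  · have h2 : 2 * (fs / P / 2) = fs / P := by ring
    have h3 := injOn_cell hh (e p)
    rwa [h2] at h3
  · exact pairwise_disjoint_cell hh fun h => hpp (e.injective (Subtype.ext h))
  · have hsum : ∑ p, ∫ f in E p, wienerDensity SX Sη f
        = ∑ j ∈ J, ∫ f in cell (fs / P / 2) j, wienerDensity SX Sη f := by
      rw [← Finset.sum_coe_sort J]
      exact e.sum_comp fun j : J => ∫ f in cell (fs / P / 2) j, wienerDensity SX Sη f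
    rw [hsum, landauBound]
    simp only [wienerDensity] at hJ ⊢
    linarith

lemma landauBound_le_of_hasMMSE (hm : IsNoisySource μ SX Sη X η) {P : ℕ} (hP : 0 < P) {fs : ℝ}
    (hfs : 0 < fs) {H : Fin P → ℝ → ℂ} (hH : ∀ p, IsFilter (fun f => SX f + Sη f) (H p))
    {Z : Fin P → ℝ → Ω → ℝ} (hZ : IsFilterBankOutput μ SX Sη X η H Z) {m : ℝ}
    (h : HasMMSE μ X (samples fs Z) m) : landauBound SX Sη fs ≤ m := by
  rw [tendsto_nhds_unique h (hasMMSE_meanMse hm hP hH hZ hfs)]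
  exact landauBound_le_meanMse hm hP hH hZ hfs

lemma optimalMMSE_le_meanMse (hm : IsNoisySource μ SX Sη X η) {P : ℕ} (hP : 0 < P) {fs : ℝ}
    (hfs : 0 < fs) {H : Fin P → ℝ → ℂ} (hH : ∀ p, IsFilter (fun f => SX f + Sη f) (H p))
    {Z : Fin P → ℝ → Ω → ℝ} (hZ : IsFilterBankOutput μ SX Sη X η H Z) :
    optimalMMSE μ SX Sη X η fs P ≤ meanMse μ X fs Z :=
  csInf_le ⟨_, fun _ ⟨_, _, hH, hZ, h⟩ => landauBound_le_of_hasMMSE hm hP hfs hH hZ h⟩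
    ⟨H, Z, hH, hZ, hasMMSE_meanMse hm hP hH hZ hfs⟩

/-- The bank of zero filters shows that the set of attainable errors is nonempty; the real infimum
of an empty set would be the default value `0`. -/
lemma landauBound_le_optimalMMSE (hm : IsNoisySource μ SX Sη X η) {P : ℕ} (hP : 0 < P) {fs : ℝ}
    (hfs : 0 < fs) : landauBound SX Sη fs ≤ optimalMMSE μ SX Sη X η fs P := by
  have hH (p : Fin P) : IsFilter (fun f => SX f + Sη f) ((fun _ _ => 0 : Fin P → ℝ → ℂ) p) :=
    ⟨measurable_const, fun _ => (map_zero _).symm, by simp⟩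
  obtain ⟨Z, hZ⟩ := exists_isFilterBankOutput hm hH
  exact le_csInf ⟨_, _, Z, hH, hZ, hasMMSE_meanMse hm hP hH hZ hfs⟩
    fun _ ⟨_, _, hH, hZ, h⟩ => landauBound_le_of_hasMMSE hm hP hfs hH hZ h

end

end

end SubNyquist

end

theorem mainTheorem12 {Ω : Type*} [MeasurableSpace Ω] (μ : Measure Ω) [IsProbabilityMeasure μ]
    (SX Sη : ℝ → ℝ) (hSX : SubNyquist.IsPSD SX) (hSX_int : Integrable SX)
    (hSη : SubNyquist.IsPSD Sη)
    (X : ℝ → Ω → ℝ) (hX : SubNyquist.IsStationaryGaussian μ SX X)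
    (η : {g : ℝ → ℂ // SubNyquist.IsFilter Sη g} → Ω → ℝ)
    (hη : SubNyquist.IsStationaryGaussianNoise μ Sη η)
    (hindep : IndepFun (fun ω t => X t ω) (fun ω g => η g ω) μ)
    (fs : ℝ) (hfs : 0 < fs) :
    -- every admissible filter bank has an output, its MMSE exists and obeys the lower bound
    (∀ (P : ℕ) (H : Fin P → ℝ → ℂ), 0 < P →
      (∀ p, SubNyquist.IsFilter (fun f => SX f + Sη f) (H p)) →
        (∃ Z, SubNyquist.IsFilterBankOutput μ SX Sη X η H Z) ∧
        ∀ Z, SubNyquist.IsFilterBankOutput μ SX Sη X η H Z →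
          ∃ m, SubNyquist.HasMMSE μ X (SubNyquist.samples fs Z) m ∧
            SubNyquist.landauBound SX Sη fs ≤ m) ∧
    -- for every `ε` some filter bank comes within `ε` of the lower bound
    (∀ ε > 0, ∃ (P : ℕ) (H : Fin P → ℝ → ℂ), 0 < P ∧
      (∀ p, SubNyquist.IsFilter (fun f => SX f + Sη f) (H p)) ∧
        ∀ Z, SubNyquist.IsFilterBankOutput μ SX Sη X η H Z →
          ∃ m, SubNyquist.HasMMSE μ X (SubNyquist.samples fs Z) m ∧
            SubNyquist.landauBound SX Sη fs ≤ SubNyquist.optimalMMSE μ SX Sη X η fs P ∧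
            SubNyquist.optimalMMSE μ SX Sη X η fs P ≤ m ∧
            m - ε < SubNyquist.landauBound SX Sη fs) ∧
    -- the optimal MMSE converges to the lower bound as the number of branches grows
    Tendsto (fun P : ℕ => SubNyquist.optimalMMSE μ SX Sη X η fs P) atTop
      (𝓝 (SubNyquist.landauBound SX Sη fs)) := by
  have hm : SubNyquist.IsNoisySource μ SX Sη X η := ⟨hSX, hSX_int, hSη, hX, hη, hindep⟩
  refine ⟨fun P H hP hH => ⟨SubNyquist.exists_isFilterBankOutput hm hH, fun Z hZ =>
    ⟨_, SubNyquist.hasMMSE_meanMse hm hP hH hZ hfs,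
      SubNyquist.landauBound_le_meanMse hm hP hH hZ hfs⟩⟩, fun ε hε => ?_, ?_⟩
  · obtain ⟨P, ⟨H, hH, h⟩, hP⟩ :=
      ((SubNyquist.eventually_exists_meanMse_lt hm hfs hε).and (eventually_gt_atTop 0)).exists
    exact ⟨P, H, hP, hH, fun Z hZ => ⟨_, SubNyquist.hasMMSE_meanMse hm hP hH hZ hfs,
      SubNyquist.landauBound_le_optimalMMSE hm hP hfs,
      SubNyquist.optimalMMSE_le_meanMse hm hP hfs hH hZ, by linarith [h Z hZ]⟩⟩
  -- Good banks exist for all large `P`, not only for some `P`, so the whole sequence converges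
  -- without any monotonicity in `P`.
  · refine tendsto_order.2 ⟨fun a ha => ?_, fun a ha => ?_⟩
    · filter_upwards [eventually_gt_atTop 0] with P hP
      exact ha.trans_le (SubNyquist.landauBound_le_optimalMMSE hm hP hfs)
    · filter_upwards [SubNyquist.eventually_exists_meanMse_lt hm hfs (sub_pos.2 ha),
        eventually_gt_atTop 0] with P ⟨H, hH, h⟩ hP
      obtain ⟨Z, hZ⟩ := SubNyquist.exists_isFilterBankOutput hm hH
      refine (SubNyquist.optimalMMSE_le_meanMse hm hP hfs hH hZ).trans_lt ?_
      linarith [h Z hZ]
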